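/- Let $K$ be a commutative semiring with $0\neq 1$, and let $O\subseteq\{=,\neq,\leq,\not\leq\}$. $K$ may be given together with a partial order $\leq$ making it an ordered semiring (that is, $a\le b\Rightarrow a+c\le b+c$, and $0\le a,\,0\le b\Rightarrow 0\le ab$); if $\leq\in O$ or $\not\leq\in O$, this is assumed to be the case. **Logic.** For a finite relational vocabulary $\tau$, the formulas of $\mathrm{FO}(O)$ are given by $\phi::=\alpha\mid\alpha\circ\alpha\mid(\phi\wedge\phi)\mid(\phi\vee\phi)\mid\exists x\,\phi\mid\forall x\,\phi$ with $\circ\in O$ and $\alpha::= x=y\mid x\neq y\mid R(\bar x)\mid\neg R(\bar x)\mid(\alpha\wedge\alpha)\mid(\alpha\vee\alpha)\mid\exists x\,\alpha\mid\forall x\,\alpha$. A $K$-interpretation over a nonempty finite set $A$ assigns a value in $K$ to each literal $R(\bar a)$, $\neg R(\bar a)$ ($R\in\tau$, $\bar a$ a tuple over $A$). The value $[\![\varphi]\!]_{\pi,s}\in K$ of $\varphi$ under a $K$-interpretation $\pi$ and an assignment $s$ is defined by: literals have the value given by $\pi$; $x=y$, $x\ne y$ and comparisons $\alpha\circ\beta$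 (of the values of $\alpha$ and $\beta$) have value $1$ or $0$ according to their truth; $\wedge,\vee$ are product and sum in $K$; $\forall,\exists$ are product and sum over all elements of $A$. **Problem.** $\mathrm{FO}_K(O)$-$\mathrm{MC}$ is the language of all words over $K$ that encode a tuple $(\tau,A,\varphi,s,\pi)$ with $[\![\varphi]\!]_{\pi,s}\neq0$, where $\tau$ is a finite relational vocabulary, $A$ is a nonempty finite set of natural numbers, $\varphi$ is an $\mathrm{FO}(O)$-formula over $\tau$, $s$ is an assignment of elements of $A$ to finitely many variables, among them all free variables of $\varphi$, and $\pi$ is a $K$-interpretation. The encoding consists of a self-delimiting binary code (with digits $0,1\in K$) of $\tau$ (number of relation symbols and their arities), $A$ (its cardinality and its elements in increasing order), $\varphi$ (in prefix notation) and $s$ (as a list of pairs), followed by the list of the values of all literals under $\pi$: for each relation symbol in turn, the positive literals and then the negated ones, each in lexicographic order of the arguments, where the value of a literal with a symbol of arity $0$ is repeated $|A|$ times. **Machines.** A $\mathrm{BSS}_K$ machine has a finite directed graph of nodes, with one input node and one output node, and works on sequences $x=(\dots,x_{-1},x_0\,\mathbf{.}\,x_1,x_2,\dots)$ over $K$ with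 finitely many nonzero entries. An input $(x_1,\dots,x_n)$ is placed in the state $(\dots,0,1,\dots,1,0\,\mathbf{.}\,x_1,\dots,x_n,0,\dots)$ with $n$ ones. A computation node sets a fixed coordinate to $x_j+x_k$, to $x_jx_k$ or to a constant $c\in K$; a branch node tests $x_1\leq x_2$ if $K$ is given as an ordered semiring, and $x_1=x_2$ otherwise; a shift node shifts the state by one position to the left or right. The output consists of the first $l$ positive coordinates, where $l$ is the number of consecutive ones in the coordinates $-1,-2,\dots$ A machine decides $L\subseteq K^*=\bigcup_n K^n$ if it halts on every input, with output $(1)$ for inputs in $L$ and $(0)$ for all others. It uses polynomial space if there is a polynomial $p$ such that on each input of length $n$ it uses at most $p(n)$ coordinates, where a coordinate $i\in\mathbb Z$ is used if $|i|\le n$, or if it has a nonzero entry at some moment of the computation, or if it is read or written by a visited node. $\mathsf{PSPACE}_K$ is the class of languages $L\subseteq K^*$ that are decided by a $\mathrm{BSS}_K$ machine in polynomial space. **Corollary.** $\mathrm{FO}_K(O)\text{-}\mathrm{MC}\in\mathsf{PSPACE}_K$ for every $O\subseteq\{=,\neq,\leq,\not\leq\}$, with the formula being part of the input. -/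

import Mathlib

noncomputable section

namespace SemiringFO

open scoped Classical

/-! ### Ordered semirings and comparison symbols -/

/-- The data making a semiring an ordered semiring: a partial order that is compatible with
addition and for which products of nonnegative elements are nonnegative. -/
structure SemiringOrder (K : Type*) [Semiring K] extends PartialOrder K where
  add_le_add_of_le : ∀ a b c : K, a ≤ b → a + c ≤ b + c
  zero_le_mul : ∀ a b : K, 0 ≤ a → 0 ≤ b → 0 ≤ a * b

/-- The comparison symbols `=`, `≠`, `≤`, `≰`. -/
inductive Cmp where
  | eq
  | ne
  | le
  | nle

/-- The relation on `K` denoted by a comparison symbol. Here and below, `ord = some o` means that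
`K` is regarded as ordered by `o`, and `ord = none` that `K` is a semiring without order (in that
case the symbols `≤` and `≰` are not available, and their value here is irrelevant). -/
def Cmp.Holds {K : Type*} [Semiring K] (ord : Option (SemiringOrder K)) : Cmp → K → K → Prop
  | .eq, a, b => a = b
  | .ne, a, b => a ≠ b
  | .le, a, b => ∃ o ∈ ord, o.le a b
  | .nle, a, b => ¬ ∃ o ∈ ord, o.le a b

/-! ### BSS machines over a semiring -/

/-- The state space `K_*` of bi-infinite sequences with finitely many nonzero entries. -/
abbrev State (K : Type*) [Semiring K] := ℤ →₀ K

/-- The value assigned to a coordinate by a computation node. -/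
inductive Op (K : Type*) where
  | add (j k : ℤ)
  | mul (j k : ℤ)
  | const (c : K)

/-- The value that an operation produces in state `x`. -/
def Op.value {K : Type*} [Semiring K] (x : State K) : Op K → K
  | .add j k => x j + x k
  | .mul j k => x j * x k
  | .const c => c

/-- The coordinates that an operation reads. -/
def Op.reads {K : Type*} : Op K → Set ℤ
  | .add j k => {j, k}
  | .mul j k => {j, k}
  | .const _ => ∅

/-- The nodes of a machine whose node labels form the type `V`. -/
inductive Node (K V : Type*) where
  | input (next : V)
  | output
  | comp (i : ℤ) (op : Op K) (next : V)
  | branch (nextMinus nextPlus : V)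
  | shiftLeft (next : V)
  | shiftRight (next : V)

/-- The coordinates that a node reads or writes (shifts act on the state as a whole). -/
def Node.touches {K V : Type*} : Node K V → Set ℤ
  | .comp i op _ => insert i op.reads
  | .branch _ _ => {1, 2}
  | _ => ∅

/-- A BSS machine over `K`. Its nodes are labelled by `0, …, last`; the first label is that of the
unique input node and the last label is that of the unique output node. -/
structure BSSMachine (K : Type*) where
  last : ℕ
  node : Fin (last + 1) → Node K (Fin (last + 1))
  input_iff : ∀ m, (∃ next, node m = Node.input next) ↔ m = 0
  output_iff : ∀ m, node m = Node.output ↔ m = Fin.last last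

/-- The input mapping: `(x₁, …, xₙ)` is placed in the state `(…, 0, 1, …, 1, 0 . x₁, …, xₙ, 0, …)`
with `n` ones in the coordinates `-n, …, -1`. -/
def inputMap {K : Type*} [Semiring K] (w : List K) : State K :=
  Finsupp.onFinset (Finset.Icc (-(w.length : ℤ)) (w.length : ℤ))
    (fun i => if 1 ≤ i then w.getD (i.toNat - 1) 0
      else if -(w.length : ℤ) ≤ i ∧ i ≤ -1 then 1 else 0)
    (by
      intro i hi
      rw [Finset.mem_Icc]
      by_cases h1 : 1 ≤ i
      · rw [if_pos h1] at hi
        by_contra hc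
        apply hi
        apply List.getD_eq_default
        omega
      · rw [if_neg h1] at hi
        by_cases h2 : -(w.length : ℤ) ≤ i ∧ i ≤ -1
        · omega
        · rw [if_neg h2] at hi
          exact absurd rfl hi)

/-- The number of consecutive ones in the coordinates `-1, -2, …`, starting from `-1`. -/
def outputLength {K : Type*} [Semiring K] (x : State K) : ℕ :=
  sInf {k : ℕ | x (-((k : ℤ) + 1)) ≠ 1}

/-- The output mapping: the first `outputLength x` positive coordinates. -/
def outputMap {K : Type*} [Semiring K] (x : State K) : List K :=
  List.ofFn fun i : Fin (outputLength x) => x ((i : ℤ) + 1)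

/-- The condition tested by branch nodes: `x₁ ≤ x₂` if `K` is ordered, and `x₁ = x₂` otherwise. -/
def BranchCond {K : Type*} [Semiring K] (ord : Option (SemiringOrder K)) (x : State K) : Prop :=
  match ord with
  | none => x 1 = x 2
  | some o => o.le (x 1) (x 2)

namespace BSSMachine

variable {K : Type*} [Semiring K]

/-- A configuration: a node and a state. -/
abbrev Config (M : BSSMachine K) := Fin (M.last + 1) × State K

/-- One computation step. A configuration at the output node is halted, hence does not change. The
input mapping is applied once, in the initial configuration. -/
def step (M : BSSMachine K) (ord : Option (SemiringOrder K)) (c : M.Config) : M.Config :=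
  match M.node c.1 with
  | .input next => (next, c.2)
  | .output => c
  | .comp i op next => (next, c.2.update i (op.value c.2))
  | .branch nextMinus nextPlus => (if BranchCond ord c.2 then nextMinus else nextPlus, c.2)
  | .shiftLeft next => (next, c.2.equivMapDomain (Equiv.subRight 1))
  | .shiftRight next => (next, c.2.equivMapDomain (Equiv.addRight 1))

/-- The configuration after `t` steps on input `w`. -/
def conf (M : BSSMachine K) (ord : Option (SemiringOrder K)) (w : List K) (t : ℕ) : M.Config :=
  (M.step ord)^[t] (0, inputMap w)

/-- `M` computes the total function `f`. -/
def Computes (M : BSSMachine K) (ord : Option (SemiringOrder K)) (f : List K → List K) : Prop :=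
  ∀ w, ∃ t, (M.conf ord w t).1 = Fin.last M.last ∧ outputMap (M.conf ord w t).2 = f w

/-- `M` decides the language `L`: it computes the characteristic function of `L`. -/
def Decides (M : BSSMachine K) (ord : Option (SemiringOrder K)) (L : Set (List K)) : Prop :=
  M.Computes ord fun w => if w ∈ L then [1] else [0]

/-- The coordinates of the state space used on input `w`: those of the input (including its unary
length), those that are nonzero at some moment, and those read or written by a visited node. -/
def usedCoords (M : BSSMachine K) (ord : Option (SemiringOrder K)) (w : List K) : Set ℤ :=
  Set.Icc (-(w.length : ℤ)) (w.length : ℤ) ∪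
    {i | ∃ t, (M.conf ord w t).2 i ≠ 0 ∨ i ∈ (M.node (M.conf ord w t).1).touches}

/-- `M` requires space `s`: on each input `w` it reaches the output node, using at most `s |w|`
coordinates. -/
def RequiresSpace (M : BSSMachine K) (ord : Option (SemiringOrder K)) (s : ℕ → ℕ) : Prop :=
  ∀ w : List K, (∃ t, (M.conf ord w t).1 = Fin.last M.last) ∧
    (M.usedCoords ord w).encard ≤ (s w.length : ℕ∞)

end BSSMachine

/-- The class of languages over `K` decided by a BSS machine over `K` in polynomial space. -/
def PSPACE {K : Type*} [Semiring K] (ord : Option (SemiringOrder K)) : Set (Set (List K)) :=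
  {L | ∃ M : BSSMachine K, M.Decides ord L ∧
    ∃ p : Polynomial ℕ, M.RequiresSpace ord fun n => p.eval n}

/-! ### First-order logic with formula (in)equality -/

/-- A finite relational vocabulary: finitely many relation symbols with their arities. -/
structure Vocabulary where
  num : ℕ
  ar : Fin num → ℕ

/-- Formulas built from literals, `∧`, `∨`, `∃`, `∀` and comparisons of formulas. Variables are
indexed by natural numbers. The comparisons that `FO(O)` allows are singled out by
`Formula.InFO`. -/
inductive Formula (τ : Vocabulary) where
  | eq (x y : ℕ)
  | ne (x y : ℕ)
  | rel (R : Fin τ.num) (x : Fin (τ.ar R) → ℕ)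
  | nrel (R : Fin τ.num) (x : Fin (τ.ar R) → ℕ)
  | and (φ ψ : Formula τ)
  | or (φ ψ : Formula τ)
  | ex (x : ℕ) (φ : Formula τ)
  | all (x : ℕ) (φ : Formula τ)
  | cmp (c : Cmp) (φ ψ : Formula τ)

/-- The literals `R(a₁, …, aₖ)` (`neg = false`) and `¬R(a₁, …, aₖ)` (`neg = true`) over a finite
set `A`. -/
structure Lit (τ : Vocabulary) (A : Finset ℕ) where
  neg : Bool
  R : Fin τ.num
  args : Fin (τ.ar R) → A

namespace Formula

variable {τ : Vocabulary}

/-- The formulas `α` of `FO`: those without comparisons. -/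
def IsFO : Formula τ → Prop
  | .eq _ _ => True
  | .ne _ _ => True
  | .rel _ _ => True
  | .nrel _ _ => True
  | .and φ ψ => φ.IsFO ∧ ψ.IsFO
  | .or φ ψ => φ.IsFO ∧ ψ.IsFO
  | .ex _ φ => φ.IsFO
  | .all _ φ => φ.IsFO
  | .cmp _ _ _ => False

/-- The formulas of `FO(O)`: comparisons are labelled by elements of `O`, and they are only applied
to formulas of `FO`. -/
def InFO (O : Set Cmp) : Formula τ → Prop
  | .eq _ _ => True
  | .ne _ _ => True
  | .rel _ _ => True
  | .nrel _ _ => True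
  | .and φ ψ => φ.InFO O ∧ ψ.InFO O
  | .or φ ψ => φ.InFO O ∧ ψ.InFO O
  | .ex _ φ => φ.InFO O
  | .all _ φ => φ.InFO O
  | .cmp c φ ψ => c ∈ O ∧ φ.IsFO ∧ ψ.IsFO

/-- The free variables of a formula. -/
def FV : Formula τ → Finset ℕ
  | .eq x y => {x, y}
  | .ne x y => {x, y}
  | .rel _ x => Finset.univ.image x
  | .nrel _ x => Finset.univ.image x
  | .and φ ψ => φ.FV ∪ ψ.FV
  | .or φ ψ => φ.FV ∪ ψ.FV
  | .ex x φ => φ.FV.erase x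
  | .all x φ => φ.FV.erase x
  | .cmp _ φ ψ => φ.FV ∪ ψ.FV

/-- The value of a formula in the semiring `K` under the `K`-interpretation `π` and the
assignment `s`. -/
def eval {K : Type*} [CommSemiring K] (ord : Option (SemiringOrder K)) {A : Finset ℕ}
    (π : Lit τ A → K) : Formula τ → (ℕ → A) → K
  | .eq x y, s => if s x = s y then 1 else 0
  | .ne x y, s => if s x ≠ s y then 1 else 0
  | .rel R x, s => π ⟨false, R, fun i => s (x i)⟩
  | .nrel R x, s => π ⟨true, R, fun i => s (x i)⟩
  | .and φ ψ, s => φ.eval ord π s * ψ.eval ord π s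
  | .or φ ψ, s => φ.eval ord π s + ψ.eval ord π s
  | .ex x φ, s => ∑ a : A, φ.eval ord π (Function.update s x a)
  | .all x φ, s => ∏ a : A, φ.eval ord π (Function.update s x a)
  | .cmp c φ ψ, s => if c.Holds ord (φ.eval ord π s) (ψ.eval ord π s) then 1 else 0

end Formula

/-! ### The model checking problem -/

/-- An assignment of elements of `A` to finitely many variables. -/
structure Assignment (A : Finset ℕ) where
  dom : Finset ℕ
  val : dom → A

/-- Extension of an assignment to all variables, by an arbitrary element of `A`. It is only used to
evaluate formulas whose free variables belong to the domain. -/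
def Assignment.extend {A : Finset ℕ} (s : Assignment A) (a : A) : ℕ → A :=
  fun x => if h : x ∈ s.dom then s.val ⟨x, h⟩ else a

/-- An instance of the model checking problem: a nonempty finite set `A` (of natural numbers, with
their order), a formula `φ` over a finite vocabulary, a `K`-interpretation `π`, and an assignment
`s` defined at least on the free variables of `φ`. -/
structure MCInstance (K : Type*) where
  voc : Vocabulary
  A : Finset ℕ
  nonempty : A.Nonempty
  φ : Formula voc
  s : Assignment A
  fv_subset : φ.FV ⊆ s.dom
  π : Lit voc A → K

/-- The value of the formula of an instance. -/
def MCInstance.value {K : Type*} [CommSemiring K] (ord : Option (SemiringOrder K))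
    (I : MCInstance K) : K :=
  I.φ.eval ord I.π (I.s.extend ⟨I.A.min' I.nonempty, I.A.min'_mem I.nonempty⟩)

/-! ### Encodings -/

/-- The elements of a finite set of natural numbers in increasing order. -/
def sortedElems (A : Finset ℕ) : List A :=
  List.ofFn fun i => A.orderIsoOfFin rfl i

/-- All `k`-tuples of elements of a list, in lexicographic order. -/
def tuples {α : Type*} (l : List α) : (k : ℕ) → List (Fin k → α)
  | 0 => [Fin.elim0]
  | k + 1 => l.flatMap fun a => (tuples l k).map fun t => Fin.cons a t

/-- The values of all literals with a given relation symbol and sign, in lexicographic order of the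
arguments. The value of a literal with a symbol of arity `0` is repeated `|A|` times. -/
def encLits {K : Type*} {τ : Vocabulary} {A : Finset ℕ} (π : Lit τ A → K) (R : Fin τ.num)
    (neg : Bool) : List K :=
  ((tuples (sortedElems A) (τ.ar R)).map fun t => π ⟨neg, R, t⟩).flatMap fun v =>
    if τ.ar R = 0 then List.replicate A.card v else [v]

/-- The encoding of a `K`-interpretation: the list of the values of all literals. -/
def encInterp {K : Type*} {τ : Vocabulary} {A : Finset ℕ} (π : Lit τ A → K) : List K :=
  (List.finRange τ.num).flatMap fun R => encLits π R false ++ encLits π R true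

/-- The code of a comparison symbol. -/
def Cmp.code : Cmp → ℕ
  | .eq => 0
  | .ne => 1
  | .le => 2
  | .nle => 3

/-- A formula in prefix notation, as a list of natural numbers. -/
def Formula.tokens {τ : Vocabulary} : Formula τ → List ℕ
  | .eq x y => [0, x, y]
  | .ne x y => [1, x, y]
  | .rel R x => 2 :: (R : ℕ) :: List.ofFn x
  | .nrel R x => 3 :: (R : ℕ) :: List.ofFn x
  | .and φ ψ => 4 :: (φ.tokens ++ ψ.tokens)
  | .or φ ψ => 5 :: (φ.tokens ++ ψ.tokens)
  | .ex x φ => 6 :: x :: φ.tokens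
  | .all x φ => 7 :: x :: φ.tokens
  | .cmp c φ ψ => (8 + c.code) :: (φ.tokens ++ ψ.tokens)

/-- A vocabulary as a list of natural numbers: the number of symbols and their arities. -/
def Vocabulary.tokens (τ : Vocabulary) : List ℕ :=
  τ.num :: List.ofFn τ.ar

/-- A finite set as a list of natural numbers: its cardinality and its elements. -/
def setTokens (A : Finset ℕ) : List ℕ :=
  A.card :: (sortedElems A).map fun a : A => a.1

/-- An assignment as a list of natural numbers: the number of variables in its domain, followed by
the pairs consisting of a variable and its value. -/
def Assignment.tokens {A : Finset ℕ} (s : Assignment A) : List ℕ :=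
  s.dom.card :: (sortedElems s.dom).flatMap fun x : s.dom => [x.1, (s.val x).1]

/-- The self-delimiting binary code of a natural number: a one before each binary digit (the least
significant digit comes first), and a zero at the end. -/
def natCode (n : ℕ) : List Bool :=
  (Nat.bits n).flatMap (fun b => [true, b]) ++ [false]

/-- The encoding of an instance as a word over `K`: the vocabulary, the set, the formula and the
assignment in binary (with the digits `0, 1 ∈ K`), followed by the encoding of the
interpretation. -/
def MCInstance.encode {K : Type*} [Semiring K] (I : MCInstance K) : List K :=
  (((I.voc.tokens ++ setTokens I.A ++ I.φ.tokens ++ I.s.tokens).flatMap natCode).map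
    fun b => if b then (1 : K) else 0) ++ encInterp I.π

/-- The model checking problem for `FO_K(O)`, as a language over `K`: the encodings of the
instances with a formula of `FO(O)` whose value is nonzero. -/
def MC {K : Type*} [CommSemiring K] (ord : Option (SemiringOrder K)) (O : Set Cmp) :
    Set (List K) :=
  {w | ∃ I : MCInstance K, I.φ.InFO O ∧ I.value ord ≠ 0 ∧ I.encode = w}

end SemiringFO

end

/-! The value of a formula is computed by recursion on its syntax. An element of `K` occupies a
single coordinate, however complicated it is, so space only counts how many elements are stored, and
the running time is irrelevant. The depth of the recursion is bounded by the length of the formula.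
A pending call keeps the operand values found so far, the environments of the calls still to be made
and a position in the input, all of polynomial size. The tree of all calls may be exponentially
large, but only one of its branches is stored at a time.

Three layers turn this into a machine. On the lowest one, structured programs are compiled to BSS
machines (`BSSMachine.gets_of_runs`), and four stacks are kept on the tape. A datum is a binary tree
with leaves in `K`, written in prefix order on a stack.

On the second layer, `PS ord f` says that some program replaces the code of `a` by that of `f a`,
within space polynomial in the size of the code. This class is closed under composition, pairing,
case distinction, loops with bounded data (`PS.loop`) and recursion with bounded depth and bounded
frames (`PS.recursion`). A truth-valued function in the class decides a language in `PSPACE`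
(`mem_PSPACE_of_ps`), so the rest is about functions and not about tapes.

On the third layer, the function `decideMC` is shown to belong to the class (`ps_decideMC`) and to
decide the problem (`decideMC_iff`). Its core `peval` parses and evaluates a formula at once. As the
assignment and the interpretation follow the formula in the code, `peval` runs twice: once over a
one-element universe, only to find the end of the formula, and then in earnest. Counts and arities
are written in binary and may be huge; they are cut off at a bound above the length of the input.
Nothing is lost, since that many items cannot be present in the word. -/

noncomputable section

namespace SemiringFO

open scoped Classical

set_option linter.unusedSectionVars false
set_option linter.unusedSimpArgs false

/-! ### Structured programs -/

section Programs

variable {K : Type*} [CommSemiring K]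

/-- The condition of a branch node, as a relation on `K`. -/
def BranchRel (ord : Option (SemiringOrder K)) (a b : K) : Prop :=
  match ord with
  | none => a = b
  | some o => o.le a b

/-- Structured programs for machines over `K`, with a moving head instead of a moving tape. -/
inductive Cmd (K : Type*) where
  | skip
  | set (i : ℤ) (op : Op K)
  | left
  | right
  | seq (c d : Cmd K)
  | ite (c d : Cmd K)
  | loop (c : Cmd K)

/-- The value of an operation on a tape given by a function. -/
def Op.val (f : ℤ → K) : Op K → K
  | .add j k => f j + f k
  | .mul j k => f j * f k
  | .const c => c

/-- `Runs ord B c (b, p) (b', p')`: the program `c`, started on the tape contents `b` with the head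
at `p`, terminates with contents `b'` and the head at `p'`, and the head always stays in
`[-B, B]`. -/
inductive Runs (ord : Option (SemiringOrder K)) (B : ℕ) :
    Cmd K → (ℤ → K) × ℤ → (ℤ → K) × ℤ → Prop where
  | skip (s) : Runs ord B .skip s s
  | set (i op b p) :
      Runs ord B (.set i op) (b, p)
        (Function.update b (p + i) (op.val fun j => b (p + j)), p)
  | left (b p) (h : |p - 1| ≤ (B : ℤ)) : Runs ord B .left (b, p) (b, p - 1)
  | right (b p) (h : |p + 1| ≤ (B : ℤ)) : Runs ord B .right (b, p) (b, p + 1)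
  | seq {c d s t u} (h₁ : Runs ord B c s t) (h₂ : Runs ord B d t u) : Runs ord B (.seq c d) s u
  | iteTrue {c d s t} (hc : BranchRel ord (s.1 (s.2 + 1)) (s.1 (s.2 + 2)))
      (h : Runs ord B c s t) : Runs ord B (.ite c d) s t
  | iteFalse {c d s t} (hc : ¬ BranchRel ord (s.1 (s.2 + 1)) (s.1 (s.2 + 2)))
      (h : Runs ord B d s t) : Runs ord B (.ite c d) s t
  | loopTrue {c s t u} (hc : BranchRel ord (s.1 (s.2 + 1)) (s.1 (s.2 + 2)))
      (h₁ : Runs ord B c s t) (h₂ : Runs ord B (.loop c) t u) : Runs ord B (.loop c) s u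
  | loopFalse {c s} (hc : ¬ BranchRel ord (s.1 (s.2 + 1)) (s.1 (s.2 + 2))) :
      Runs ord B (.loop c) s s

/-- The number of nodes of the compiled program. -/
def Cmd.len : Cmd K → ℕ
  | .skip => 1
  | .set _ _ => 1
  | .left => 1
  | .right => 1
  | .seq c d => c.len + d.len
  | .ite c d => 1 + c.len + d.len
  | .loop c => 1 + c.len

/-- The compiled program, placed at the label `b`, with exit `e`. -/
def Cmd.compile : Cmd K → ℕ → ℕ → List (Node K ℕ)
  -- No node does nothing, so a branch with equal exits serves.
  | .skip, _, e => [.branch e e]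
  | .set i op, _, e => [.comp i op e]
  -- The tape moves in the direction opposite to the head.
  | .left, _, e => [.shiftRight e]
  | .right, _, e => [.shiftLeft e]
  | .seq c d, b, e => c.compile b (b + c.len) ++ d.compile (b + c.len) e
  | .ite c d, b, e =>
      .branch (b + 1) (b + 1 + c.len) :: (c.compile (b + 1) e ++ d.compile (b + 1 + c.len) e)
  | .loop c, b, e => .branch (b + 1) e :: c.compile (b + 1) b

theorem Cmd.length_compile (c : Cmd K) (b e : ℕ) : (c.compile b e).length = c.len := by
  induction c generalizing b e with
  | seq c d hc hd => simp [compile, len, hc, hd]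
  | ite c d hc hd => simp [compile, len, hc, hd]; omega
  | loop c hc => simp [compile, len, hc]; omega
  | _ => rfl

/-- Relabelling of nodes. -/
def Node.map {V W : Type*} (f : V → W) : Node K V → Node K W
  | .input n => .input (f n)
  | .output => .output
  | .comp i op n => .comp i op (f n)
  | .branch m n => .branch (f m) (f n)
  | .shiftLeft n => .shiftLeft (f n)
  | .shiftRight n => .shiftRight (f n)

/-- Nodes that are neither input nor output nodes. -/
def Node.Inner {V : Type*} : Node K V → Prop
  | .input _ => False
  | .output => False
  | _ => True

theorem Cmd.inner_compile (c : Cmd K) (b e : ℕ) : ∀ n ∈ c.compile b e, n.Inner := by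
  induction c generalizing b e with
  | seq c d hc hd =>
    intro n hn
    rcases List.mem_append.1 hn with h | h
    exacts [hc _ _ _ h, hd _ _ _ h]
  | ite c d hc hd =>
    intro n hn
    rcases List.mem_cons.1 hn with rfl | hn
    · trivial
    rcases List.mem_append.1 hn with h | h
    exacts [hc _ _ _ h, hd _ _ _ h]
  | loop c hc =>
    intro n hn
    rcases List.mem_cons.1 hn with rfl | hn
    · trivial
    exact hc _ _ _ hn
  | _ =>
    intro n hn
    rcases List.mem_singleton.1 hn with rfl
    trivial

/-- The nodes of the machine that runs a program once, with labels in `ℕ`. -/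
def Cmd.label (c : Cmd K) (m : ℕ) : Node K ℕ :=
  (Node.input 1 :: (c.compile 1 (c.len + 1) ++ [Node.output])).getD m Node.output

theorem Cmd.label_zero (c : Cmd K) : c.label 0 = .input 1 := rfl

theorem Cmd.label_succ (c : Cmd K) {j : ℕ} (hj : j < c.len) :
    c.label (j + 1) = (c.compile 1 (c.len + 1))[j]'(by rwa [c.length_compile]) := by
  unfold label
  rw [List.getD_cons_succ, List.getD_append _ _ _ _ (by rwa [c.length_compile]),
    List.getD_eq_getElem _ _ (by rwa [c.length_compile])]

theorem Cmd.label_last (c : Cmd K) {j : ℕ} (hj : c.len ≤ j) : c.label (j + 1) = .output := by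
  unfold label
  rw [List.getD_cons_succ, List.getD_append_right _ _ _ _ (by rwa [c.length_compile]),
    c.length_compile]
  rcases j - c.len with _ | k <;> rfl

theorem Cmd.inner_label (c : Cmd K) {j : ℕ} (hj : j < c.len) : (c.label (j + 1)).Inner := by
  rw [c.label_succ hj]
  exact c.inner_compile _ _ _ (List.getElem_mem _)

/-- The machine that runs a program once. -/
def Cmd.machine (c : Cmd K) : BSSMachine K where
  last := c.len + 1
  node m := (c.label m).map (Fin.ofNat (c.len + 1 + 1))
  input_iff m := by
    rcases m with ⟨_ | m, hm⟩
    · simp [Node.map, label_zero]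
    · simp only [Fin.ext_iff]
      constructor
      · rintro ⟨n, hn⟩
        exfalso
        rcases Nat.lt_or_ge m c.len with h | h
        · have := c.inner_label h
          revert hn this
          cases c.label (m + 1) <;> simp [Node.map, Node.Inner]
        · rw [c.label_last h] at hn
          simp [Node.map] at hn
      · intro h
        simp at h
  output_iff m := by
    rcases m with ⟨_ | m, hm⟩
    · simp [Node.map, Fin.ext_iff, label_zero]
    · simp only [Fin.ext_iff, Fin.val_last]
      rcases Nat.lt_or_ge m c.len with h | h
      · have := c.inner_label h
        constructor
        · revert this
          cases c.label (m + 1) <;> simp [Node.map, Node.Inner]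
        · omega
      · rw [c.label_last h]
        simp [Node.map]
        omega

theorem Cmd.machine_node_zero (c : Cmd K) : c.machine.node 0 = .input (Fin.ofNat _ 1) := rfl

theorem Cmd.machine_node_last (c : Cmd K) :
    c.machine.node (Fin.last _) = .output :=
  (c.machine.output_iff _).2 rfl

theorem Cmd.machine_node (c : Cmd K) (j : ℕ) (hj : j < c.len) :
    c.machine.node (Fin.ofNat _ (1 + j)) =
      ((c.compile 1 (c.len + 1))[j]'(by rwa [c.length_compile])).map
        (Fin.ofNat (c.machine.last + 1)) := by
  have h1 : ((Fin.ofNat (c.machine.last + 1) (1 + j) : Fin (c.machine.last + 1)) : ℕ) = j + 1 := by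
    simp only [Fin.ofNat, machine]
    rw [Nat.mod_eq_of_lt (by omega), Nat.add_comm]
  change (c.label ((Fin.ofNat (c.machine.last + 1) (1 + j) : Fin _) : ℕ)).map _ = _
  rw [h1, c.label_succ hj]
  rfl

/-- The program `c` occupies the labels of `M` from `b` on, with exit `e`. -/
def BSSMachine.Placed (M : BSSMachine K) (c : Cmd K) (b e : ℕ) : Prop :=
  ∀ j (hj : j < c.len), M.node (Fin.ofNat _ (b + j)) =
    ((c.compile b e)[j]'(by rwa [c.length_compile])).map (Fin.ofNat (M.last + 1))

theorem BSSMachine.Placed.seq {M : BSSMachine K} {c d : Cmd K} {b e : ℕ}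
    (h : M.Placed (.seq c d) b e) : M.Placed c b (b + c.len) ∧ M.Placed d (b + c.len) e := by
  constructor
  · intro j hj
    rw [h j (by simp only [Cmd.len]; omega)]
    simp only [Cmd.compile]
    rw [List.getElem_append_left]
  · intro j hj
    have := h (c.len + j) (by simp only [Cmd.len]; omega)
    rw [← add_assoc] at this
    rw [this]
    simp only [Cmd.compile]
    rw [List.getElem_append_right (by rw [c.length_compile]; omega)]
    simp [c.length_compile]

theorem BSSMachine.Placed.ite {M : BSSMachine K} {c d : Cmd K} {b e : ℕ}
    (h : M.Placed (.ite c d) b e) :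
    M.node (Fin.ofNat _ b) = .branch (Fin.ofNat _ (b + 1)) (Fin.ofNat _ (b + 1 + c.len)) ∧
    M.Placed c (b + 1) e ∧ M.Placed d (b + 1 + c.len) e := by
  refine ⟨h 0 (by simp only [Cmd.len]; omega), ?_, ?_⟩
  · intro j hj
    have := h (1 + j) (by simp only [Cmd.len]; omega)
    rw [← add_assoc] at this
    rw [this]
    simp only [Cmd.compile]
    rw [List.getElem_cons, dif_neg (by omega),
      List.getElem_append_left (by rw [c.length_compile]; omega)]
    simp
  · intro j hj
    have := h (1 + c.len + j) (by simp only [Cmd.len]; omega)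
    rw [← add_assoc, ← add_assoc] at this
    rw [this]
    simp only [Cmd.compile]
    rw [List.getElem_cons, dif_neg (by omega),
      List.getElem_append_right (by rw [c.length_compile]; omega)]
    congr 2
    rw [c.length_compile]; omega

theorem BSSMachine.Placed.loop {M : BSSMachine K} {c : Cmd K} {b e : ℕ}
    (h : M.Placed (.loop c) b e) :
    M.node (Fin.ofNat _ b) = .branch (Fin.ofNat _ (b + 1)) (Fin.ofNat _ e) ∧
    M.Placed c (b + 1) b := by
  refine ⟨h 0 (by simp only [Cmd.len]; omega), ?_⟩
  intro j hj
  have := h (1 + j) (by simp only [Cmd.len]; omega)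
  rw [← add_assoc] at this
  rw [this]
  simp only [Cmd.compile]
  rw [List.getElem_cons, dif_neg (by omega)]
  simp

/-- All coordinates (relative to the head) that are written have absolute value at most `T`. -/
def Cmd.Within (T : ℕ) : Cmd K → Prop
  | .set i _ => |i| ≤ T
  | .seq c d => c.Within T ∧ d.Within T
  | .ite c d => c.Within T ∧ d.Within T
  | .loop c => c.Within T
  | _ => True

theorem Cmd.Within.mono {c : Cmd K} {T U : ℕ} (h : T ≤ U) (hc : c.Within T) : c.Within U := by
  induction c with
  | set i _ => exact le_trans (show |i| ≤ T from hc) (by exact_mod_cast h)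
  | seq _ _ h₁ h₂ => exact ⟨h₁ hc.1, h₂ hc.2⟩
  | ite _ _ h₁ h₂ => exact ⟨h₁ hc.1, h₂ hc.2⟩
  | loop _ h => exact h hc
  | _ => trivial

theorem Cmd.exists_within (c : Cmd K) : ∃ T, c.Within T := by
  induction c with
  | set i _ => exact ⟨i.natAbs, by simp [Within]⟩
  | seq _ _ h₁ h₂ =>
    obtain ⟨T, hT⟩ := h₁
    obtain ⟨U, hU⟩ := h₂
    exact ⟨max T U, hT.mono (le_max_left _ _), hU.mono (le_max_right _ _)⟩
  | ite _ _ h₁ h₂ =>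
    obtain ⟨T, hT⟩ := h₁
    obtain ⟨U, hU⟩ := h₂
    exact ⟨max T U, hT.mono (le_max_left _ _), hU.mono (le_max_right _ _)⟩
  | loop _ h => exact h
  | _ => exact ⟨0, trivial⟩

/-- The state `x` shows the tape contents of the head configuration `s`, of which head position and
support are bounded. -/
def Shows (B W : ℕ) (s : (ℤ → K) × ℤ) (x : State K) : Prop :=
  (∀ i, x i = s.1 (s.2 + i)) ∧ |s.2| ≤ B ∧ ∀ a, s.1 a ≠ 0 → |a| ≤ W

/-- `M` gets from the first configuration to the second one, with states satisfying `G`. -/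
def BSSMachine.Gets (M : BSSMachine K) (ord : Option (SemiringOrder K)) (G : State K → Prop)
    (c d : M.Config) : Prop :=
  ∃ t, (M.step ord)^[t] c = d ∧ ∀ k ≤ t, G ((M.step ord)^[k] c).2

theorem BSSMachine.Gets.trans {M : BSSMachine K} {ord : Option (SemiringOrder K)}
    {G : State K → Prop} {c d e : M.Config} (h₁ : M.Gets ord G c d) (h₂ : M.Gets ord G d e) :
    M.Gets ord G c e := by
  obtain ⟨t, rfl, ht⟩ := h₁
  obtain ⟨u, rfl, hu⟩ := h₂
  refine ⟨u + t, Function.iterate_add_apply _ _ _ _, fun k hk => ?_⟩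
  rcases le_total k t with h | h
  · exact ht k h
  · obtain ⟨j, rfl⟩ := Nat.exists_eq_add_of_le h
    rw [add_comm t j, Function.iterate_add_apply]
    exact hu j (by omega)

theorem BSSMachine.Gets.step {M : BSSMachine K} {ord : Option (SemiringOrder K)}
    {G : State K → Prop} {c d : M.Config} (h : M.step ord c = d) (hc : G c.2) (hd : G d.2) :
    M.Gets ord G c d := by
  refine ⟨1, h, fun k hk => ?_⟩
  interval_cases k
  · exact hc
  · change G (M.step ord c).2
    rwa [h]

/-- Correctness of the compiler. The induction is on the run and not on the program, because a loop
returns to its own code: the second premise of `loopTrue` is a run of the same placed program. A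
write is at most `T` away from a head that is at most `B` away from the origin, which explains `B +
T ≤ W`. -/
theorem BSSMachine.gets_of_runs {M : BSSMachine K} {ord : Option (SemiringOrder K)} {B W T : ℕ}
    (hW : B + T ≤ W) {c : Cmd K} {s s' : (ℤ → K) × ℤ} (h : Runs ord B c s s') :
    ∀ {b e : ℕ}, M.Placed c b e → c.Within T → ∀ x, Shows B W s x →
      ∃ x', Shows B W s' x' ∧ M.Gets ord (fun y => ∃ s, Shows B W s y)
        (Fin.ofNat _ b, x) (Fin.ofNat _ e, x') := by
  induction h with
  | skip s =>
    intro b e hM _ x hx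
    refine ⟨x, hx, .step ?_ ⟨s, hx⟩ ⟨s, hx⟩⟩
    have := hM 0 (by simp [Cmd.len])
    simp only [add_zero, Cmd.compile, List.getElem_cons_zero, Node.map] at this
    simp only [BSSMachine.step, this, ite_self]
  | set i op a p =>
    intro b e hM hT x hx
    have hs : Shows B W (Function.update a (p + i) (op.val fun j => a (p + j)), p)
        (x.update i (op.value x)) := by
      refine ⟨fun j => ?_, hx.2.1, fun j hj => ?_⟩
      · have hv : op.value x = op.val fun j => a (p + j) := by
          cases op <;> simp [Op.value, Op.val, hx.1]
        rw [Finsupp.update_apply, hv]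
        by_cases hj : j = i
        · simp [hj]
        · simp [hj, hx.1]
      · by_cases hji : j = p + i
        · rw [hji]
          have h1 : |p| ≤ B := hx.2.1
          have h2 : |i| ≤ T := hT
          have := abs_add_le p i
          omega
        · exact hx.2.2 j (by simpa [Function.update_of_ne hji] using hj)
    refine ⟨_, hs, .step ?_ ⟨_, hx⟩ ⟨_, hs⟩⟩
    have := hM 0 (by simp [Cmd.len])
    simp only [add_zero, Cmd.compile, List.getElem_cons_zero, Node.map] at this
    simp only [BSSMachine.step, this]
  | left a p h =>
    intro b e hM _ x hx
    have hs : Shows B W (a, p - 1) (x.equivMapDomain (Equiv.addRight 1)) := by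
      refine ⟨fun j => ?_, h, hx.2.2⟩
      rw [Finsupp.equivMapDomain_apply, hx.1]
      simp only [Equiv.addRight_symm_apply]
      congr 1; ring
    refine ⟨_, hs, .step ?_ ⟨_, hx⟩ ⟨_, hs⟩⟩
    have := hM 0 (by simp [Cmd.len])
    simp only [add_zero, Cmd.compile, List.getElem_cons_zero, Node.map] at this
    simp only [BSSMachine.step, this]
  | right a p h =>
    intro b e hM _ x hx
    have hs : Shows B W (a, p + 1) (x.equivMapDomain (Equiv.subRight 1)) := by
      refine ⟨fun j => ?_, h, hx.2.2⟩
      rw [Finsupp.equivMapDomain_apply, hx.1]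
      simp only [Equiv.subRight_symm_apply]
      congr 1; ring
    refine ⟨_, hs, .step ?_ ⟨_, hx⟩ ⟨_, hs⟩⟩
    have := hM 0 (by simp [Cmd.len])
    simp only [add_zero, Cmd.compile, List.getElem_cons_zero, Node.map] at this
    simp only [BSSMachine.step, this]
  | seq _ _ ih₁ ih₂ =>
    intro b e hM hT x hx
    obtain ⟨y, hy, h1⟩ := ih₁ hM.seq.1 hT.1 x hx
    obtain ⟨z, hz, h2⟩ := ih₂ hM.seq.2 hT.2 y hy
    exact ⟨z, hz, h1.trans h2⟩
  | iteTrue hc _ ih =>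
    intro b e hM hT x hx
    obtain ⟨y, hy, h1⟩ := ih hM.ite.2.1 hT.1 x hx
    refine ⟨y, hy, .trans (.step ?_ ⟨_, hx⟩ ⟨_, hx⟩) h1⟩
    rw [← hx.1, ← hx.1] at hc
    replace hc : BranchCond ord x := by cases ord <;> exact hc
    simp only [BSSMachine.step, hM.ite.1, hc, if_true, if_false]
  | iteFalse hc _ ih =>
    intro b e hM hT x hx
    obtain ⟨y, hy, h1⟩ := ih hM.ite.2.2 hT.2 x hx
    refine ⟨y, hy, .trans (.step ?_ ⟨_, hx⟩ ⟨_, hx⟩) h1⟩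
    rw [← hx.1, ← hx.1] at hc
    replace hc : ¬ BranchCond ord x := by cases ord <;> exact hc
    simp only [BSSMachine.step, hM.ite.1, hc, if_true, if_false]
  | loopTrue hc _ _ ih₁ ih₂ =>
    intro b e hM hT x hx
    obtain ⟨y, hy, h1⟩ := ih₁ hM.loop.2 hT x hx
    obtain ⟨z, hz, h2⟩ := ih₂ hM hT y hy
    refine ⟨z, hz, .trans (.step ?_ ⟨_, hx⟩ ⟨_, hx⟩) (h1.trans h2)⟩
    rw [← hx.1, ← hx.1] at hc
    replace hc : BranchCond ord x := by cases ord <;> exact hc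
    simp only [BSSMachine.step, hM.loop.1, hc, if_true, if_false]
  | loopFalse hc =>
    intro b e hM hT x hx
    refine ⟨x, hx, .step ?_ ⟨_, hx⟩ ⟨_, hx⟩⟩
    rw [← hx.1, ← hx.1] at hc
    replace hc : ¬ BranchCond ord x := by cases ord <;> exact hc
    simp only [BSSMachine.step, hM.loop.1, hc, if_true, if_false]

/-- Coordinates that are read count as used even while they are zero, so a bound on the support is
not enough. There are finitely many nodes, and each touches finitely many coordinates. -/
theorem Cmd.exists_touches (c : Cmd K) (b e : ℕ) :
    ∃ U : ℕ, ∀ n ∈ c.compile b e, ∀ i ∈ n.touches, |i| ≤ U := by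
  induction c.compile b e with
  | nil => exact ⟨0, by simp⟩
  | cons n l ih =>
    obtain ⟨U, hU⟩ := ih
    obtain ⟨V, hV⟩ : ∃ V : ℕ, ∀ i ∈ n.touches, |i| ≤ V := by
      have hf : n.touches.Finite := by
        unfold Node.touches
        split
        · rename_i op _
          cases op <;> simp [Op.reads]
        · simp
        · simp
      obtain ⟨V, hV⟩ := (hf.image Int.natAbs).bddAbove
      exact ⟨V, fun i hi => by
        have := hV (Set.mem_image_of_mem _ hi)
        rw [Int.abs_eq_natAbs]
        exact_mod_cast this⟩
    refine ⟨max U V, fun m hm i hi => ?_⟩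
    rcases List.mem_cons.1 hm with rfl | hm
    · have := hV i hi
      omega
    · have := hU m hm i hi
      omega

theorem Cmd.exists_machine_touches (c : Cmd K) :
    ∃ U : ℕ, ∀ m, ∀ i ∈ (c.machine.node m).touches, |i| ≤ U := by
  obtain ⟨U, hU⟩ := c.exists_touches 1 (c.len + 1)
  refine ⟨U, fun m i hi => ?_⟩
  have hi : i ∈ (c.label m).touches := by
    change i ∈ Node.touches (Node.map _ (c.label m)) at hi
    revert hi
    cases c.label m <;> exact id
  rcases m with ⟨_ | m, hm⟩
  · simp [Node.touches, Cmd.label_zero] at hi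
  · rcases Nat.lt_or_ge m c.len with h | h
    · simp only [c.label_succ h] at hi
      exact hU _ (List.getElem_mem _) i hi
    · simp [c.label_last h, Node.touches] at hi

/-- A program that leaves the characteristic function of `L` at the head, with a polynomial bound on
the head positions, gives a decision procedure in polynomial space. -/
theorem mem_PSPACE_of_runs [Nontrivial K] {ord : Option (SemiringOrder K)} {L : Set (List K)}
    (c : Cmd K) (q : Polynomial ℕ)
    (h : ∀ w : List K, ∃ p b' p', |p| ≤ ((q.eval w.length : ℕ) : ℤ) ∧
      Runs ord (q.eval w.length) c (fun a => inputMap w (a - p), p) (b', p') ∧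
      b' (p' - 1) = 1 ∧ b' (p' - 2) = 0 ∧ b' (p' + 1) = if w ∈ L then 1 else 0) :
    L ∈ PSPACE ord := by
  obtain ⟨T, hT⟩ := c.exists_within
  obtain ⟨U, hU⟩ := c.exists_machine_touches
  have hP : c.machine.Placed c 1 (c.len + 1) := fun j hj => c.machine_node j hj
  have key : ∀ w : List K, ∃ t,
      (c.machine.conf ord w t).1 = Fin.last c.machine.last ∧
      outputMap (c.machine.conf ord w t).2 = (if w ∈ L then [1] else [0]) ∧
      ∀ k ≤ t, ∃ s, Shows (q.eval w.length) (q.eval w.length + T + w.length)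
        s (c.machine.conf ord w k).2 := by
    intro w
    obtain ⟨p, b', p', hp, hr, h1, h2, h3⟩ := h w
    have hs : Shows (q.eval w.length) (q.eval w.length + T + w.length)
        (fun a => inputMap w (a - p), p) (inputMap w) := by
      refine ⟨fun i => by simp, hp, fun a ha => ?_⟩
      have := Finsupp.mem_support_iff.2 ha
      have := Finsupp.support_onFinset_subset this
      rw [Finset.mem_Icc] at this
      have hp' : |p| ≤ q.eval w.length := hp
      rw [abs_le] at hp' ⊢
      push_cast
      constructor <;> linarith
    obtain ⟨x', hx', hg⟩ := BSSMachine.gets_of_runs (M := c.machine) (T := T)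
      (W := q.eval w.length + T + w.length) (by omega) hr hP hT _ hs
    have h0 : c.machine.Gets ord (fun y => ∃ s, Shows (q.eval w.length)
        (q.eval w.length + T + w.length) s y) (0, inputMap w) (Fin.ofNat _ 1, inputMap w) := by
      refine .step ?_ ⟨_, hs⟩ ⟨_, hs⟩
      simp only [BSSMachine.step, c.machine_node_zero]
    obtain ⟨t, ht, hG⟩ := h0.trans hg
    refine ⟨t, ?_, ?_, hG⟩
    · unfold BSSMachine.conf
      rw [ht]
      simp only [Fin.ext_iff, Cmd.machine, Fin.val_last, Fin.ofNat]
      exact Nat.mod_eq_of_lt (by omega)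
    · unfold BSSMachine.conf
      rw [ht]
      have e1 : x' (-1) = 1 := by rw [hx'.1, ← h1]; congr 1
      have e2 : x' (-2) = 0 := by rw [hx'.1, ← h2]; congr 1
      have e3 : x' 1 = if w ∈ L then 1 else 0 := by rw [hx'.1, ← h3]
      -- A one at `-1` and a zero at `-2` make the output exactly one letter long.
      have hl : outputLength x' = 1 := by
        apply le_antisymm
        · apply Nat.sInf_le
          simp [e2]
        · have hne : {k : ℕ | x' (-((k : ℤ) + 1)) ≠ 1}.Nonempty := ⟨1, by simp [e2]⟩
          by_contra hlt
          have h0 : outputLength x' = 0 := by omega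
          have := Nat.sInf_mem hne
          rw [show sInf {k : ℕ | x' (-((k : ℤ) + 1)) ≠ 1} = 0 from h0] at this
          simp [e1] at this
      change outputMap x' = _
      unfold outputMap
      rw [hl]
      simp only [List.ofFn_succ, List.ofFn_zero, Fin.val_zero, Nat.cast_zero, zero_add, e3]
      split_ifs <;> rfl
  -- Used coordinates are collected over all times, hence also after halting.
  have halted : ∀ w t, (c.machine.conf ord w t).1 = Fin.last c.machine.last →
      ∀ k, c.machine.conf ord w (t + k) = c.machine.conf ord w t := by
    intro w t ht k
    induction k with
    | zero => rfl
    | succ k ih =>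
      have : c.machine.conf ord w (t + (k + 1)) =
          c.machine.step ord (c.machine.conf ord w (t + k)) := by
        unfold BSSMachine.conf
        rw [← add_assoc, Function.iterate_succ_apply']
      rw [this, ih]
      simp only [BSSMachine.step, ht, c.machine_node_last]
  refine ⟨c.machine, fun w => ?_, 4 * q + 2 * Polynomial.X +
    Polynomial.C (2 * T + 2 * U + 1), fun w => ?_⟩
  · obtain ⟨t, h1, h2, -⟩ := key w
    exact ⟨t, h1, h2⟩
  · obtain ⟨t, h1, -, h3⟩ := key w
    refine ⟨⟨t, h1⟩, ?_⟩
    -- Machine coordinates are relative to the head. Passing from tape coordinates to them costs the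
    -- head position once more, hence the factor `2`; `U` accounts for the touched coordinates.
    set R : ℕ := 2 * q.eval w.length + T + w.length + U with hR
    have hsub : c.machine.usedCoords ord w ⊆ ((Finset.Icc (-(R : ℤ)) R : Finset ℤ) : Set ℤ) := by
      rintro i (hi | ⟨k, hi | hi⟩)
      · rw [Set.mem_Icc] at hi
        rw [Finset.coe_Icc, Set.mem_Icc]
        constructor <;> omega
      · obtain ⟨s, hs⟩ : ∃ s, Shows (q.eval w.length) (q.eval w.length + T + w.length)
            s (c.machine.conf ord w k).2 := by
          rcases le_total k t with hk | hk
          · exact h3 k hk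
          · obtain ⟨j, rfl⟩ := Nat.exists_eq_add_of_le hk
            rw [halted w t h1 j]
            exact h3 t le_rfl
        rw [hs.1] at hi
        have h4 := hs.2.2 _ hi
        have h5 := hs.2.1
        rw [Finset.coe_Icc, Set.mem_Icc]
        rw [abs_le] at h4 h5
        constructor <;> omega
      · have := hU _ i hi
        rw [Finset.coe_Icc, Set.mem_Icc]
        rw [abs_le] at this
        constructor <;> omega
    calc (c.machine.usedCoords ord w).encard ≤ _ := Set.encard_le_encard hsub
      _ = ((2 * R + 1 : ℕ) : ℕ∞) := by
        rw [Set.encard_coe_eq_coe_finsetCard, Int.card_Icc]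
        congr 1
        omega
      _ ≤ _ := by
        rw [Nat.cast_le]
        simp
        omega

end Programs

/-! ### Straight-line code and bit tests -/

section Tests

variable {K : Type*} [CommSemiring K] {ord : Option (SemiringOrder K)} {B : ℕ}

/-- A sequence of assignments. -/
def Cmd.sets : List (ℤ × Op K) → Cmd K
  | [] => .skip
  | (i, op) :: l => .seq (.set i op) (Cmd.sets l)

/-- The effect of a sequence of assignments. -/
def execs : List (ℤ × Op K) → (ℤ → K) → ℤ → ℤ → K
  | [], b, _ => b
  | (i, op) :: l, b, p => execs l (Function.update b (p + i) (op.val fun j => b (p + j))) p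

theorem runs_sets (l : List (ℤ × Op K)) (b : ℤ → K) (p : ℤ) :
    Runs ord B (.sets l) (b, p) (execs l b p, p) := by
  induction l generalizing b with
  | nil => exact .skip _
  | cons a l ih => exact .seq (.set _ _ _ _) (ih _)

theorem runs_sets' {l : List (ℤ × Op K)} {b b' : ℤ → K} {p : ℤ} (h : execs l b p = b') :
    Runs ord B (.sets l) (b, p) (b', p) := h ▸ runs_sets l b p

/-- Moves of the head to the left. -/
def Cmd.lefts : ℕ → Cmd K
  | 0 => .skip
  | n + 1 => .seq .left (Cmd.lefts n)

/-- Moves of the head to the right. -/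
def Cmd.rights : ℕ → Cmd K
  | 0 => .skip
  | n + 1 => .seq .right (Cmd.rights n)

theorem runs_lefts (n : ℕ) {b : ℤ → K} {p q : ℤ} (hq : q = p - n) (h₁ : |p| ≤ (B : ℤ))
    (h₂ : |q| ≤ (B : ℤ)) : Runs ord B (.lefts n) (b, p) (b, q) := by
  induction n generalizing p with
  | zero =>
    obtain rfl : q = p := by simpa using hq
    exact .skip _
  | succ n ih =>
    have : |p - 1| ≤ (B : ℤ) := by
      push_cast at hq
      rw [abs_le] at *
      omega
    exact .seq (.left _ _ this) (ih (by push_cast at hq; omega) this)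

theorem runs_rights (n : ℕ) {b : ℤ → K} {p q : ℤ} (hq : q = p + n) (h₁ : |p| ≤ (B : ℤ))
    (h₂ : |q| ≤ (B : ℤ)) : Runs ord B (.rights n) (b, p) (b, q) := by
  induction n generalizing p with
  | zero =>
    obtain rfl : q = p := by simpa using hq
    exact .skip _
  | succ n ih =>
    have : |p + 1| ≤ (B : ℤ) := by
      push_cast at hq
      rw [abs_le] at *
      omega
    exact .seq (.right _ _ this) (ih (by push_cast at hq; omega) this)

/-- The code `l` prepares a branch on `v`, after which `c` (if `v` holds) or `d` (if not) restores
the tape. -/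
structure IsTest (ord : Option (SemiringOrder K)) (l c d : List (ℤ × Op K)) (b : ℤ → K) (p : ℤ)
    (v : Prop) : Prop where
  iff : BranchRel ord (execs l b p (p + 1)) (execs l b p (p + 2)) ↔ v
  pos : v → execs c (execs l b p) p = b
  neg : ¬ v → execs d (execs l b p) p = b

/-- The conditional statement for a test. -/
def Cmd.iteTest (l c d : List (ℤ × Op K)) (P Q : Cmd K) : Cmd K :=
  .seq (.sets l) (.ite (.seq (.sets c) P) (.seq (.sets d) Q))

/-- The while statement for a test. -/
def Cmd.whileTest (l c d : List (ℤ × Op K)) (P : Cmd K) : Cmd K :=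
  .seq (.sets l) (.seq (.loop (.seq (.sets c) (.seq P (.sets l)))) (.sets d))

variable {l c d : List (ℤ × Op K)} {b : ℤ → K} {p : ℤ} {v : Prop} {P Q : Cmd K}
  {s t : (ℤ → K) × ℤ}

theorem IsTest.runs_pos (h : IsTest ord l c d b p v) (hv : v) (hP : Runs ord B P (b, p) t) :
    Runs ord B (.iteTest l c d P Q) (b, p) t :=
  .seq (runs_sets _ _ _) (.iteTrue (h.iff.2 hv) (.seq (runs_sets' (h.pos hv)) hP))

theorem IsTest.runs_neg (h : IsTest ord l c d b p v) (hv : ¬ v) (hQ : Runs ord B Q (b, p) t) :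
    Runs ord B (.iteTest l c d P Q) (b, p) t :=
  .seq (runs_sets _ _ _) (.iteFalse (fun hb => hv (h.iff.1 hb)) (.seq (runs_sets' (h.neg hv)) hQ))

theorem IsTest.runs_done (h : IsTest ord l c d b p v) (hv : ¬ v) :
    Runs ord B (.whileTest l c d P) (b, p) (b, p) :=
  .seq (runs_sets _ _ _) (.seq (.loopFalse fun hb => hv (h.iff.1 hb)) (runs_sets' (h.neg hv)))

theorem IsTest.runs_step (h : IsTest ord l c d b p v) (hv : v) (hP : Runs ord B P (b, p) s)
    (ht : Runs ord B (.whileTest l c d P) s t) :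
    Runs ord B (.whileTest l c d P) (b, p) t := by
  -- The preparation that opens the remaining loop becomes the one that closes the present pass
  -- through the body.
  rcases ht with _ | _ | _ | _ | ⟨h₁, h₂⟩
  rcases h₂ with _ | _ | _ | _ | ⟨h₂, h₃⟩
  exact .seq (runs_sets _ _ _) (.seq (.loopTrue (h.iff.2 hv)
    (.seq (runs_sets' (h.pos hv)) (.seq hP h₁)) h₂) h₃)

/-- The element of `K` that represents a truth value. -/
def bit (K : Type*) [CommSemiring K] (e : Bool) : K := if e then 1 else 0

/-- Whether a bit is compared with `e` in this order (and not in the reverse one). -/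
def Fwd (ord : Option (SemiringOrder K)) (e : Bool) : Prop := e = true ↔ ¬ BranchRel ord 1 0

theorem branchRel_self (a : K) : BranchRel ord a a := by
  cases ord with
  | none => rfl
  | some o => exact o.le_refl a

theorem branchRel_antisymm {a a' : K} (h₁ : BranchRel ord a a') (h₂ : BranchRel ord a' a) :
    a = a' := by
  cases ord with
  | none => exact h₁
  | some o => exact o.le_antisymm _ _ h₁ h₂

variable [Nontrivial K]

/-- In an ordered semiring `0 ≤ 1`, `1 ≤ 0` or neither may hold, but not both, by antisymmetry.
`Fwd` selects the order of comparison that fails for different bits, so one branch node tests a bit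
whatever the order is. -/
theorem branchRel_fwd {e f : Bool} (h : Fwd ord e) :
    BranchRel ord (bit K e) (bit K f) ↔ f = e := by
  have h01 : ∀ {P : Prop}, BranchRel ord (1 : K) 0 → BranchRel ord (0 : K) 1 → P :=
    fun h₁ h₂ => absurd (branchRel_antisymm h₁ h₂) one_ne_zero
  constructor
  · cases e <;> cases f <;> simp [bit, Fwd] at * <;> intro h' <;> first | exact h01 h h' | exact h h'
  · rintro rfl
    exact branchRel_self _

theorem branchRel_bwd {e f : Bool} (h : ¬ Fwd ord e) :
    BranchRel ord (bit K f) (bit K e) ↔ f = e := by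
  have h01 : ∀ {P : Prop}, BranchRel ord (1 : K) 0 → BranchRel ord (0 : K) 1 → P :=
    fun h₁ h₂ => absurd (branchRel_antisymm h₁ h₂) one_ne_zero
  constructor
  · cases e <;> cases f <;> simp [bit, Fwd] at * <;> intro h' <;> first | exact h01 h h' | exact h h'
  · rintro rfl
    exact branchRel_self _

/-- Preparation of the test whether coordinate `j` is `e`, with coordinates `1` and `2` zero. -/
def loadAt (ord : Option (SemiringOrder K)) (e : Bool) (j : ℤ) : List (ℤ × Op K) :=
  -- There is no copy operation; adding to a cell that holds `0` copies.
  if Fwd ord e then [(1, .const (bit K e)), (2, .add 2 j)]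
  else [(1, .add 1 j), (2, .const (bit K e))]

/-- Clears coordinates `1` and `2`. -/
def clear12 (K : Type*) [CommSemiring K] : List (ℤ × Op K) := [(1, .const 0), (2, .const 0)]

theorem isTest_at {e f : Bool} {j : ℤ} (h₁ : b (p + 1) = 0) (h₂ : b (p + 2) = 0)
    (hj : j ≠ 1 ∧ j ≠ 2) (hf : b (p + j) = bit K f) :
    IsTest ord (loadAt ord e j) (clear12 K) (clear12 K) b p (f = e) := by
  have hr : execs (clear12 K) (execs (loadAt ord e j) b p) p = b := by
    funext a
    unfold loadAt clear12
    split_ifs <;> simp only [execs, Op.val, Function.update_apply] <;> split_ifs <;> simp_all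
  refine ⟨?_, fun _ => hr, fun _ => hr⟩
  unfold loadAt
  split_ifs with h
  · rw [← branchRel_fwd h]
    simp [execs, Op.val, Function.update_apply, h₂, hj, hf]
  · rw [← branchRel_bwd h]
    simp [execs, Op.val, Function.update_apply, h₁, hj, hf]

/-- Preparation of the test whether coordinate `1` is `e`, with coordinate `2` known. -/
def loadL (ord : Option (SemiringOrder K)) (e : Bool) : List (ℤ × Op K) :=
  if Fwd ord e then [(2, .const 0), (2, .add 2 1), (1, .const (bit K e))]
  else [(2, .const (bit K e))]

/-- The tested cell is itself one of the two compared ones and may get overwritten. The branch taken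
reveals its bit, which is then restored as a constant. -/
theorem isTest_L {e f : Bool} {k : K} (h₂ : b (p + 2) = k) (hf : b (p + 1) = bit K f) :
    IsTest ord (loadL ord e) [(1, .const (bit K e)), (2, .const k)]
      [(1, .const (bit K (!e))), (2, .const k)] b p (f = e) := by
  refine ⟨?_, fun hv => ?_, fun hv => ?_⟩
  · unfold loadL
    split_ifs with h
    · rw [← branchRel_fwd h]
      simp [execs, Op.val, Function.update_apply, hf]
    · rw [← branchRel_bwd h]
      simp [execs, Op.val, Function.update_apply, hf]
  · funext a
    unfold loadL
    split_ifs <;> simp only [execs, Op.val, Function.update_apply] <;> split_ifs <;> simp_all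
  · rw [← ne_eq, ← Bool.eq_not_iff] at hv
    funext a
    unfold loadL
    split_ifs <;> simp only [execs, Op.val, Function.update_apply] <;> split_ifs <;> simp_all

/-- Preparation of the test whether coordinate `2` is `e`, with coordinate `1` known. -/
def loadR (ord : Option (SemiringOrder K)) (e : Bool) : List (ℤ × Op K) :=
  if Fwd ord e then [(1, .const (bit K e))]
  else [(1, .const 0), (1, .add 1 2), (2, .const (bit K e))]

theorem isTest_R {e f : Bool} {k : K} (h₁ : b (p + 1) = k) (hf : b (p + 2) = bit K f) :
    IsTest ord (loadR ord e) [(2, .const (bit K e)), (1, .const k)]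
      [(2, .const (bit K (!e))), (1, .const k)] b p (f = e) := by
  refine ⟨?_, fun hv => ?_, fun hv => ?_⟩
  · unfold loadR
    split_ifs with h
    · rw [← branchRel_fwd h]
      simp [execs, Op.val, Function.update_apply, hf]
    · rw [← branchRel_bwd h]
      simp [execs, Op.val, Function.update_apply, hf]
  · funext a
    unfold loadR
    split_ifs <;> simp only [execs, Op.val, Function.update_apply] <;> split_ifs <;> simp_all
  · rw [← ne_eq, ← Bool.eq_not_iff] at hv
    funext a
    unfold loadR
    split_ifs <;> simp only [execs, Op.val, Function.update_apply] <;> split_ifs <;> simp_all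

end Tests

/-! ### Four stacks on the tape -/

section Stacks

variable {K : Type*} [CommSemiring K]

/-- The entry of a stack at a height, counted from the bottom. -/
def sval : List K → ℕ → K
  | [], _ => 0
  | a :: l, m => if m = l.length then a else sval l m

theorem sval_of_le {l : List K} {m : ℕ} (h : l.length ≤ m) : sval l m = 0 := by
  induction l with
  | nil => rfl
  | cons a l ih =>
    rw [List.length_cons] at h
    rw [sval, if_neg (by omega), ih (by omega)]

/-- The contents of track `j` of the block at height `m` of the stacks `st`. -/
def cell (st : ℕ → List K) (m : ℕ) (j : ℤ) : K :=
  if 6 ≤ j ∧ j < 14 then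
    -- Even tracks flag that the stack reaches this height, odd tracks hold the entries. The flag is
    -- needed because an entry may be `0`.
    if j % 2 = 0 then if m < (st ((j - 6) / 2).toNat).length then 1 else 0
    else sval (st ((j - 6) / 2).toNat) m
  else 0

/-- The tape with the stacks `st` on the negative and `R` on the nonnegative coordinates. -/
def tape (st : ℕ → List K) (R : ℤ → K) : ℤ → K := fun a =>
  if 0 ≤ a then R a else cell st ((-a - 1) / 16).toNat (a % 16)

theorem tape_of_nonneg (st : ℕ → List K) (R : ℤ → K) {a : ℤ} (h : 0 ≤ a) : tape st R a = R a :=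
  if_pos h

theorem tape_block (st : ℕ → List K) (R : ℤ → K) {a j : ℤ} {m : ℕ} (h : a = -16 * (m + 1) + j)
    (h₀ : 0 ≤ j) (h₁ : j < 16) : tape st R a = cell st m j := by
  unfold tape
  rw [if_neg (by omega)]
  congr 1 <;> omega

/-- The right half of the tape around the home block is as the stack operations expect it. -/
structure Home (R : ℤ → K) : Prop where
  one : R 1 = 0
  two : R 2 = 0
  three : R 3 = 1
  five : R 5 = 0

variable {st : ℕ → List K} {R : ℤ → K} {v : K} {h : ℕ} {B : ℕ} {ord : Option (SemiringOrder K)}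

/-- Tracks 1 and 2 (for comparisons) and 5 (for the carried value) are free in every block, so tests
work and a value can be transported wherever the head stands. -/
theorem tape_track (hR : Home R) {a j : ℤ} (ha : a = -16 * h + j) (hj : j = 1 ∨ j = 2 ∨ j = 5) :
    tape st R a = 0 := by
  rcases h with _ | h
  · rw [tape_of_nonneg _ _ (by omega)]
    obtain rfl : a = j := by simpa using ha
    rcases hj with rfl | rfl | rfl
    exacts [hR.one, hR.two, hR.five]
  · rw [tape_block st R (m := h) (j := j) (by push_cast at ha; omega) (by omega) (by omega), cell,
      if_neg (by omega)]

theorem tape_flag {s : ℕ} (hs : s < 4) {a : ℤ} (ha : a = -16 * (h + 1) + (6 + 2 * s)) :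
    tape st R a = bit K (decide (h < (st s).length)) := by
  rw [tape_block st R ha (by omega) (by omega), cell, if_pos (by omega), if_pos (by omega)]
  have : ((6 + 2 * (s : ℤ) - 6) / 2).toNat = s := by omega
  rw [this]
  by_cases hh : h < (st s).length <;> simp [bit, hh]

theorem tape_val {s : ℕ} (hs : s < 4) {a : ℤ} (ha : a = -16 * (h + 1) + (7 + 2 * s)) :
    tape st R a = sval (st s) h := by
  rw [tape_block st R ha (by omega) (by omega), cell, if_pos (by omega), if_neg (by omega)]
  have : ((7 + 2 * (s : ℤ) - 6) / 2).toNat = s := by omega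
  rw [this]

theorem tape_home (hR : Home R) {a : ℤ} (ha : a = -16 * h + 3) :
    tape st R a = bit K (decide (h = 0)) := by
  rcases h with _ | h
  · rw [tape_of_nonneg _ _ (by omega)]
    obtain rfl : a = 3 := by simpa using ha
    simp [hR.three, bit]
  · rw [tape_block st R (m := h) (j := 3) (by push_cast at ha; omega) (by omega) (by omega), cell,
      if_neg (by omega)]
    simp [bit]

/-- Pushing onto a stack changes two coordinates. -/
theorem tape_push {s : ℕ} (hs : s < 4) {p : ℤ} (hp : p = -16 * ((st s).length + 1)) (k : K) :
    tape (Function.update st s (k :: st s)) R =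
      Function.update (Function.update (tape st R) (p + (6 + 2 * s)) 1) (p + (7 + 2 * s)) k := by
  funext a
  rcases le_or_gt 0 a with ha | ha
  · rw [Function.update_of_ne (by omega), Function.update_of_ne (by omega), tape_of_nonneg _ _ ha,
      tape_of_nonneg _ _ ha]
  obtain ⟨m, j, h₀, h₁, rfl⟩ : ∃ (m : ℕ) (j : ℤ), 0 ≤ j ∧ j < 16 ∧ a = -16 * (m + 1) + j :=
    ⟨((-a - 1) / 16).toNat, a % 16, by omega, by omega, by omega⟩
  simp only [Function.update_apply]
  rw [tape_block _ R rfl h₀ h₁, tape_block _ R rfl h₀ h₁]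
  by_cases hj : 6 ≤ j ∧ j < 14
  · by_cases hs' : ((j - 6) / 2).toNat = s
    · unfold cell
      rw [if_pos hj, if_pos hj, hs']
      simp only [Function.update_self, List.length_cons, sval]
      have e1 : (-16 * ((m : ℤ) + 1) + j = p + (7 + 2 * s)) ↔
          (j % 2 ≠ 0 ∧ m = (st s).length) := by omega
      have e2 : (-16 * ((m : ℤ) + 1) + j = p + (6 + 2 * s)) ↔
          (j % 2 = 0 ∧ m = (st s).length) := by omega
      simp only [e1, e2]
      split_ifs <;> first | rfl | omega
    · rw [if_neg (by omega), if_neg (by omega)]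
      unfold cell
      rw [if_pos hj, if_pos hj, Function.update_of_ne hs']
  · rw [if_neg (by omega), if_neg (by omega)]
    unfold cell
    rw [if_neg hj, if_neg hj]

/-- The configuration with the head at block `h` (counted from home) and the carried value `v`. -/
def carry (st : ℕ → List K) (R : ℤ → K) (v : K) (h : ℕ) : (ℤ → K) × ℤ :=
  (Function.update (tape st R) (-16 * h + 5) v, -16 * h)

/-- Moves away from home, with the carried value. -/
def Cmd.away : Cmd K := .seq (.sets [(-11, .add (-11) 5), (5, .const 0)]) (.lefts 16)

/-- Moves towards home, with the carried value. -/
def Cmd.back : Cmd K := .seq (.sets [(21, .add 21 5), (5, .const 0)]) (.rights 16)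

/-- The constants `-11 = 5 - 16` and `21 = 5 + 16` in `Cmd.away` and `Cmd.back` are the carry tracks
of the two neighbouring blocks. -/
theorem runs_away (hR : Home R) (hB : 16 * (h + 1) ≤ B) :
    Runs ord B .away (carry st R v h) (carry st R v (h + 1)) := by
  refine .seq (runs_sets' (b' := Function.update (tape st R) (-16 * (h + 1 : ℕ) + 5) v) ?_)
    (runs_lefts _ (by push_cast; ring) (by rw [abs_le]; omega) (by rw [abs_le]; push_cast; omega))
  have h1 := tape_track (st := st) (h := h) hR rfl (Or.inr (Or.inr rfl))
  have h2 := tape_track (st := st) (h := h + 1) hR rfl (Or.inr (Or.inr rfl))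
  funext a
  simp only [execs, Op.val, Function.update_apply]
  push_cast at h2 ⊢
  rw [show -16 * (h : ℤ) + -11 = -16 * (h + 1) + 5 by ring]
  by_cases ha : a = -16 * (h : ℤ) + 5
  · rw [if_pos ha, if_neg (by omega), ha, h1]
  · rw [if_neg ha]
    by_cases ha' : a = -16 * ((h : ℤ) + 1) + 5
    · rw [if_pos ha', if_pos ha', if_neg (by omega), h2, zero_add]
    · rw [if_neg ha', if_neg ha', if_neg ha]

theorem runs_back (hR : Home R) (hB : 16 * (h + 1) ≤ B) :
    Runs ord B .back (carry st R v (h + 1)) (carry st R v h) := by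
  refine .seq (runs_sets' (b' := Function.update (tape st R) (-16 * h + 5) v) ?_)
    (runs_rights _ (by push_cast; ring) (by rw [abs_le]; push_cast; omega)
      (by rw [abs_le]; omega))
  have h1 := tape_track (st := st) (h := h) hR rfl (Or.inr (Or.inr rfl))
  have h2 := tape_track (st := st) (h := h + 1) hR rfl (Or.inr (Or.inr rfl))
  funext a
  simp only [execs, Op.val, Function.update_apply]
  push_cast at h2 ⊢
  rw [show -16 * ((h : ℤ) + 1) + 21 = -16 * h + 5 by ring]
  by_cases ha : a = -16 * (h : ℤ) + 5
  · rw [if_neg (by omega), if_pos ha, if_pos ha, if_neg (by omega), h1, zero_add]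
  · rw [if_neg ha, if_neg ha]
    by_cases ha' : a = -16 * ((h : ℤ) + 1) + 5
    · rw [if_pos ha', ha', h2]
    · rw [if_neg ha', if_neg ha']

variable [Nontrivial K]

/-- The while statement for the condition that coordinate `j` is `e`. -/
def Cmd.whileAt (ord : Option (SemiringOrder K)) (e : Bool) (j : ℤ) (P : Cmd K) : Cmd K :=
  .whileTest (loadAt ord e j) (clear12 K) (clear12 K) P

/-- The conditional statement for the condition that coordinate `j` is `1`. -/
def Cmd.iteAt (ord : Option (SemiringOrder K)) (j : ℤ) (P Q : Cmd K) : Cmd K :=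
  .iteTest (loadAt ord true j) (clear12 K) (clear12 K) P Q

theorem isTest_carry (hR : Home R) {e f : Bool} {j : ℤ} (hj : j ≠ 1 ∧ j ≠ 2)
    (hf : (carry st R v h).1 ((carry st R v h).2 + j) = bit K f) :
    IsTest ord (loadAt ord e j) (clear12 K) (clear12 K) (carry st R v h).1 (carry st R v h).2
      (f = e) := by
  refine isTest_at ?_ ?_ hj hf
  · simp only [carry]
    rw [Function.update_of_ne (by omega), tape_track hR rfl (by simp)]
  · simp only [carry]
    rw [Function.update_of_ne (by omega), tape_track hR rfl (by simp)]

/-- Moves to the first free block of stack `s`. -/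
def Cmd.goTop (ord : Option (SemiringOrder K)) (s : ℕ) : Cmd K :=
  .seq .away (.whileAt ord true (6 + 2 * s) .away)

/-- Moves back to the home block. -/
def Cmd.goHome (ord : Option (SemiringOrder K)) : Cmd K := .whileAt ord false 3 .back

/-- The home block has no flags (its track 6 is a register), so the first move is unconditional. The
search stops at the first unset flag, in block `length + 1` counted from home. -/
theorem runs_goTop (hR : Home R) {s : ℕ} (hs : s < 4) (hB : 16 * ((st s).length + 1) ≤ B) :
    Runs ord B (.goTop ord s) (carry st R v 0) (carry st R v ((st s).length + 1)) := by
  have key : ∀ k h, h + k = (st s).length → Runs ord B (.whileAt ord true (6 + 2 * s) .away)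
      (carry st R v (h + 1)) (carry st R v ((st s).length + 1)) := by
    intro k
    induction k with
    | zero =>
      intro h hk
      obtain rfl : h = (st s).length := by omega
      refine (isTest_carry (f := false) hR (by omega) ?_).runs_done (by simp)
      simp only [carry]
      rw [Function.update_of_ne (by omega), tape_flag hs (h := (st s).length) (by push_cast; ring)]
      simp
    | succ k ih =>
      intro h hk
      refine (isTest_carry (f := true) hR (by omega) ?_).runs_step rfl
        (runs_away hR (by omega)) (ih (h + 1) (by omega))
      simp only [carry]
      rw [Function.update_of_ne (by omega), tape_flag hs (h := h) (by push_cast; ring), decide_eq_true (by omega)]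
  exact .seq (runs_away hR (by omega)) (key (st s).length 0 (by omega))

theorem runs_goHome (hR : Home R) (hB : 16 * h ≤ B) :
    Runs ord B (.goHome ord) (carry st R v h) (carry st R v 0) := by
  induction h with
  | zero =>
    refine (isTest_carry (f := true) hR (by omega) ?_).runs_done (by simp)
    simp only [carry]
    rw [Function.update_of_ne (by omega), tape_home (h := 0) hR rfl]
    simp
  | succ h ih =>
    refine (isTest_carry (f := false) hR (by omega) ?_).runs_step rfl
      (runs_back hR (by omega)) (ih (by omega))
    simp only [carry]
    rw [Function.update_of_ne (by omega), tape_home (h := h + 1) hR rfl]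
    simp

/-- Pushes the carried value onto stack `s`, and keeps it. -/
def Cmd.push (ord : Option (SemiringOrder K)) (s : ℕ) : Cmd K :=
  .seq (.goTop ord s) (.seq (.sets [(6 + 2 * s, .const 1), (7 + 2 * s, .add (7 + 2 * s) 5)])
    (.goHome ord))

/-- Pops the top of stack `s` into the carried value. -/
def Cmd.pop (ord : Option (SemiringOrder K)) (s : ℕ) : Cmd K :=
  .seq (.goTop ord s) (.seq .back (.seq (.sets [(5, .const 0), (5, .add 5 (7 + 2 * s)),
    (6 + 2 * s, .const 0), (7 + 2 * s, .const 0)]) (.goHome ord)))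

theorem runs_push (hR : Home R) {s : ℕ} (hs : s < 4) (hB : 16 * ((st s).length + 1) ≤ B) :
    Runs ord B (.push ord s) (carry st R v 0)
      (carry (Function.update st s (v :: st s)) R v 0) := by
  refine .seq (runs_goTop hR hs hB) (.seq (t := carry (Function.update st s (v :: st s)) R v
    ((st s).length + 1)) (runs_sets' ?_) (runs_goHome hR hB))
  simp only [tape_push hs rfl]
  have h1 := tape_track (st := st) (h := (st s).length + 1) hR rfl (Or.inr (Or.inr rfl))
  have h2 := tape_val (st := st) (R := R) hs (h := (st s).length) rfl
  rw [sval_of_le le_rfl] at h2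
  push_cast at h1
  funext a
  simp only [execs, Op.val, Function.update_apply]
  push_cast
  split_ifs <;> first | omega | simp_all

theorem runs_pop (hR : Home R) {s : ℕ} (hs : s < 4) {k : K} {l : List K} (hl : st s = k :: l)
    (hB : 16 * ((st s).length + 1) ≤ B) :
    Runs ord B (.pop ord s) (carry st R v 0) (carry (Function.update st s l) R k 0) := by
  have hl' : (st s).length = l.length + 1 := by rw [hl, List.length_cons]
  refine .seq (runs_goTop hR hs hB) (.seq (runs_back hR hB) (.seq
    (t := carry (Function.update st s l) R k (st s).length) (runs_sets' ?_)
    (runs_goHome hR (by omega))))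
  -- A pop is a push read backwards, so the two tapes again differ in two coordinates only.
  have hst : st = Function.update (Function.update st s l) s
      (k :: (Function.update st s l) s) := by
    funext i
    by_cases hi : i = s
    · subst hi; simp [hl]
    · simp [hi]
  set st' := Function.update st s l with hst'
  have hsl : st' s = l := by simp [hst']
  have h1 := tape_track (st := st') (h := l.length + 1) hR rfl (Or.inr (Or.inr rfl))
  have h2 := tape_val (st := st') (R := R) hs (h := l.length) rfl
  have h3 := tape_flag (st := st') (R := R) hs (h := l.length) rfl
  rw [hsl, sval_of_le le_rfl] at h2
  rw [hsl, decide_eq_false (by omega)] at h3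
  rw [hl']
  rw [hst, tape_push hs rfl, hsl]
  push_cast at *
  funext a
  simp only [execs, Op.val, Function.update_apply]
  have e1 : -16 * ((l.length : ℤ) + 1) + (7 + 2 * s) ≠ -16 * ((l.length : ℤ) + 1) + (6 + 2 * s) := by
    omega
  have e2 : -16 * ((l.length : ℤ) + 1) + (7 + 2 * s) ≠ -16 * ((l.length : ℤ) + 1) + 5 := by
    omega
  have e3 : -16 * ((l.length : ℤ) + 1) + (6 + 2 * s) ≠ -16 * ((l.length : ℤ) + 1) + 5 := by
    omega
  simp only [e1, e2, e3, if_true, if_false, zero_add]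
  by_cases g1 : a = -16 * ((l.length : ℤ) + 1) + (7 + 2 * s)
  · rw [if_pos g1, if_neg (by omega), g1, h2]
  rw [if_neg g1]
  by_cases g2 : a = -16 * ((l.length : ℤ) + 1) + (6 + 2 * s)
  · rw [if_pos g2, if_neg (by omega), g2, h3]
    rfl
  rw [if_neg g2]
  by_cases g3 : a = -16 * ((l.length : ℤ) + 1) + 5
  · rw [if_pos g3, if_pos g3]
  · rw [if_neg g3, if_neg g3, if_neg g3, if_neg g1, if_neg g2, if_neg g3]

end Stacks

/-! ### Trees on the stacks -/

/-- Binary trees with leaves labelled by elements of `K`. -/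
inductive KTree (K : Type*) where
  | nil
  | leaf (k : K)
  | node (l r : KTree K)

section Trees

variable {K : Type*} [CommSemiring K]

/-- The prefix code of a tree. -/
def KTree.code : KTree K → List K
  | .nil => [0, 0]
  | .leaf k => [0, 1, k]
  | .node l r => 1 :: (l.code ++ r.code)

/-- The stack contents with the four given stacks. -/
def stk (M X Z C : List K) : ℕ → List K
  | 0 => M
  | 1 => X
  | 2 => Z
  | 3 => C
  | _ => []

variable [Nontrivial K] {ord : Option (SemiringOrder K)} {S : ℕ} {R : ℤ → K} {v : K}
  {st : ℕ → List K} {P Q : Cmd K} {t : (ℤ → K) × ℤ}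

/-- Sets the carried value. -/
def Cmd.setv (k : K) : Cmd K := .sets [(5, .const k)]

theorem runs_setv {B : ℕ} (k : K) : Runs ord B (.setv k) (carry st R v 0) (carry st R k 0) := by
  refine runs_sets' ?_
  funext a
  simp only [execs, Op.val, Function.update_apply]
  simp
  split_ifs <;> rfl

theorem runs_iteAt_one {B : ℕ} (hR : Home R) (h : Runs ord B P (carry st R 1 0) t) :
    Runs ord B (.iteAt ord 5 P Q) (carry st R 1 0) t :=
  (isTest_carry (f := true) hR (by omega) (by simp [carry, bit])).runs_pos rfl h

theorem runs_iteAt_zero {B : ℕ} (hR : Home R) (h : Runs ord B Q (carry st R 0 0) t) :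
    Runs ord B (.iteAt ord 5 P Q) (carry st R 0 0) t :=
  (isTest_carry (f := false) hR (by omega) (by simp [carry, bit])).runs_neg (by simp) h

/-- The while statement for the condition that stack `s` is nonempty. -/
def Cmd.whileNe (ord : Option (SemiringOrder K)) (s : ℕ) (P : Cmd K) : Cmd K :=
  .whileAt ord true (-10 + 2 * s) P

/-- Seen from home, `-10 + 2 * s = (6 + 2 * s) - 16` is the flag of the bottom entry of stack `s`.
-/
theorem runs_whileNe_done {B : ℕ} (hR : Home R) {s : ℕ} (hs : s < 4) (h : st s = []) :
    Runs ord B (.whileNe ord s P) (carry st R v 0) (carry st R v 0) := by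
  refine (isTest_carry (f := false) hR (by omega) ?_).runs_done (by simp)
  simp only [carry]
  rw [Function.update_of_ne (by omega), tape_flag hs (h := 0) (by push_cast; ring)]
  simp [h]

theorem runs_whileNe_step {B : ℕ} (hR : Home R) {s : ℕ} (hs : s < 4) (h : st s ≠ [])
    {u : (ℤ → K) × ℤ} (hP : Runs ord B P (carry st R v 0) u)
    (hu : Runs ord B (.whileNe ord s P) u t) :
    Runs ord B (.whileNe ord s P) (carry st R v 0) t := by
  refine (isTest_carry (f := true) hR (by omega) ?_).runs_step rfl hP hu
  simp only [carry]
  rw [Function.update_of_ne (by omega), tape_flag hs (h := 0) (by push_cast; ring)]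
  simp [List.length_pos_iff, h]

/-- The stack contents with three given stacks. -/
def mix (st : ℕ → List K) (s d e : ℕ) (M D C : List K) : ℕ → List K := fun i =>
  if i = s then M else if i = d then D else if i = e then C else st i

/-! ### Pushing and popping with three distinguished stacks -/

section Mix

variable {s d e : ℕ} {M D C l : List K}

theorem update_mix_fst : Function.update (mix st s d e M D C) s l = mix st s d e l D C := by
  funext i
  simp only [mix, Function.update_apply]
  split_ifs <;> rfl

theorem update_mix_snd (h : d ≠ s) :
    Function.update (mix st s d e M D C) d l = mix st s d e M l C := by
  funext i
  simp only [mix, Function.update_apply]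
  split_ifs <;> first | rfl | omega

theorem update_mix_thd (h : e ≠ s) (h' : e ≠ d) :
    Function.update (mix st s d e M D C) e l = mix st s d e M D l := by
  funext i
  simp only [mix, Function.update_apply]
  split_ifs <;> first | rfl | omega

theorem mix_fst : mix st s d e M D C s = M := if_pos rfl

theorem mix_snd (h : d ≠ s) : mix st s d e M D C d = D := by
  simp [mix, h]

theorem mix_thd (h : e ≠ s) (h' : e ≠ d) : mix st s d e M D C e = C := by
  simp [mix, h, h']

theorem runs_pop_fst (hR : Home R) (hs : s < 4) {k : K} (hB : M.length + 1 ≤ S) :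
    Runs ord (16 * (S + 1)) (.pop ord s) (carry (mix st s d e (k :: M) D C) R v 0)
      (carry (mix st s d e M D C) R k 0) := by
  have := runs_pop (ord := ord) (B := 16 * (S + 1)) (v := v) hR hs
    (mix_fst (st := st) (s := s) (d := d) (e := e) (M := k :: M) (D := D) (C := C))
    (by rw [mix_fst, List.length_cons]; omega)
  rwa [update_mix_fst] at this

theorem runs_pop_thd (hR : Home R) (h : e ≠ s) (h' : e ≠ d) (hs : e < 4) {k : K}
    (hB : C.length + 1 ≤ S) :
    Runs ord (16 * (S + 1)) (.pop ord e) (carry (mix st s d e M D (k :: C)) R v 0)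
      (carry (mix st s d e M D C) R k 0) := by
  have := runs_pop (ord := ord) (B := 16 * (S + 1)) (v := v) hR hs
    (mix_thd (st := st) (s := s) (d := d) (e := e) (M := M) (D := D) (C := k :: C) h h')
    (by rw [mix_thd h h', List.length_cons]; omega)
  rwa [update_mix_thd h h'] at this

theorem runs_push_snd (hR : Home R) (h : d ≠ s) (hs : d < 4) (hB : D.length ≤ S) :
    Runs ord (16 * (S + 1)) (.push ord d) (carry (mix st s d e M D C) R v 0)
      (carry (mix st s d e M (v :: D) C) R v 0) := by
  have := runs_push (ord := ord) (B := 16 * (S + 1)) (st := mix st s d e M D C) (v := v) hR hs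
    (by rw [mix_snd h]; omega)
  rwa [update_mix_snd h, mix_snd h] at this

theorem runs_push_thd (hR : Home R) (h : e ≠ s) (h' : e ≠ d) (hs : e < 4) (hB : C.length ≤ S) :
    Runs ord (16 * (S + 1)) (.push ord e) (carry (mix st s d e M D C) R v 0)
      (carry (mix st s d e M D (v :: C)) R v 0) := by
  have := runs_push (ord := ord) (B := 16 * (S + 1)) (st := mix st s d e M D C) (v := v) hR hs
    (by rw [mix_thd h h']; omega)
  rwa [update_mix_thd h h', mix_thd h h'] at this

end Mix

/-- Moves the contents of stack `s` onto stack `d` and onto stack `e`. -/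
def Cmd.pour (ord : Option (SemiringOrder K)) (s d e : ℕ) : Cmd K :=
  .seq (.whileNe ord s (.seq (.pop ord s) (.seq (.push ord d) (.push ord e)))) (.setv 0)

/-- Moves the contents of stack `s` onto stack `d`. -/
def Cmd.pour₁ (ord : Option (SemiringOrder K)) (s d : ℕ) : Cmd K :=
  .seq (.whileNe ord s (.seq (.pop ord s) (.push ord d))) (.setv 0)

theorem runs_pour (hR : Home R) {s d e : ℕ} (hs : s < 4) (hd : d < 4) (he : e < 4) (hds : d ≠ s)
    (hes : e ≠ s) (hed : e ≠ d) {M D C : List K} (hM : M.length ≤ S) (hD : M.length + D.length ≤ S)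
    (hC : M.length + C.length ≤ S) :
    Runs ord (16 * (S + 1)) (.pour ord s d e) (carry (mix st s d e M D C) R v 0)
      (carry (mix st s d e [] (M.reverse ++ D) (M.reverse ++ C)) R 0 0) := by
  -- The carried value left by the loop depends on the entries moved; it is cleared afterwards.
  suffices ∃ v', Runs ord (16 * (S + 1)) (.whileNe ord s _) (carry (mix st s d e M D C) R v 0)
      (carry (mix st s d e [] (M.reverse ++ D) (M.reverse ++ C)) R v' 0) by
    obtain ⟨v', h⟩ := this
    exact .seq h (runs_setv 0)
  induction M generalizing D C v with
  | nil => exact ⟨v, runs_whileNe_done hR hs mix_fst⟩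
  | cons k M ih =>
    simp only [List.length_cons] at hM hD hC
    obtain ⟨v', h⟩ := ih (v := k) (D := k :: D) (C := k :: C) (by omega)
      (by rw [List.length_cons]; omega) (by rw [List.length_cons]; omega)
    refine ⟨v', ?_⟩
    rw [List.reverse_cons, List.append_assoc, List.append_assoc]
    exact runs_whileNe_step hR hs (by rw [mix_fst]; simp)
      (.seq (runs_pop_fst hR hs (by omega)) (.seq (runs_push_snd hR hds hd (by omega))
        (runs_push_thd hR hes hed he (by omega)))) h

theorem runs_pour₁ (hR : Home R) {s d e : ℕ} (hs : s < 4) (hd : d < 4) (hds : d ≠ s)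
    {M D C : List K} (hM : M.length ≤ S) (hD : M.length + D.length ≤ S) :
    Runs ord (16 * (S + 1)) (.pour₁ ord s d) (carry (mix st s d e M D C) R v 0)
      (carry (mix st s d e [] (M.reverse ++ D) C) R 0 0) := by
  suffices ∃ v', Runs ord (16 * (S + 1)) (.whileNe ord s _) (carry (mix st s d e M D C) R v 0)
      (carry (mix st s d e [] (M.reverse ++ D) C) R v' 0) by
    obtain ⟨v', h⟩ := this
    exact .seq h (runs_setv 0)
  induction M generalizing D v with
  | nil => exact ⟨v, runs_whileNe_done hR hs mix_fst⟩
  | cons k M ih =>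
    simp only [List.length_cons] at hM hD
    obtain ⟨v', h⟩ := ih (v := k) (D := k :: D) (by omega) (by rw [List.length_cons]; omega)
    refine ⟨v', ?_⟩
    rw [List.reverse_cons, List.append_assoc]
    exact runs_whileNe_step hR hs (by rw [mix_fst]; simp)
      (.seq (runs_pop_fst hR hs (by omega)) (runs_push_snd hR hds hd (by omega))) h

/-- One step of moving a tree from stack `s` to stack `d`. -/
def Cmd.moveStep (ord : Option (SemiringOrder K)) (s d : ℕ) : Cmd K :=
  .seq (.seq (.pop ord s) (.iteAt ord 5
    (.seq (.push ord d) (.push ord 3))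
    (.seq (.push ord d) (.seq (.pop ord 3) (.seq (.pop ord s) (.iteAt ord 5
      (.seq (.push ord d) (.seq (.pop ord s) (.push ord d))) (.push ord d))))))) (.setv 0)

/-- Moves a tree from stack `s` to stack `d`, where its code is reversed. -/
def Cmd.moveTree (ord : Option (SemiringOrder K)) (s d : ℕ) : Cmd K :=
  .seq (.setv 1) (.seq (.push ord 3) (.seq (.setv 0) (.whileNe ord 3 (.moveStep ord s d))))

/-- Stack 3 holds one mark for each subtree still to be moved: a node trades its mark for two, a
leaf or `nil` uses its mark up. The payload of a leaf is moved without being tested, since it may be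
any element of `K`. The statement has a continuation `h`, so that the subtrees of a node are handled
one after the other within the same loop. -/
theorem runs_moveTree_aux (hR : Home R) {s d : ℕ} (hs : s < 3) (hd : d < 3) (hds : d ≠ s)
    (x : KTree K) {M D C : List K} (hM : x.code.length + M.length ≤ S)
    (hD : x.code.length + D.length ≤ S) (hC : x.code.length + C.length ≤ S)
    (h : Runs ord (16 * (S + 1)) (.whileNe ord 3 (.moveStep ord s d))
      (carry (mix st s d 3 M (x.code.reverse ++ D) C) R 0 0) t) :
    Runs ord (16 * (S + 1)) (.whileNe ord 3 (.moveStep ord s d))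
      (carry (mix st s d 3 (x.code ++ M) D (1 :: C)) R 0 0) t := by
  have h3s : 3 ≠ s := by omega
  have h3d : 3 ≠ d := by omega
  induction x generalizing M D C with
  | nil =>
    simp only [KTree.code, List.length_cons, List.length_nil] at hM hD hC
    refine runs_whileNe_step hR (by omega) (by rw [mix_thd h3s h3d]; simp)
      (.seq ?_ (runs_setv (v := 0) 0)) h
    refine .seq (runs_pop_fst hR (by omega) (by simp; omega)) (runs_iteAt_zero hR ?_)
    refine .seq (runs_push_snd hR hds (by omega) (by omega)) ?_
    refine .seq (runs_pop_thd hR h3s h3d (by omega) (by omega)) ?_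
    refine .seq (runs_pop_fst hR (by omega) (by simp; omega)) (runs_iteAt_zero hR ?_)
    exact runs_push_snd hR hds (by omega) (by simp; omega)
  | leaf k =>
    simp only [KTree.code, List.length_cons, List.length_nil] at hM hD hC
    refine runs_whileNe_step hR (by omega) (by rw [mix_thd h3s h3d]; simp)
      (.seq ?_ (runs_setv (v := k) 0)) h
    refine .seq (runs_pop_fst hR (by omega) (by simp; omega)) (runs_iteAt_zero hR ?_)
    refine .seq (runs_push_snd hR hds (by omega) (by omega)) ?_
    refine .seq (runs_pop_thd hR h3s h3d (by omega) (by omega)) ?_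
    refine .seq (runs_pop_fst hR (by omega) (by simp; omega)) (runs_iteAt_one hR ?_)
    refine .seq (runs_push_snd hR hds (by omega) (by simp; omega)) ?_
    refine .seq (runs_pop_fst hR (by omega) (by simp; omega)) ?_
    exact runs_push_snd hR hds (by omega) (by simp; omega)
  | node a b iha ihb =>
    simp only [KTree.code, List.length_cons, List.length_append] at hM hD hC
    have h1 : 1 ≤ b.code.length := by cases b <;> simp [KTree.code]
    refine runs_whileNe_step hR (by omega) (by rw [mix_thd h3s h3d]; simp)
      (.seq (.seq (runs_pop_fst hR (by omega) (by simp; omega)) (runs_iteAt_one hR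
        (.seq (runs_push_snd hR hds (by omega) (by omega))
        (runs_push_thd hR h3s h3d (by omega) (by simp; omega))))) (runs_setv 0)) ?_
    rw [show (a.code ++ b.code).append M = a.code ++ (b.code ++ M) from List.append_assoc _ _ _]
    refine iha (by simp; omega) (by simp; omega) (by simp; omega) ?_
    refine ihb (by omega) (by simp; omega) (by omega) ?_
    simpa [KTree.code] using h

theorem runs_moveTree (hR : Home R) {s d : ℕ} (hs : s < 3) (hd : d < 3) (hds : d ≠ s)
    (x : KTree K) {M D : List K} (hM : x.code.length + M.length ≤ S)
    (hD : x.code.length + D.length ≤ S) :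
    Runs ord (16 * (S + 1)) (.moveTree ord s d)
      (carry (mix st s d 3 (x.code ++ M) D []) R v 0)
      (carry (mix st s d 3 M (x.code.reverse ++ D) []) R 0 0) :=
  .seq (runs_setv 1) (.seq (runs_push_thd hR (by omega) (by omega) (by omega) (by simp))
    (.seq (runs_setv 0) (runs_moveTree_aux hR hs hd hds x hM hD (by simp; omega)
      (runs_whileNe_done hR (by omega) (mix_thd (by omega) (by omega))))))

/-! ### Operations on the tree at the top of the main stack -/

/-- The resting configuration with main stack `M`. -/
def rest (R : ℤ → K) (M : List K) : (ℤ → K) × ℤ := carry (stk M [] [] []) R 0 0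

theorem stk_013 (M X Z C : List K) : stk M X Z C = mix (stk [] [] Z []) 0 1 3 M X C := by
  funext i; rcases i with _ | _ | _ | _ | i <;> rfl

theorem stk_023 (M X Z C : List K) : stk M X Z C = mix (stk [] X [] []) 0 2 3 M Z C := by
  funext i; rcases i with _ | _ | _ | _ | i <;> rfl

theorem stk_102 (M X Z C : List K) : stk M X Z C = mix (stk [] [] [] C) 1 0 2 X M Z := by
  funext i; rcases i with _ | _ | _ | _ | i <;> rfl

theorem stk_210 (M X Z C : List K) : stk M X Z C = mix (stk [] [] [] C) 2 1 0 Z X M := by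
  funext i; rcases i with _ | _ | _ | _ | i <;> rfl

theorem stk_201 (M X Z C : List K) : stk M X Z C = mix (stk [] [] [] C) 2 0 1 Z M X := by
  funext i; rcases i with _ | _ | _ | _ | i <;> rfl

/-- Duplicates the top tree. -/
def Cmd.dup (ord : Option (SemiringOrder K)) : Cmd K :=
  .seq (.moveTree ord 0 1) (.seq (.pour ord 1 0 2) (.seq (.pour₁ ord 2 1) (.pour₁ ord 1 0)))

/-- Swaps the two top trees. -/
def Cmd.swap (ord : Option (SemiringOrder K)) : Cmd K :=
  .seq (.moveTree ord 0 1) (.seq (.moveTree ord 0 2) (.seq (.pour₁ ord 1 0) (.pour₁ ord 2 0)))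

/-- Removes the top tree. -/
def Cmd.drop (ord : Option (SemiringOrder K)) : Cmd K :=
  .seq (.moveTree ord 0 1) (.seq (.whileNe ord 1 (.pop ord 1)) (.setv 0))

/-- Each transfer reverses the code. One copy returns after two transfers and the other after four,
so both arrive in the right order. -/
theorem runs_dup (hR : Home R) (x : KTree K) {M : List K}
    (hS : 2 * x.code.length + M.length ≤ S) :
    Runs ord (16 * (S + 1)) (.dup ord) (rest R (x.code ++ M))
      (rest R (x.code ++ (x.code ++ M))) := by
  unfold rest
  have h1 := runs_moveTree (ord := ord) (st := stk [] [] [] []) (S := S) (s := 0) (d := 1) (v := 0)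
    hR (by omega) (by omega) (by omega) x (M := M) (D := []) (by omega) (by simp; omega)
  have h2 := runs_pour (ord := ord) (st := stk [] [] [] []) (S := S) (s := 1) (d := 0) (e := 2)
    (v := 0) (M := x.code.reverse) (D := M) (C := [])
    hR (by omega) (by omega) (by omega) (by omega) (by omega) (by omega) (by simp; omega)
    (by simp; omega) (by simp; omega)
  have h3 := runs_pour₁ (ord := ord) (st := stk [] [] [] []) (S := S) (s := 2) (d := 1) (e := 0)
    (v := 0) (M := x.code) (D := []) (C := x.code ++ M)
    hR (by omega) (by omega) (by omega) (by omega) (by simp; omega)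
  have h4 := runs_pour₁ (ord := ord) (st := stk [] [] [] []) (S := S) (s := 1) (d := 0) (e := 2)
    (v := 0) (M := x.code.reverse) (D := x.code ++ M) (C := [])
    hR (by omega) (by omega) (by omega) (by simp; omega) (by simp; omega)
  simp only [← stk_013, ← stk_102, ← stk_210, List.reverse_reverse, List.append_nil] at h1 h2 h3 h4
  exact .seq h1 (.seq h2 (.seq h3 h4))

theorem runs_swap (hR : Home R) (x y : KTree K) {M : List K}
    (hS : x.code.length + y.code.length + M.length ≤ S) :
    Runs ord (16 * (S + 1)) (.swap ord) (rest R (x.code ++ (y.code ++ M)))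
      (rest R (y.code ++ (x.code ++ M))) := by
  unfold rest
  have h1 := runs_moveTree (ord := ord) (st := stk [] [] [] []) (S := S) (s := 0) (d := 1) (v := 0)
    hR (by omega) (by omega) (by omega) x (M := y.code ++ M) (D := []) (by simp; omega)
    (by simp; omega)
  have h2 := runs_moveTree (ord := ord) (st := stk [] x.code.reverse [] []) (S := S) (s := 0)
    (d := 2) (v := 0) hR (by omega) (by omega) (by omega) y (M := M) (D := []) (by omega)
    (by simp; omega)
  have h3 := runs_pour₁ (ord := ord) (st := stk [] [] [] []) (S := S) (s := 1) (d := 0) (e := 2)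
    (v := 0) (M := x.code.reverse) (D := M) (C := y.code.reverse)
    hR (by omega) (by omega) (by omega) (by simp; omega) (by simp; omega)
  have h4 := runs_pour₁ (ord := ord) (st := stk [] [] [] []) (S := S) (s := 2) (d := 0) (e := 1)
    (v := 0) (M := y.code.reverse) (D := x.code ++ M) (C := [])
    hR (by omega) (by omega) (by omega) (by simp; omega) (by simp; omega)
  simp only [← stk_013, ← stk_023, ← stk_102, ← stk_201, List.reverse_reverse,
    List.append_nil] at h1 h2 h3 h4
  exact .seq h1 (.seq h2 (.seq h3 h4))

theorem runs_drop (hR : Home R) (x : KTree K) {M : List K}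
    (hS : x.code.length + M.length ≤ S) :
    Runs ord (16 * (S + 1)) (.drop ord) (rest R (x.code ++ M)) (rest R M) := by
  unfold rest
  have h1 := runs_moveTree (ord := ord) (st := stk [] [] [] []) (S := S) (s := 0) (d := 1) (v := 0)
    hR (by omega) (by omega) (by omega) x (M := M) (D := []) (by omega) (by simp; omega)
  have h2 : ∀ (l : List K), l.length ≤ S → ∀ v, ∃ v', Runs ord (16 * (S + 1))
      (.whileNe ord 1 (.pop ord 1)) (carry (mix (stk [] [] [] []) 1 0 2 l M []) R v 0)
      (carry (mix (stk [] [] [] []) 1 0 2 [] M []) R v' 0) := by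
    intro l
    induction l with
    | nil => exact fun _ v => ⟨v, runs_whileNe_done hR (by omega) mix_fst⟩
    | cons k l ih =>
      intro hl v
      rw [List.length_cons] at hl
      obtain ⟨v', h⟩ := ih (by omega) k
      exact ⟨v', runs_whileNe_step hR (by omega) (by rw [mix_fst]; simp)
        (runs_pop_fst hR (by omega) (by omega)) h⟩
  obtain ⟨v', h2⟩ := h2 x.code.reverse (by simp; omega) 0
  simp only [← stk_013, ← stk_102, List.append_nil] at h1 h2
  exact .seq h1 (.seq h2 (runs_setv 0))

theorem runs_popMain (hR : Home R) {k : K} {M : List K} (hS : M.length + 1 ≤ S) :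
    Runs ord (16 * (S + 1)) (.pop ord 0) (carry (stk (k :: M) [] [] []) R v 0)
      (carry (stk M [] [] []) R k 0) := by
  rw [stk_013 (k :: M), stk_013 M]
  exact runs_pop_fst (s := 0) (M := M) hR (by omega) hS

theorem runs_pushMain (hR : Home R) {M : List K} (hS : M.length ≤ S) :
    Runs ord (16 * (S + 1)) (.push ord 0) (carry (stk M [] [] []) R v 0)
      (carry (stk (v :: M) [] [] []) R v 0) := by
  rw [stk_102 M, stk_102 (v :: M)]
  exact runs_push_snd (s := 1) (d := 0) (D := M) hR (by omega) (by omega) hS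

/-- Pushes a list of constants onto the main stack. -/
def Cmd.pushList (ord : Option (SemiringOrder K)) : List K → Cmd K
  | [] => .setv 0
  | k :: l => .seq (.pushList ord l) (.seq (.setv k) (.seq (.push ord 0) (.setv 0)))

theorem runs_pushList (hR : Home R) (l : List K) {M : List K} (hS : l.length + M.length ≤ S)
    (v : K) : Runs ord (16 * (S + 1)) (.pushList ord l) (carry (stk M [] [] []) R v 0)
      (rest R (l ++ M)) := by
  induction l with
  | nil => exact runs_setv 0
  | cons k l ih =>
    rw [List.length_cons] at hS
    exact .seq (ih (by omega)) (.seq (runs_setv k) (.seq (runs_pushMain (M := l ++ M) hR (by simp; omega))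
      (runs_setv 0)))

/-- Pops a given number of elements from the main stack; the last one is kept. -/
def Cmd.pops (ord : Option (SemiringOrder K)) : ℕ → Cmd K
  | 0 => .skip
  | n + 1 => .seq (.pop ord 0) (.pops ord n)

theorem runs_pops (hR : Home R) (l : List K) (k : K) {M : List K} (hS : l.length + 1 + M.length ≤ S)
    (v : K) : Runs ord (16 * (S + 1)) (.pops ord (l.length + 1))
      (carry (stk (l ++ k :: M) [] [] []) R v 0) (carry (stk M [] [] []) R k 0) := by
  induction l generalizing v with
  | nil => exact .seq (runs_popMain (M := M) hR (by simp at hS; omega)) (.skip _)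
  | cons a l ih =>
    rw [List.length_cons] at hS
    exact .seq (runs_popMain (M := l ++ k :: M) hR (by simp; omega)) (ih (by omega) a)

/-- The right half of the tape at home, with the number `u` in the register. -/
def homeR (u : K) : ℤ → K := fun a => if a = 3 then 1 else if a = 6 then u else 0

theorem home_homeR (u : K) : Home (homeR u) := by
  constructor <;> simp [homeR]

/-- Evaluates an operation on register and carried value; the result becomes the carried value. -/
def Cmd.alu (op : ℤ → ℤ → Op K) : Cmd K := .sets [(5, op 6 5), (6, .const 0)]

/-- Straight-line code at home need only be checked on the carried value and the register, provided
that it restores everything else. -/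
theorem runs_regs {B : ℕ} {l : List (ℤ × Op K)} {u u' v v' : K} (h : ∀ b : ℤ → K, b 5 = v →
      b 6 = u → b 1 = 0 → b 2 = 0 → execs l b 0 = Function.update (Function.update b 5 v') 6 u') :
    Runs ord B (.sets l) (carry st (homeR u) v 0) (carry st (homeR u') v' 0) := by
  refine runs_sets' ?_
  simp only [Nat.cast_zero, mul_zero, zero_add]
  rw [h _ (by simp) (by simp [tape, homeR]) (by simp [tape, homeR]) (by simp [tape, homeR])]
  funext a
  simp only [Function.update_apply, tape, homeR]
  split_ifs <;> first | rfl | omega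

end Trees

/-! ### Functions that are computable in polynomial space -/

/-- Data that are represented by trees. -/
class Enc (K : Type*) (α : Type*) where
  enc : α → KTree K

section Encodings

variable (K : Type*) {α β : Type*}

instance : Enc K Unit := ⟨fun _ => .nil⟩

instance : Enc K K := ⟨.leaf⟩

instance [Enc K α] [Enc K β] : Enc K (α × β) := ⟨fun x => .node (Enc.enc x.1) (Enc.enc x.2)⟩

/-- The second symbol of the code is `0` for the left and `1` for the right summand. Case
distinctions and loops find it after two pops. -/
instance [Enc K α] [Enc K β] : Enc K (α ⊕ β) :=
  ⟨Sum.elim (fun a => .node .nil (Enc.enc a)) (fun b => .node (.node .nil .nil) (Enc.enc b))⟩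

/-- Options as a sum type. -/
def optSum : Option α → Unit ⊕ α
  | none => .inl ()
  | some a => .inr a

instance [Enc K α] : Enc K (Option α) := ⟨fun o => Enc.enc (optSum o)⟩

/-- Truth values as a sum type. -/
def boolSum (b : Bool) : Unit ⊕ Unit := if b then .inr () else .inl ()

instance : Enc K Bool := ⟨fun b => Enc.enc (boolSum b)⟩

/-- The tree that represents a list. -/
def encList [Enc K α] : List α → KTree K
  | [] => .node .nil .nil
  | a :: l => .node (.node .nil .nil) (.node (Enc.enc a) (encList l))

instance [Enc K α] : Enc K (List α) := ⟨encList K⟩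

/-- Unary coding makes arithmetic simple, and it is affordable because these numbers are kept below
polynomial bounds. Numbers that the input gives in binary have the separate type `Num`. -/
instance : Enc K ℕ := ⟨fun n => Enc.enc (List.replicate n ())⟩

variable [CommSemiring K] [Enc K α] [Enc K β]

/-- The length of the code of a datum. -/
def sz (a : α) : ℕ := (Enc.enc a : KTree K).code.length

theorem sz_unit (u : Unit) : sz K u = 2 := rfl

theorem sz_self (k : K) : sz K k = 3 := rfl

theorem sz_prod (x : α × β) : sz K x = sz K x.1 + sz K x.2 + 1 := by
  simp [sz, Enc.enc, KTree.code]

theorem sz_inl (a : α) : sz K (Sum.inl a : α ⊕ β) = sz K a + 3 := by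
  simp [sz, Enc.enc, KTree.code]

theorem sz_inr (b : β) : sz K (Sum.inr b : α ⊕ β) = sz K b + 6 := by
  simp [sz, Enc.enc, KTree.code]

theorem sz_none : sz K (none : Option α) = 5 := rfl

theorem sz_some (a : α) : sz K (some a) = sz K a + 6 := by
  simp [sz, Enc.enc, KTree.code, optSum]

theorem sz_bool (b : Bool) : sz K b ≤ 8 := by cases b <;> simp [sz, Enc.enc, KTree.code, boolSum]

theorem sz_nil : sz K ([] : List α) = 5 := rfl

theorem sz_cons (a : α) (l : List α) : sz K (a :: l) = sz K a + sz K l + 7 := by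
  simp [sz, Enc.enc, encList, KTree.code]

theorem sz_nat (n : ℕ) : sz K n = 9 * n + 5 := by
  induction n with
  | zero => rfl
  | succ n ih =>
    have h : sz K (n + 1) = sz K (() :: List.replicate n ()) := rfl
    have h' : sz K n = sz K (List.replicate n ()) := rfl
    rw [h, sz_cons, ← h', ih, sz_unit]; ring

theorem length_le_sz (l : List α) : l.length ≤ sz K l := by
  induction l with
  | nil => exact Nat.zero_le _
  | cons a l ih => rw [sz_cons, List.length_cons]; omega

end Encodings

theorem eval_mono (p : Polynomial ℕ) {m n : ℕ} (h : m ≤ n) : p.eval m ≤ p.eval n := by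
  induction p using Polynomial.induction_on' with
  | add p q hp hq => rw [Polynomial.eval_add, Polynomial.eval_add]; omega
  | monomial k a =>
    rw [Polynomial.eval_monomial, Polynomial.eval_monomial]
    exact Nat.mul_le_mul_left _ (Nat.pow_le_pow_left h k)

section PS

variable {K : Type*} [CommSemiring K] [Nontrivial K] {ord : Option (SemiringOrder K)}

/-- The program `c` replaces the tree `x` at the top of the main stack by `y`, in space `N`. -/
def Impl (ord : Option (SemiringOrder K)) (c : Cmd K) (x y : KTree K) (N : ℕ) : Prop :=
  -- The contents `M` below the argument are arbitrary, so the program can be used as a subroutine.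
  y.code.length ≤ N ∧ ∀ (S : ℕ) (M : List K), N + M.length ≤ S →
    Runs ord (16 * (S + 1)) c (rest (homeR 0) (x.code ++ M)) (rest (homeR 0) (y.code ++ M))

theorem Impl.mono {c : Cmd K} {x y : KTree K} {N N' : ℕ} (h : Impl ord c x y N) (hN : N ≤ N') :
    Impl ord c x y N' :=
  ⟨h.1.trans hN, fun S M hS => h.2 S M (by omega)⟩

variable {α β γ δ : Type*} [Enc K α] [Enc K β] [Enc K γ] [Enc K δ]

/-- The function `f` is computable in polynomial space. -/
@[fun_prop]
def PS (ord : Option (SemiringOrder K)) (f : α → β) : Prop :=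
  ∃ (c : Cmd K) (p : Polynomial ℕ), ∀ a, Impl ord c (Enc.enc a) (Enc.enc (f a)) (p.eval (sz K a))

theorem PS.sz_le {f : α → β} (hf : PS ord f) :
    ∃ p : Polynomial ℕ, ∀ a, sz K (f a) ≤ p.eval (sz K a) :=
  let ⟨_, p, h⟩ := hf
  ⟨p, fun a => (h a).1⟩

/-- Functions that agree with a computable function on the level of codes are computable. -/
theorem PS.recode {f : α → β} {g : γ → δ} (i : α → γ) (hg : PS ord g)
    (hi : ∀ a, (Enc.enc (i a) : KTree K) = Enc.enc a)
    (hf : ∀ a, (Enc.enc (f a) : KTree K) = Enc.enc (g (i a))) : PS ord f := by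
  obtain ⟨c, p, h⟩ := hg
  refine ⟨c, p, fun a => ?_⟩
  have := h (i a)
  unfold sz at this ⊢
  rwa [hi, ← hf] at this

@[fun_prop]
theorem PS.id : PS ord (fun a : α => a) :=
  ⟨.skip, Polynomial.X, fun a => ⟨by simp [sz], fun _ _ _ => .skip _⟩⟩

@[fun_prop]
theorem PS.const (b : β) : PS ord (fun _ : α => b) := by
  refine ⟨.seq (.drop ord) (.pushList ord (Enc.enc b : KTree K).code),
    Polynomial.X + Polynomial.C (sz K b), fun a => ⟨by simp [sz], fun S M hS => ?_⟩⟩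
  simp [sz] at hS
  exact .seq (runs_drop (home_homeR 0) _ (by omega))
    (runs_pushList (home_homeR 0) _ (by omega) 0)

-- The second program starts from a datum of size at most `p(n)`, and polynomials are closed under
-- composition; monotonicity of polynomials over `ℕ` does the rest.
@[fun_prop]
theorem PS.comp {g : β → γ} {f : α → β} (hg : PS ord g) (hf : PS ord f) :
    PS ord (fun a => g (f a)) := by
  obtain ⟨c, p, hp⟩ := hf
  obtain ⟨d, q, hq⟩ := hg
  refine ⟨.seq c d, p + q.comp p, fun a => ?_⟩
  have h1 := hp a
  have h2 := (hq (f a)).mono (eval_mono q h1.1)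
  rw [Polynomial.eval_add, Polynomial.eval_comp]
  exact ⟨h2.1.trans (Nat.le_add_left _ _), fun S M hS =>
    .seq (h1.2 S M (by omega)) (h2.2 S M (by omega))⟩

-- The argument is duplicated. While one program works on the top tree, the other copy, or the other
-- result, waits beneath it; swaps exchange the roles.
@[fun_prop]
theorem PS.prodMk {f : α → β} {g : α → γ} (hf : PS ord f) (hg : PS ord g) :
    PS ord (fun a => (f a, g a)) := by
  obtain ⟨c, p, hp⟩ := hf
  obtain ⟨d, q, hq⟩ := hg
  refine ⟨.seq (.dup ord) (.seq c (.seq (.swap ord) (.seq d (.seq (.swap ord)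
    (.pushList ord [1]))))), p + q + 2 * Polynomial.X + 1, fun a => ?_⟩
  have h1 := hp a
  have h2 := hq a
  have h3 := h1.1
  have h4 := h2.1
  simp only [Polynomial.eval_add, Polynomial.eval_mul, Polynomial.eval_X, Polynomial.eval_ofNat,
    Polynomial.eval_one] at *
  unfold sz at *
  refine ⟨by simp [Enc.enc, KTree.code] at *; omega, fun S M hS => ?_⟩
  refine .seq (runs_dup (home_homeR 0) _ (by omega)) (.seq (h1.2 S _ (by simp; omega))
    (.seq (runs_swap (home_homeR 0) _ _ (by omega)) (.seq (h2.2 S _ (by simp; omega))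
    (.seq (runs_swap (home_homeR 0) _ _ (by omega)) ?_))))
  have := runs_pushList (ord := ord) (S := S) (home_homeR (0 : K)) [1]
    (M := (Enc.enc (f a) : KTree K).code ++ ((Enc.enc (g a) : KTree K).code ++ M))
    (by simp; omega) 0
  have e : (Enc.enc (f a, g a) : KTree K).code ++ M = [1] ++ ((Enc.enc (f a) : KTree K).code ++
      ((Enc.enc (g a) : KTree K).code ++ M)) := by simp [Enc.enc, KTree.code]
  rw [e]
  exact this

/-- Removal of elements from the main stack at rest. -/
theorem runs_pops_rest {S : ℕ} (l : List K) (k : K) {M : List K}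
    (hS : l.length + 1 + M.length ≤ S) :
    Runs ord (16 * (S + 1)) (.seq (.pops ord (l.length + 1)) (.setv 0))
      (rest (homeR 0) (l ++ k :: M)) (rest (homeR 0) M) :=
  .seq (runs_pops (home_homeR 0) _ _ hS 0) (runs_setv 0)

theorem PS.fst' : PS ord (fun x : α × β => x.1) := by
  refine ⟨.seq (.seq (.pops ord (0 + 1)) (.setv 0)) (.seq (.swap ord) (.drop ord)), Polynomial.X,
    fun x => ?_⟩
  simp only [Polynomial.eval_X, sz, Enc.enc, KTree.code, List.length_cons, List.length_append]
  refine ⟨by omega, fun S M hS => ?_⟩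
  refine .seq (runs_pops_rest [] 1 (by simp; omega)) ?_
  rw [List.append_eq, List.append_assoc]
  exact .seq (runs_swap (home_homeR 0) _ _ (by omega)) (runs_drop (home_homeR 0) _ (by simp; omega))

theorem PS.snd' : PS ord (fun x : α × β => x.2) := by
  refine ⟨.seq (.seq (.pops ord (0 + 1)) (.setv 0)) (.drop ord), Polynomial.X, fun x => ?_⟩
  simp only [Polynomial.eval_X, sz, Enc.enc, KTree.code, List.length_cons, List.length_append]
  refine ⟨by omega, fun S M hS => ?_⟩
  refine .seq (runs_pops_rest [] 1 (by simp; omega)) ?_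
  rw [List.append_eq, List.append_assoc]
  exact runs_drop (home_homeR 0) _ (by simp; omega)

@[fun_prop]
theorem PS.fst {f : α → β × γ} (hf : PS ord f) : PS ord (fun a => (f a).1) := PS.fst'.comp hf

@[fun_prop]
theorem PS.snd {f : α → β × γ} (hf : PS ord f) : PS ord (fun a => (f a).2) := PS.snd'.comp hf

theorem PS.inl' : PS ord (fun a : α => (Sum.inl a : α ⊕ β)) := by
  refine ⟨.pushList ord [1, 0, 0], Polynomial.X + 3, fun a => ⟨?_, fun S M hS => ?_⟩⟩
  · simp [sz, Enc.enc, KTree.code]; omega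
  · simp [sz] at hS
    exact runs_pushList (home_homeR 0) _ (by simp; omega) 0

theorem PS.inr' : PS ord (fun b : β => (Sum.inr b : α ⊕ β)) := by
  refine ⟨.pushList ord [1, 1, 0, 0, 0, 0], Polynomial.X + 6, fun a => ⟨?_, fun S M hS => ?_⟩⟩
  · simp [sz, Enc.enc, KTree.code]; omega
  · simp [sz] at hS
    exact runs_pushList (home_homeR 0) _ (by simp; omega) 0

@[fun_prop]
theorem PS.inl {f : α → β} (hf : PS ord f) : PS ord (fun a => (Sum.inl (f a) : β ⊕ γ)) :=
  PS.inl'.comp hf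

@[fun_prop]
theorem PS.inr {f : α → γ} (hf : PS ord f) : PS ord (fun a => (Sum.inr (f a) : β ⊕ γ)) :=
  PS.inr'.comp hf

theorem PS.sumElim' {f : α → γ} {g : β → γ} (hf : PS ord f) (hg : PS ord g) :
    PS ord (fun x : α ⊕ β => Sum.elim f g x) := by
  obtain ⟨c, p, hp⟩ := hf
  obtain ⟨d, q, hq⟩ := hg
  -- The tags are coded by `1, 0, 0` and `1, 1, 0, 0, 0, 0`, including the symbol of the root. After
  -- two pops, one or four symbols are left to be removed.
  refine ⟨.seq (.pops ord (1 + 1)) (.iteAt ord 5 (.seq (.seq (.pops ord (3 + 1)) (.setv 0)) d)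
    (.seq (.seq (.pops ord (0 + 1)) (.setv 0)) c)), p + q + Polynomial.X, fun x => ?_⟩
  simp only [Polynomial.eval_add, Polynomial.eval_X]
  rcases x with a | b
  · have h := hp a
    have h1 := eval_mono p (show sz K a ≤ sz K (Sum.inl a : α ⊕ β) by rw [sz_inl]; omega)
    refine ⟨h.1.trans (by omega), fun S M hS => ?_⟩
    have h2 : (Enc.enc a : KTree K).code.length + 3 = sz K (Sum.inl a : α ⊕ β) := (sz_inl K a).symm
    refine .seq (runs_pops (home_homeR 0) [1] 0 (M := 0 :: ((Enc.enc a : KTree K).code ++ M))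
      (by simp; omega) 0) (runs_iteAt_zero (home_homeR 0) ?_)
    exact .seq (runs_pops_rest [] 0 (by simp; omega)) (h.2 S M (by omega))
  · have h := hq b
    have h1 := eval_mono q (show sz K b ≤ sz K (Sum.inr b : α ⊕ β) by rw [sz_inr]; omega)
    refine ⟨h.1.trans (by omega), fun S M hS => ?_⟩
    have h2 : (Enc.enc b : KTree K).code.length + 6 = sz K (Sum.inr b : α ⊕ β) := (sz_inr K b).symm
    refine .seq (runs_pops (home_homeR 0) [1] 1
      (M := 0 :: 0 :: 0 :: 0 :: ((Enc.enc b : KTree K).code ++ M))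
      (by simp; omega) 0) (runs_iteAt_one (home_homeR 0) ?_)
    exact .seq (.seq (runs_pops (home_homeR 0) [0, 0, 0] 0 (by simp; omega) 1) (runs_setv 0))
      (h.2 S M (by omega))

instance : Enc K (KTree K) := ⟨_root_.id⟩

/-- The tag of an element of a sum type. -/
def sumTag (K : Type*) {α β : Type*} : α ⊕ β → KTree K
  | .inl _ => .nil
  | .inr _ => .node .nil .nil

/-- The payload of an element of a sum type. -/
def sumData (K : Type*) {α β : Type*} [Enc K α] [Enc K β] : α ⊕ β → KTree K
  | .inl a => Enc.enc a
  | .inr b => Enc.enc b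

/-- Distributivity of products over sums. -/
def distSum {α β γ : Type*} (x : γ × (α ⊕ β)) : (γ × α) ⊕ (γ × β) :=
  Sum.elim (fun a => .inl (x.1, a)) (fun b => .inr (x.1, b)) x.2

/-- On codes this merely moves the tag outwards without inspecting it. Hence projections and pairing
on raw trees suffice. -/
theorem PS.distSum : PS ord (distSum : γ × (α ⊕ β) → (γ × α) ⊕ (γ × β)) := by
  refine PS.recode (g := fun x : γ × KTree K × KTree K => (x.2.1, (x.1, x.2.2)))
    (fun x => (x.1, sumTag K x.2, sumData K x.2)) (by fun_prop) ?_ ?_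
  · rintro ⟨c, a | b⟩ <;> rfl
  · rintro ⟨c, a | b⟩ <;> rfl

@[fun_prop]
theorem PS.sumElim {h : δ → α ⊕ β} {f : δ → α → γ} {g : δ → β → γ} (hh : PS ord h)
    (hf : PS ord (fun x : δ × α => f x.1 x.2)) (hg : PS ord (fun x : δ × β => g x.1 x.2)) :
    PS ord (fun x => Sum.elim (f x) (g x) (h x)) := by
  have := (PS.sumElim' hf hg).comp (PS.distSum.comp (PS.id.prodMk hh))
  refine this.recode (fun x => x) (fun _ => rfl) fun x => ?_
  rcases hx : h x with a | b <;> simp [SemiringFO.distSum, hx]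

end PS

/-! ### Semiring operations and loops -/

section Basic

variable {K : Type*} [CommSemiring K] [Nontrivial K] {ord : Option (SemiringOrder K)}

variable {α β γ δ : Type*} [Enc K α] [Enc K β] [Enc K γ] [Enc K δ]

/-- Loads a pair of semiring elements into register and carried value. -/
def Cmd.load2 (ord : Option (SemiringOrder K)) : Cmd K :=
  .seq (.pops ord (3 + 1)) (.seq (.sets [(6, .add 6 5)]) (.pops ord (2 + 1)))

theorem runs_load2 {S : ℕ} (a b : K) {M : List K} (hS : 7 + M.length ≤ S) :
    Runs ord (16 * (S + 1)) (.load2 ord) (rest (homeR 0) ((Enc.enc (a, b) : KTree K).code ++ M))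
      (carry (stk M [] [] []) (homeR a) b 0) := by
  refine .seq (runs_pops (home_homeR 0) [1, 0, 1] a (M := 0 :: 1 :: b :: M) (by simp; omega) 0)
    (.seq (t := carry (stk (0 :: 1 :: b :: M) [] [] []) (homeR a) a 0) (runs_regs ?_)
      (runs_pops (home_homeR a) [0, 1] b (by simp; omega) a))
  intro c h5 h6 _ _
  funext i
  simp only [execs, Op.val, Function.update_apply, zero_add, h5, h6]
  split_ifs <;> simp_all

theorem PS.alu (op : ℤ → ℤ → Op K) (g : K → K → K)
    (h : ∀ f : ℤ → K, (op 6 5).val f = g (f 6) (f 5)) :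
    PS ord (fun x : K × K => g x.1 x.2) := by
  refine ⟨.seq (.load2 ord) (.seq (.alu op) (.seq (.push ord 0) (.pushList ord [0, 1]))), 7,
    fun x => ?_⟩
  obtain ⟨a, b⟩ := x
  simp only [Polynomial.eval_ofNat]
  refine ⟨by simp [Enc.enc, KTree.code], fun S M hS => ?_⟩
  refine .seq (runs_load2 a b hS) (.seq (t := carry (stk M [] [] []) (homeR 0) (g a b) 0)
    (runs_regs ?_) (.seq (runs_pushMain (home_homeR 0) (by omega)) (runs_pushList (home_homeR 0) [0, 1]
      (M := g a b :: M) (by simp; omega) _)))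
  intro c h5 h6 _ _
  funext i
  simp only [execs, h, zero_add, h5, h6]
  simp [Function.update_apply, Op.val]

@[fun_prop]
theorem PS.add {f g : α → K} (hf : PS ord f) (hg : PS ord g) : PS ord (fun a => f a + g a) :=
  (PS.alu .add (· + ·) fun _ => rfl).comp (hf.prodMk hg)

@[fun_prop]
theorem PS.mul {f g : α → K} (hf : PS ord f) (hg : PS ord g) : PS ord (fun a => f a * g a) :=
  (PS.alu .mul (· * ·) fun _ => rfl).comp (hf.prodMk hg)

/-- The test that a branch node performs, as a function. -/
def branchTest (ord : Option (SemiringOrder K)) (a b : K) : Bool := decide (BranchRel ord a b)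

/-- Here two arbitrary elements of `K` meet in a branch node. Unlike a bit, they cannot be restored
from the outcome; both branches clear the working cells and push a constant answer. -/
theorem PS.branchTest' : PS ord (fun x : K × K => branchTest ord x.1 x.2) := by
  refine ⟨.seq (.load2 ord) (.seq (.sets [(1, .add 1 6), (2, .add 2 5)])
    (.ite (.seq (.sets [(1, .const 0), (2, .const 0), (5, .const 0), (6, .const 0)])
      (.pushList ord (Enc.enc true : KTree K).code))
    (.seq (.sets [(1, .const 0), (2, .const 0), (5, .const 0), (6, .const 0)])
      (.pushList ord (Enc.enc false : KTree K).code)))), 8, fun x => ?_⟩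
  obtain ⟨a, b⟩ := x
  simp only [Polynomial.eval_ofNat]
  refine ⟨sz_bool K _, fun S M hS => ?_⟩
  refine .seq (runs_load2 a b (by omega)) (.seq (runs_sets _ _ _) ?_)
  have key : ∀ e : Bool, Runs ord (16 * (S + 1))
      (.seq (.sets [(1, .const 0), (2, .const 0), (5, .const 0), (6, .const 0)])
      (.pushList ord (Enc.enc e : KTree K).code))
      (execs [(1, .add 1 6), (2, .add 2 5)] (carry (stk M [] [] []) (homeR a) b 0).1
        (carry (stk M [] [] []) (homeR a) b 0).2, (carry (stk M [] [] []) (homeR a) b 0).2)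
      (rest (homeR 0) ((Enc.enc e : KTree K).code ++ M)) := by
    intro e
    have he := sz_bool K e
    unfold sz at he
    refine .seq (t := carry (stk M [] [] []) (homeR 0) 0 0) (runs_sets' ?_)
      (runs_pushList (home_homeR 0) _ (by omega) _)
    simp only [carry]
    funext i
    simp only [execs, Op.val, Function.update_apply, tape, homeR, Nat.cast_zero]
    split_ifs <;> first | rfl | omega
  have e1 : execs [(1, .add 1 6), (2, .add 2 5)] (carry (stk M [] [] []) (homeR a) b 0).1
        (carry (stk M [] [] []) (homeR a) b 0).2 ((carry (stk M [] [] []) (homeR a) b 0).2 + 1)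
        = a := by
    simp [carry, execs, Op.val, Function.update_apply, tape, homeR]
  have e2 : execs [(1, .add 1 6), (2, .add 2 5)] (carry (stk M [] [] []) (homeR a) b 0).1
        (carry (stk M [] [] []) (homeR a) b 0).2 ((carry (stk M [] [] []) (homeR a) b 0).2 + 2)
        = b := by
    simp [carry, execs, Op.val, Function.update_apply, tape, homeR]
  by_cases h : BranchRel ord a b
  · have e3 : branchTest ord a b = true := decide_eq_true h
    simp only [e3]
    refine .iteTrue ?_ (key true)
    dsimp only [carry] at e1 e2 ⊢
    rwa [e1, e2]
  · have e3 : branchTest ord a b = false := decide_eq_false h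
    simp only [e3]
    refine .iteFalse ?_ (key false)
    dsimp only [carry] at e1 e2 ⊢
    rwa [e1, e2]

@[fun_prop]
theorem PS.branchTest {f g : α → K} (hf : PS ord f) (hg : PS ord g) :
    PS ord (fun a => branchTest ord (f a) (g a)) :=
  PS.branchTest'.comp (hf.prodMk hg)

/-! ### Case distinctions -/

@[fun_prop]
theorem PS.optElim {h : α → Option β} {n : α → γ} {s : α → β → γ} (hh : PS ord h)
    (hn : PS ord n) (hs : PS ord (fun x : α × β => s x.1 x.2)) :
    PS ord (fun x => (h x).elim (n x) (s x)) := by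
  have hh' : PS ord (fun x => optSum (h x)) := hh.recode (fun x => x) (fun _ => rfl) fun _ => rfl
  have := PS.sumElim (f := fun x _ => n x) (g := s) hh' (by fun_prop) hs
  refine this.recode (fun x => x) (fun _ => rfl) fun x => ?_
  rcases h x with _ | b <;> rfl

@[fun_prop]
theorem PS.some {f : α → β} (hf : PS ord f) : PS ord (fun x => some (f x)) :=
  (PS.inr (β := Unit) hf).recode (fun x => x) (fun _ => rfl) fun _ => rfl

@[fun_prop]
theorem PS.cond {h : α → Bool} {f g : α → β} (hh : PS ord h) (hf : PS ord f) (hg : PS ord g) :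
    PS ord (fun x => cond (h x) (f x) (g x)) := by
  have hh' : PS ord (fun x => boolSum (h x)) := hh.recode (fun x => x) (fun _ => rfl) fun _ => rfl
  have := PS.sumElim (f := fun x _ => g x) (g := fun x _ => f x) hh' (by fun_prop) (by fun_prop)
  refine this.recode (fun x => x) (fun _ => rfl) fun x => ?_
  rcases h x with _ | b <;> rfl

@[fun_prop]
theorem PS.and {f g : α → Bool} (hf : PS ord f) (hg : PS ord g) : PS ord (fun x => f x && g x) := by
  have : (fun x => f x && g x) = fun x => _root_.cond (f x) (g x) false := by
    funext x; cases f x <;> rfl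
  rw [this]; fun_prop

@[fun_prop]
theorem PS.not {f : α → Bool} (hf : PS ord f) : PS ord (fun x => !f x) := by
  have : (fun x => !f x) = fun x => _root_.cond (f x) false true := by
    funext x; cases f x <;> rfl
  rw [this]; fun_prop

@[fun_prop]
theorem PS.xor {f g : α → Bool} (hf : PS ord f) (hg : PS ord g) :
    PS ord (fun x => f x ^^ g x) := by
  have : (fun x => f x ^^ g x) = fun x => _root_.cond (f x) (!g x) (g x) := by
    funext x; cases f x <;> simp
  rw [this]; fun_prop

/-- Equality of semiring elements, as a function. -/
def keq (a b : K) : Bool := decide (a = b)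

-- By antisymmetry, two branch tests in opposite orders decide equality, even if the machine can
-- only test `≤`.
@[fun_prop]
theorem PS.keq {f g : α → K} (hf : PS ord f) (hg : PS ord g) : PS ord (fun a => keq (f a) (g a)) := by
  have : (fun a => SemiringFO.keq (f a) (g a)) = fun a => SemiringFO.branchTest ord (f a) (g a) &&
      SemiringFO.branchTest ord (g a) (f a) := by
    funext a
    unfold SemiringFO.keq SemiringFO.branchTest
    rw [← Bool.decide_and, decide_eq_decide]
    exact ⟨fun h => h ▸ ⟨branchRel_self _, branchRel_self _⟩, fun h => branchRel_antisymm h.1 h.2⟩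
  rw [this]; fun_prop

@[fun_prop]
theorem PS.listCons {f : α → β} {g : α → List β} (hf : PS ord f) (hg : PS ord g) :
    PS ord (fun x => f x :: g x) :=
  (PS.inr (β := Unit) (hf.prodMk hg)).recode (fun x => x) (fun _ => rfl) fun _ => rfl

/-- The decomposition of a list into head and tail. -/
def uncons {α : Type*} : List α → Option (α × List α)
  | [] => none
  | a :: l => some (a, l)

@[fun_prop]
theorem PS.uncons {f : α → List β} (hf : PS ord f) : PS ord (fun x => uncons (f x)) := by
  refine hf.recode (fun x => x) (fun _ => rfl) fun x => ?_
  rcases f x with _ | ⟨b, l⟩ <;> rfl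

@[fun_prop]
theorem PS.succ {f : α → ℕ} (hf : PS ord f) : PS ord (fun x => f x + 1) :=
  (PS.listCons (PS.const ()) (hf.recode (f := fun x => List.replicate (f x) ()) (fun x => x)
    (fun _ => rfl) fun _ => rfl)).recode (fun x => x) (fun _ => rfl) fun _ => rfl

/-- The list of units that represents a number. -/
def units (n : ℕ) : List Unit := List.replicate n ()

@[fun_prop]
theorem PS.units {f : α → ℕ} (hf : PS ord f) : PS ord (fun x => units (f x)) :=
  hf.recode (fun x => x) (fun _ => rfl) fun _ => rfl

@[fun_prop]
theorem PS.length_units {f : α → List Unit} (hf : PS ord f) : PS ord (fun x => (f x).length) :=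
  hf.recode (fun x => x) (fun _ => rfl) fun x => by
    show (Enc.enc (List.replicate (f x).length ()) : KTree K) = _
    rw [← List.eq_replicate_length.2 fun _ _ => rfl]

@[fun_prop]
theorem PS.pred {f : α → ℕ} (hf : PS ord f) : PS ord (fun x => f x - 1) := by
  have : (fun x => f x - 1) = fun x =>
      (SemiringFO.uncons (SemiringFO.units (f x))).elim 0 (fun y => y.2.length) := by
    funext x
    rcases f x with _ | n
    · rfl
    · simp [SemiringFO.units, List.replicate_succ, SemiringFO.uncons]
  rw [this]; fun_prop

/-! ### Loops -/

/-- A run of the loop with the given step, with data of size at most `W`. -/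
inductive Chain (K : Type*) [CommSemiring K] {α β : Type*} [Enc K α] [Enc K β]
    (step : α → β ⊕ α) (W : ℕ) : α → β → Prop where
  | done {a b} (h : sz K a ≤ W) (hs : step a = .inl b) : Chain K step W a b
  | next {a a' b} (h : sz K a ≤ W) (hs : step a = .inr a') (hc : Chain K step W a' b) :
      Chain K step W a b

/-- Functions that are bounded by a polynomial in the size of the argument. -/
def PB (K : Type*) [CommSemiring K] {α : Type*} [Enc K α] (g : α → ℕ) : Prop :=
  ∃ p : Polynomial ℕ, ∀ a, g a ≤ p.eval (sz K a)

/-- Only the size of the data is bounded, not the number of passes: termination is part of `Chain`.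
The step leaves a sum on the stack, and its tag tells whether to go on. In the space bound, `r` pays
for the initialization and `p.comp q` for a step on data of the maximal size. -/
theorem PS.loop {step : α → β ⊕ α} {init : δ → α} {f : δ → β} (hs : PS ord step)
    (hi : PS ord init) {W : δ → ℕ} (hW : PB K W)
    (h : ∀ x, Chain K step (W x) (init x) (f x)) : PS ord f := by
  obtain ⟨c, p, hp⟩ := hs
  obtain ⟨d, r, hr⟩ := hi
  obtain ⟨q, hq⟩ := hW
  refine ⟨.seq d <| .seq c (.seq (.pops ord (1 + 1)) (.seq (.whileAt ord true 5 (.seq (.seq (.pops ord (3 + 1))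
    (.setv 0)) (.seq c (.pops ord (1 + 1))))) (.seq (.pops ord (0 + 1)) (.setv 0)))),
    r + p.comp q, fun x => ?_⟩
  have hW : p.eval (W x) ≤ (r + p.comp q).eval (sz K x) := by
    rw [Polynomial.eval_add, Polynomial.eval_comp]
    exact (eval_mono p (hq x)).trans (Nat.le_add_left _ _)
  have hd := (hr x).mono (show _ ≤ (r + p.comp q).eval (sz K x) by simp)
  have ha := h x
  revert ha hd
  generalize f x = b
  generalize W x = N at hW
  generalize (r + p.comp q).eval (sz K x) = N' at hW
  generalize init x = a
  clear h hq
  intro hd ha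
  suffices ∀ a b, Chain K step N a b → (Enc.enc b : KTree K).code.length ≤ N' ∧
      ∀ (S : ℕ) (M : List K), N' + M.length ≤ S → Runs ord (16 * (S + 1))
      (.seq c (.seq (.pops ord (1 + 1)) (.seq (.whileAt ord true 5 (.seq (.seq (.pops ord (3 + 1))
      (.setv 0)) (.seq c (.pops ord (1 + 1))))) (.seq (.pops ord (0 + 1)) (.setv 0)))))
      (rest (homeR 0) ((Enc.enc a : KTree K).code ++ M))
      (rest (homeR 0) ((Enc.enc b : KTree K).code ++ M)) from
    ⟨(this a b ha).1, fun S M hS => .seq (hd.2 S M hS) ((this a b ha).2 S M hS)⟩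
  clear ha hd a b
  intro a b ha
  induction ha with
  | @done a b hsz he =>
    have h1 := ((hp a).mono (eval_mono p hsz)).mono hW
    rw [he] at h1
    have h2 := h1.1
    simp only [Enc.enc, Sum.elim_inl, KTree.code] at h2
    refine ⟨by simp at h2 ⊢; omega, fun S M hS => ?_⟩
    refine .seq (h1.2 S M hS) (.seq (runs_pops (home_homeR 0) [1] 0
      (M := 0 :: ((Enc.enc b : KTree K).code ++ M)) (by simp at h2 ⊢; omega) 0) (.seq
      ((isTest_carry (f := false) (home_homeR 0) (by omega) (by simp [carry, bit])).runs_done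
        (by simp)) (runs_pops_rest [] 0 (by simp at h2 ⊢; omega))))
  | @next a a' b hsz he _ ih =>
    have h1 := ((hp a).mono (eval_mono p hsz)).mono hW
    rw [he] at h1
    have h2 := h1.1
    simp only [Enc.enc, Sum.elim_inr, KTree.code] at h2
    refine ⟨ih.1, fun S M hS => ?_⟩
    have ih' := ih.2 S M hS
    -- The run from `a'` begins with a step and the reading of a tag; these become the end of the
    -- present pass.
    cases ih' with
    | seq i1 i2 =>
    cases i2 with
    | seq i3 i4 =>
    cases i4 with
    | seq i5 i6 =>
    refine .seq (h1.2 S M hS) (.seq (runs_pops (home_homeR 0) [1] 1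
      (M := 0 :: 0 :: 0 :: 0 :: ((Enc.enc a' : KTree K).code ++ M)) (by simp at h2 ⊢; omega) 0) (.seq
      ((isTest_carry (f := true) (home_homeR 0) (by omega) (by simp [carry, bit])).runs_step rfl
        (.seq (.seq (runs_pops (home_homeR 0) [0, 0, 0] 0 (M := (Enc.enc a' : KTree K).code ++ M)
          (by simp at h2 ⊢; omega) 1) (runs_setv 0)) (.seq i1 i3)) i5) i6))

end Basic

/-! ### Lists and numbers -/

section Lists

variable {K : Type*} [CommSemiring K] [Nontrivial K] {ord : Option (SemiringOrder K)}

variable {α β γ δ : Type*} [Enc K α] [Enc K β] [Enc K γ] [Enc K δ]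

theorem PB.mono {f g : α → ℕ} (hg : PB K g) (h : ∀ a, f a ≤ g a) : PB K f :=
  let ⟨p, hp⟩ := hg
  ⟨p, fun a => (h a).trans (hp a)⟩

theorem PB.const (n : ℕ) : PB K (fun _ : α => n) := ⟨Polynomial.C n, fun a => by simp⟩

theorem PB.add {f g : α → ℕ} (hf : PB K f) (hg : PB K g) : PB K (fun a => f a + g a) :=
  let ⟨p, hp⟩ := hf
  let ⟨q, hq⟩ := hg
  ⟨p + q, fun a => by rw [Polynomial.eval_add]; exact Nat.add_le_add (hp a) (hq a)⟩

theorem PB.mul {f g : α → ℕ} (hf : PB K f) (hg : PB K g) : PB K (fun a => f a * g a) :=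
  let ⟨p, hp⟩ := hf
  let ⟨q, hq⟩ := hg
  ⟨p * q, fun a => by rw [Polynomial.eval_mul]; exact Nat.mul_le_mul (hp a) (hq a)⟩

theorem PB.sz {f : α → β} (hf : PS ord f) : PB K (fun a => sz K (f a)) := hf.sz_le

theorem PB.of_ps {f : α → ℕ} (hf : PS ord f) : PB K f :=
  (PB.sz hf).mono fun a => by rw [sz_nat]; omega

theorem PB.eval {f : α → ℕ} (hf : PB K f) (p : Polynomial ℕ) : PB K (fun a => p.eval (f a)) :=
  let ⟨q, hq⟩ := hf
  ⟨p.comp q, fun a => by rw [Polynomial.eval_comp]; exact eval_mono p (hq a)⟩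

theorem sz_le_of_mem {a : α} {l : List α} (h : a ∈ l) : sz K a + 7 ≤ sz K l := by
  induction l with
  | nil => simp at h
  | cons b l ih =>
    rw [sz_cons]
    rcases List.mem_cons.1 h with rfl | h
    · omega
    · have := ih h; omega

theorem sz_le_of_forall {l : List α} {C : ℕ} (h : ∀ a ∈ l, sz K a ≤ C) :
    sz K l ≤ l.length * (C + 7) + 5 := by
  induction l with
  | nil => simp [sz_nil]
  | cons b l ih =>
    have h1 := h b (by simp)
    have h2 := ih fun a ha => h a (by simp [ha])
    rw [sz_cons, List.length_cons, Nat.succ_mul]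
    omega

/-- A fold is computable in polynomial space if the intermediate values are bounded. -/
theorem PS.foldl_of_le {g : δ → β → γ → β} {a : δ → β} {l : δ → List γ}
    (hg : PS ord (fun x : (δ × β) × γ => g x.1.1 x.1.2 x.2)) (ha : PS ord a) (hl : PS ord l)
    {W : δ → ℕ} (hW : PB K W)
    (h : ∀ x l₁ l₂, l x = l₁ ++ l₂ → sz K (l₁.foldl (g x) (a x)) ≤ W x) :
    PS ord (fun x => (l x).foldl (g x) (a x)) := by
  refine PS.loop (init := fun x => (x, a x, l x)) (step := fun y : δ × β × List γ =>
    (SemiringFO.uncons y.2.2).elim (Sum.inl y.2.1)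
      fun z => Sum.inr (y.1, g y.1 y.2.1 z.1, z.2)) ?_ (by fun_prop)
    (W := fun x => sz K x + W x + sz K (l x) + 2)
    ((((PB.sz (PS.id (ord := ord))).add hW).add (PB.sz hl)).add (PB.const 2)) ?_
  · have : PS ord fun y : (δ × β × List γ) × (γ × List γ) => g y.1.1 y.1.2.1 y.2.1 :=
      hg.comp (f := fun y : (δ × β × List γ) × (γ × List γ) => ((y.1.1, y.1.2.1), y.2.1))
        (by fun_prop)
    exact .optElim (by fun_prop) (by fun_prop)
      (.inr (.prodMk (by fun_prop) (.prodMk this (by fun_prop))))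
  · intro x
    have key : ∀ l₂ l₁, l x = l₁ ++ l₂ → Chain K (fun y : δ × β × List γ =>
        (SemiringFO.uncons y.2.2).elim (Sum.inl y.2.1)
          fun z => Sum.inr (y.1, g y.1 y.2.1 z.1, z.2)) (sz K x + W x + sz K (l x) + 2)
        (x, l₁.foldl (g x) (a x), l₂) ((l x).foldl (g x) (a x)) := by
      intro l₂
      have hsz : ∀ l₁ : List γ, sz K l₂ ≤ sz K (l₁ ++ l₂) := by
        intro l₁
        induction l₁ with
        | nil => exact le_rfl
        | cons c l₁ ih => rw [List.cons_append, sz_cons]; omega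
      induction l₂ with
      | nil =>
        intro l₁ e
        have h1 := h x _ _ e
        refine .done ?_ ?_
        · simp only [sz_prod]
          have := hsz l₁
          rw [← e] at this
          omega
        · rw [e]; simp [SemiringFO.uncons]
      | cons c l₂ ih =>
        intro l₁ e
        have h1 := h x _ _ e
        refine .next ?_ rfl ?_
        · simp only [sz_prod]
          have := hsz l₁
          rw [← e] at this
          omega
        · have := ih (fun l₁ => ?_) (l₁ ++ [c]) (by simp [e])
          · simpa using this
          · clear * -
            induction l₁ with
            | nil => exact le_rfl
            | cons c l₁ ih => rw [List.cons_append, sz_cons]; omega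
    exact key (l x) [] rfl

/-- A fold is computable in polynomial space if the steps increase the size by bounded amounts. -/
theorem PS.foldl_of_add {g : δ → β → γ → β} {a : δ → β} {l : δ → List γ}
    (hg : PS ord (fun x : (δ × β) × γ => g x.1.1 x.1.2 x.2)) (ha : PS ord a) (hl : PS ord l)
    {C : δ → ℕ} (hC : PB K C) (h : ∀ x b, ∀ c ∈ l x, sz K (g x b c) ≤ sz K b + C x) :
    PS ord (fun x => (l x).foldl (g x) (a x)) := by
  refine PS.foldl_of_le hg ha hl (W := fun x => sz K (a x) + sz K (l x) * C x)
    ((PB.sz ha).add ((PB.sz hl).mul hC)) fun x l₁ l₂ e => ?_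
  have key : ∀ (l₁ : List γ) (b : β), (∀ c ∈ l₁, c ∈ l x) →
      sz K (l₁.foldl (g x) b) ≤ sz K b + l₁.length * C x := by
    intro l₁
    induction l₁ with
    | nil => simp
    | cons c l₁ ih =>
      intro b hb
      rw [List.foldl_cons, List.length_cons, Nat.succ_mul]
      have h1 := h x b c (hb c (by simp))
      have h2 := ih (g x b c) fun d hd => hb d (by simp [hd])
      omega
  have h1 := key l₁ (a x) fun c hc => by rw [e]; simp [hc]
  have h2 : l₁.length ≤ sz K (l x) := by
    have := length_le_sz K (l x)
    rw [e] at this ⊢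
    simp at this
    omega
  have h3 := Nat.mul_le_mul_right (C x) h2
  omega

theorem foldl_units {g : β → β} {a : β} (n : ℕ) :
    (units n).foldl (fun b _ => g b) a = g^[n] a := by
  induction n generalizing a with
  | zero => rfl
  | succ n ih => rw [Function.iterate_succ_apply, ← ih]; rfl

theorem PS.iterate_of_le {g : δ → β → β} {a : δ → β} {n : δ → ℕ}
    (hg : PS ord (fun x : δ × β => g x.1 x.2)) (ha : PS ord a) (hn : PS ord n)
    {W : δ → ℕ} (hW : PB K W) (h : ∀ x, ∀ k ≤ n x, sz K ((g x)^[k] (a x)) ≤ W x) :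
    PS ord (fun x => (g x)^[n x] (a x)) := by
  have := PS.foldl_of_le (g := fun x b (_ : Unit) => g x b) (a := a)
    (l := fun x => SemiringFO.units (n x))
    (hg.comp (f := fun y : (δ × β) × Unit => (y.1.1, y.1.2)) (by fun_prop)) ha (by fun_prop) hW ?_
  · simpa only [foldl_units] using this
  · intro x l₁ l₂ e
    have e' : l₁ = SemiringFO.units l₁.length := List.eq_replicate_length.2 fun _ _ => rfl
    rw [e', foldl_units]
    have := congrArg List.length e
    simp [SemiringFO.units] at this
    exact h x _ (by omega)

theorem PS.iterate_of_add {g : δ → β → β} {a : δ → β} {n : δ → ℕ}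
    (hg : PS ord (fun x : δ × β => g x.1 x.2)) (ha : PS ord a) (hn : PS ord n)
    {C : δ → ℕ} (hC : PB K C) (h : ∀ x b, sz K (g x b) ≤ sz K b + C x) :
    PS ord (fun x => (g x)^[n x] (a x)) := by
  have := PS.foldl_of_add (g := fun x b (_ : Unit) => g x b) (a := a)
    (l := fun x => SemiringFO.units (n x))
    (hg.comp (f := fun y : (δ × β) × Unit => (y.1.1, y.1.2)) (by fun_prop)) ha (by fun_prop) hC
    fun x b _ _ => h x b
  simpa only [foldl_units] using this

/-! #### Arithmetic in unary -/

@[fun_prop]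
theorem PS.natAdd {f g : α → ℕ} (hf : PS ord f) (hg : PS ord g) : PS ord (fun x => f x + g x) := by
  have := PS.iterate_of_add (g := fun _ b => b + 1) (by fun_prop) hf hg (PB.const 9)
    (fun x b => by rw [sz_nat, sz_nat]; omega)
  refine this.recode (fun x => x) (fun _ => rfl) fun x => ?_
  congr 1
  induction g x with
  | zero => rfl
  | succ n ih => rw [Function.iterate_succ_apply', ← ih, Nat.add_assoc]

@[fun_prop]
theorem PS.natSub {f g : α → ℕ} (hf : PS ord f) (hg : PS ord g) : PS ord (fun x => f x - g x) := by
  have := PS.iterate_of_add (g := fun _ b => b - 1) (by fun_prop) hf hg (PB.const 0)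
    (fun x b => by rw [sz_nat, sz_nat]; omega)
  refine this.recode (fun x => x) (fun _ => rfl) fun x => ?_
  congr 1
  induction g x with
  | zero => rfl
  | succ n ih => rw [Function.iterate_succ_apply', ← ih, Nat.sub_sub]

@[fun_prop]
theorem PS.natMul {f g : α → ℕ} (hf : PS ord f) (hg : PS ord g) : PS ord (fun x => f x * g x) := by
  have := PS.iterate_of_add (g := fun x b => b + f x) (a := fun _ => 0) (by fun_prop) (by fun_prop)
    hg ((PB.of_ps hf).mul (PB.const 9)) (fun x b => by rw [sz_nat, sz_nat]; omega)
  refine this.recode (fun x => x) (fun _ => rfl) fun x => ?_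
  congr 1
  induction g x with
  | zero => rfl
  | succ n ih => rw [Function.iterate_succ_apply', ← ih, Nat.mul_succ]

@[fun_prop]
theorem PS.natMin {f g : α → ℕ} (hf : PS ord f) (hg : PS ord g) :
    PS ord (fun x => min (f x) (g x)) := by
  have : (fun x => min (f x) (g x)) = fun x => f x - (f x - g x) := by
    funext x; omega
  rw [this]; fun_prop

@[fun_prop]
theorem PS.natLt {f g : α → ℕ} (hf : PS ord f) (hg : PS ord g) :
    PS ord (fun x => decide (f x < g x)) := by
  have : PS ord (fun x => (SemiringFO.uncons (SemiringFO.units (g x - f x))).elim false fun _ => true) := by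
    fun_prop
  convert this using 2 with x
  rcases h : g x - f x with _ | n
  · simp [SemiringFO.units, SemiringFO.uncons]; omega
  · simp [SemiringFO.units, SemiringFO.uncons, List.replicate_succ]; omega

@[fun_prop]
theorem PS.natEq {f g : α → ℕ} (hf : PS ord f) (hg : PS ord g) :
    PS ord (fun x => decide (f x = g x)) := by
  have : PS ord (fun x => !decide (f x < g x) && !decide (g x < f x)) := by
    fun_prop
  convert this using 2 with x
  rw [← decide_not, ← decide_not, ← Bool.decide_and, decide_eq_decide]
  omega

/-! #### Lists -/

@[fun_prop]
theorem PS.reverse {l : α → List β} (hl : PS ord l) : PS ord (fun x => (l x).reverse) := by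
  have := PS.foldl_of_add (g := fun _ acc c => c :: acc) (a := fun _ => []) (by fun_prop)
    (by fun_prop) hl (PB.sz hl)
    (fun x b c hc => by rw [sz_cons]; have := sz_le_of_mem (K := K) hc; omega)
  refine this.recode (fun x => x) (fun _ => rfl) fun x => ?_
  simp

@[fun_prop]
theorem PS.map {f : α → β → γ} {l : α → List β} (hf : PS ord (fun x : α × β => f x.1 x.2))
    (hl : PS ord l) : PS ord (fun x => (l x).map (f x)) := by
  obtain ⟨p, hp⟩ := hf.sz_le
  have := PS.foldl_of_add (g := fun x acc c => f x c :: acc) (a := fun _ => [])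
    (.listCons (hf.comp (f := fun y : (α × List γ) × β => (y.1.1, y.2)) (by fun_prop)) (by fun_prop))
    (by fun_prop) hl.reverse
    (((PB.sz (PS.id (ord := ord))).add (PB.sz hl)).eval p |>.add (PB.const 7)) fun x b c hc => by
      rw [sz_cons]
      have h1 := sz_le_of_mem (K := K) (List.mem_reverse.1 hc)
      have h2 := hp (x, c)
      have h3 : p.eval (sz K (x, c)) ≤ p.eval (sz K x + sz K (l x)) :=
        eval_mono p (by rw [sz_prod]; dsimp only; omega)
      dsimp only at h2
      omega
  refine this.recode (fun x => x) (fun _ => rfl) fun x => ?_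
  congr 1
  induction l x with
  | nil => rfl
  | cons c l ih =>
    rw [List.map_cons, ih, List.reverse_cons, List.foldl_append, List.foldl_cons, List.foldl_nil]

@[fun_prop]
theorem PS.tail {l : α → List β} (hl : PS ord l) : PS ord (fun x => (l x).tail) := by
  have : PS ord (fun x => (SemiringFO.uncons (l x)).elim [] fun y => y.2) := by fun_prop
  refine this.recode (fun x => x) (fun _ => rfl) fun x => ?_
  rcases l x with _ | _ <;> rfl

@[fun_prop]
theorem PS.head? {l : α → List β} (hl : PS ord l) : PS ord (fun x => (l x).head?) := by
  have : PS ord (fun x => (SemiringFO.uncons (l x)).elim none fun y => Option.some y.1) := by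
    fun_prop
  refine this.recode (fun x => x) (fun _ => rfl) fun x => ?_
  rcases l x with _ | _ <;> rfl

@[fun_prop]
theorem PS.drop {l : α → List β} {n : α → ℕ} (hl : PS ord l) (hn : PS ord n) :
    PS ord (fun x => (l x).drop (n x)) := by
  have := PS.iterate_of_add (g := fun _ (b : List β) => b.tail) (by fun_prop) hl hn (PB.const 0)
    fun x b => by
      rcases b with _ | ⟨b, l⟩
      · simp
      · simp [sz_cons]; omega
  refine this.recode (fun x => x) (fun _ => rfl) fun x => ?_
  congr 1
  generalize l x = l
  induction n x generalizing l with
  | zero => rfl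
  | succ n ih => rw [Function.iterate_succ_apply, ← ih, List.drop_tail]

@[fun_prop]
theorem PS.length {l : α → List β} (hl : PS ord l) : PS ord (fun x => (l x).length) := by
  have : PS ord (fun x => ((l x).map fun _ => ()).length) := by fun_prop
  refine this.recode (fun x => x) (fun _ => rfl) fun x => ?_
  simp

@[fun_prop]
theorem PS.take {l : α → List β} {n : α → ℕ} (hl : PS ord l) (hn : PS ord n) :
    PS ord (fun x => (l x).take (n x)) := by
  have : PS ord (fun x => ((l x).reverse.drop ((l x).length - n x)).reverse) := by fun_prop
  refine this.recode (fun x => x) (fun _ => rfl) fun x => ?_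
  rw [List.drop_reverse, List.reverse_reverse]
  rcases le_total (n x) (l x).length with h | h
  · rw [Nat.sub_sub_self h]
  · rw [List.take_of_length_le h, Nat.sub_eq_zero_of_le h, Nat.sub_zero, List.take_length]

@[fun_prop]
theorem PS.getElem? {l : α → List β} {n : α → ℕ} (hl : PS ord l) (hn : PS ord n) :
    PS ord (fun x => (l x)[n x]?) := by
  have : PS ord (fun x => ((l x).drop (n x)).head?) := by fun_prop
  refine this.recode (fun x => x) (fun _ => rfl) fun x => ?_
  simp

-- The number to be added is always the length of the list so far, which yields the numbers in
-- descending order.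
@[fun_prop]
theorem PS.range {n : α → ℕ} (hn : PS ord n) : PS ord (fun x => List.range (n x)) := by
  have := PS.iterate_of_le (g := fun _ (b : List ℕ) => b.length :: b) (a := fun _ : α => [])
    (by fun_prop) (by fun_prop) hn (((PB.of_ps hn).mul (((PB.of_ps hn).mul (PB.const 9)).add
      (PB.const 12))).add (PB.const 5)) (W := fun x => n x * (n x * 9 + 12) + 5) ?_
  · refine this.reverse.recode (fun x => x) (fun _ => rfl) fun x => ?_
    congr 1
    induction n x with
    | zero => rfl
    | succ n ih =>
      rw [Function.iterate_succ_apply', List.reverse_cons, ← ih, List.range_succ,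
        ← List.length_reverse, ← ih]
      simp
  · intro x k hk
    have key : ∀ k, ((fun b : List ℕ => b.length :: b)^[k] []).length = k ∧
        ∀ i ∈ ((fun b : List ℕ => b.length :: b)^[k] []), i < k := by
      intro k
      induction k with
      | zero => simp
      | succ k ih =>
        rw [Function.iterate_succ_apply']
        refine ⟨by simp [ih.1], fun i hi => ?_⟩
        rcases List.mem_cons.1 hi with rfl | hi
        · omega
        · have := ih.2 i hi; omega
    have h1 := sz_le_of_forall (K := K) (l := ((fun b : List ℕ => b.length :: b)^[k] []))
      (C := 9 * n x + 5) fun i hi => by rw [sz_nat]; have := (key k).2 i hi; omega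
    rw [(key k).1] at h1
    have h2 := Nat.mul_le_mul_right (9 * n x + 5 + 7) hk
    have h3 : n x * (9 * n x + 5 + 7) = n x * (n x * 9 + 12) := by ring
    omega

@[fun_prop]
theorem PS.bind {f : α → Option β} {g : α → β → Option γ} (hf : PS ord f)
    (hg : PS ord (fun x : α × β => g x.1 x.2)) : PS ord (fun x => (f x).bind (g x)) := by
  have : PS ord (fun x => (f x).elim none (g x)) := by fun_prop
  refine this.recode (fun x => x) (fun _ => rfl) fun x => ?_
  rcases f x with _ | _ <;> rfl

@[fun_prop]
theorem PS.optMap {f : α → Option β} {g : α → β → γ} (hf : PS ord f)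
    (hg : PS ord (fun x : α × β => g x.1 x.2)) : PS ord (fun x => (f x).map (g x)) := by
  have : PS ord (fun x => (f x).elim none fun y => Option.some (g x y)) := by fun_prop
  refine this.recode (fun x => x) (fun _ => rfl) fun x => ?_
  rcases f x with _ | _ <;> rfl

@[fun_prop]
theorem PS.all {f : α → β → Bool} {l : α → List β} (hf : PS ord (fun x : α × β => f x.1 x.2))
    (hl : PS ord l) : PS ord (fun x => (l x).all (f x)) := by
  have := PS.foldl_of_le (g := fun x b c => b && f x c) (a := fun _ => true) (l := l)
    (.and (by fun_prop) (hf.comp (f := fun y : (α × Bool) × β => (y.1.1, y.2)) (by fun_prop)))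
    (by fun_prop) hl (PB.const 8) fun x l₁ l₂ _ => sz_bool K _
  refine this.recode (fun x => x) (fun _ => rfl) fun x => ?_
  have key : ∀ (l : List β) (b : Bool), l.foldl (fun b c => b && f x c) b = (b && l.all (f x)) := by
    intro l
    induction l with
    | nil => simp
    | cons c l ih => intro b; simp [ih, Bool.and_assoc]
  rw [key, Bool.true_and]

end Lists

/-! ### Recursion -/

section Recursion

variable {K : Type*} [CommSemiring K] [Nontrivial K] {ord : Option (SemiringOrder K)}

variable {α β γ δ : Type*} [Enc K α] [Enc K β] [Enc K γ] [Enc K δ]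

/-- Evaluation of a recursive procedure: `.inl b` returns the value `b`, and `.inr (a, g)` calls the
procedure `start` on `a` and then resumes with its value and the frame `g`. The data have size at
most `W`, and the depth of the recursion is at most `d`. -/
inductive Ev (K : Type*) [CommSemiring K] {α β γ : Type*} [Enc K α] [Enc K β] [Enc K γ]
    (start : α → β ⊕ (α × γ)) (resume : γ → β → β ⊕ (α × γ)) (W : ℕ) :
    ℕ → β ⊕ (α × γ) → β → Prop where
  | ret {d b} (h : sz K b ≤ W) : Ev K start resume W d (.inl b) b
  | call {d a g b' b} (ha : sz K a ≤ W) (hg : sz K g ≤ W)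
      (h₁ : Ev K start resume W d (start a) b')
      (h₂ : Ev K start resume W (d + 1) (resume g b') b) :
      Ev K start resume W (d + 1) (.inr (a, g)) b

theorem Ev.sz_le {start : α → β ⊕ (α × γ)} {resume : γ → β → β ⊕ (α × γ)} {W d : ℕ}
    {r : β ⊕ (α × γ)} {b : β} (h : Ev K start resume W d r b) : sz K b ≤ W := by
  induction h with
  | ret h => exact h
  | call _ _ _ _ _ ih => exact ih

theorem Ev.mono {start : α → β ⊕ (α × γ)} {resume : γ → β → β ⊕ (α × γ)} {W W' d : ℕ}
    {r : β ⊕ (α × γ)} {b : β} (h : Ev K start resume W d r b) (hW : W ≤ W') :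
    Ev K start resume W' d r b := by
  induction h with
  | ret h => exact .ret (h.trans hW)
  | call ha hg _ _ ih₁ ih₂ => exact .call (ha.trans hW) (hg.trans hW) ih₁ ih₂

/-- The state of the evaluation after a return or a call. -/
def evPush {α β γ : Type*} (r : β ⊕ (α × γ)) (st : List γ) : (α ⊕ β) × List γ :=
  Sum.elim (fun b => (.inr b, st)) (fun x => (.inl x.1, x.2 :: st)) r

/-- One step of the evaluation of a recursive procedure with a stack of frames. -/
def evStep {α β γ : Type*} (start : α → β ⊕ (α × γ)) (resume : γ → β → β ⊕ (α × γ))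
    (s : (α ⊕ β) × List γ) : β ⊕ ((α ⊕ β) × List γ) :=
  Sum.elim (fun a => .inr (evPush (start a) s.2))
    (fun b => (uncons s.2).elim (.inl b) fun y => .inr (evPush (resume y.1 b) y.2)) s.1

/-- Recursion is simulated with an explicit stack of frames. Each level of depth may add one frame,
of size at most `W + 7` with its list cell, which is what `hT` reserves. The continuation `hc` is
needed because a call returns into the middle of an evaluation. -/
theorem Ev.chain {start : α → β ⊕ (α × γ)} {resume : γ → β → β ⊕ (α × γ)} {W d : ℕ}
    {r : β ⊕ (α × γ)} {b : β} (h : Ev K start resume W d r b) {st : List γ} {T : ℕ} {f : β}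
    (hT : sz K st + d * (W + 7) ≤ T)
    (hc : Chain K (evStep start resume) (W + T + 7) (.inr b, st) f) :
    Chain K (evStep start resume) (W + T + 7) (evPush r st) f := by
  induction h generalizing st with
  | ret h => exact hc
  | @call d a g b' b ha hg h₁ _ ih₁ ih₂ =>
    rw [Nat.succ_mul] at hT
    have h1 := h₁.sz_le
    refine .next (a' := evPush (start a) (g :: st)) ?_ rfl (ih₁ ?_ (.next ?_ rfl
      (ih₂ (by rw [Nat.succ_mul]; omega) hc)))
    · simp only [evPush, Sum.elim_inr, sz_prod, sz_inl, sz_cons]; omega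
    · rw [sz_cons]; omega
    · simp only [sz_prod, sz_inr, sz_cons]; omega

/-- The space is about depth times frame size, independently of the number of calls. -/
theorem PS.recursion {start : α → β ⊕ (α × γ)} {resume : γ → β → β ⊕ (α × γ)} {init : δ → α}
    {f : δ → β} (hs : PS ord start) (hr : PS ord (fun x : γ × β => resume x.1 x.2))
    (hi : PS ord init) {W D : δ → ℕ} (hW : PB K W) (hD : PB K D)
    (h : ∀ x, sz K (init x) ≤ W x ∧ Ev K start resume (W x) (D x) (start (init x)) (f x)) :
    PS ord f := by
  have hpush : PS ord (fun x : (β ⊕ (α × γ)) × List γ => evPush x.1 x.2) := by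
    unfold evPush
    fun_prop
  refine PS.loop (step := evStep start resume) (init := fun x => (.inl (init x), [])) ?_
    (by fun_prop) (W := fun x => W x + (5 + D x * (W x + 7)) + 7) ((hW.add ((PB.const 5).add (hD.mul
    (hW.add (PB.const 7))))).add (PB.const 7)) fun x => ?_
  · unfold evStep
    refine .sumElim (by fun_prop) (.inr (hpush.comp (.prodMk (hs.comp (by fun_prop)) (by fun_prop))))
      (.optElim (by fun_prop) (by fun_prop) (.inr (hpush.comp (.prodMk
      (hr.comp (f := fun y : (((α ⊕ β) × List γ) × β) × (γ × List γ) => (y.2.1, y.1.2))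
        (by fun_prop)) (by fun_prop)))))
  · obtain ⟨h1, h2⟩ := h x
    have h3 := h2.sz_le
    refine .next ?_ rfl (h2.chain (by rw [sz_nil]) (.done ?_ rfl))
    · simp only [sz_prod, sz_inl, sz_nil]; omega
    · simp only [sz_prod, sz_inr, sz_nil]; omega

/-! ### Binary numbers -/

/-- Natural numbers, to be represented in binary. -/
structure Num where
  val : ℕ

instance (K : Type*) : Enc K Num := ⟨fun n => Enc.enc (Nat.bits n.val)⟩

@[fun_prop]
theorem PS.bits {f : α → Num} (hf : PS ord f) : PS ord (fun x => Nat.bits (f x).val) :=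
  hf.recode (fun x => x) (fun _ => rfl) fun _ => rfl

/-- The truth value as a digit. -/
def digit (b : Bool) : ℕ := bif b then 1 else 0

/-- Comparison of binary numbers, digit by digit. -/
theorem foldl_testBit (x y n : ℕ) : (List.range n).foldl
    (fun acc i => bif x.testBit i ^^ y.testBit i then y.testBit i else acc) false =
      decide (x % 2 ^ n < y % 2 ^ n) := by
  induction n with
  | zero => simp [Nat.mod_one]
  | succ n ih =>
    rw [List.range_succ, List.foldl_append, ih, Nat.mod_pow_succ, ← Nat.toNat_testBit, Nat.mod_pow_succ,
      ← Nat.toNat_testBit]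
    have h1 := Nat.mod_lt x (Nat.two_pow_pos n)
    have h2 := Nat.mod_lt y (Nat.two_pow_pos n)
    cases hx : x.testBit n <;> cases hy : y.testBit n <;> simp [hx, hy] <;> omega

theorem PS.numLt {f g : α → Num} (hf : PS ord f) (hg : PS ord g) :
    PS ord (fun x => decide ((f x).val < (g x).val)) := by
  have := PS.foldl_of_le (δ := α) (g := fun x (acc : Bool) i =>
      bif ((Nat.bits (f x).val)[i]?.elim false fun b => b) ^^
        ((Nat.bits (g x).val)[i]?.elim false fun b => b)
      then ((Nat.bits (g x).val)[i]?.elim false fun b => b) else acc) (a := fun _ => false)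
    (l := fun x => List.range ((Nat.bits (f x).val).length + (Nat.bits (g x).val).length))
    (by fun_prop) (by fun_prop) (by fun_prop) (PB.const 8) fun x l₁ l₂ _ => sz_bool K _
  refine this.recode (fun x => x) (fun _ => rfl) fun x => ?_
  have e : ∀ n i, ((Nat.bits n)[i]?.elim false fun b => b) = n.testBit i := by
    intro n i
    rw [Nat.testBit_eq_inth, List.getI_eq_getElem?_getD]
    rcases (Nat.bits n)[i]? with _ | _ <;> rfl
  simp only [e]
  have h1 := Nat.size_eq_bits_len (f x).val
  have h2 := Nat.size_eq_bits_len (g x).val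
  rw [foldl_testBit, Nat.mod_eq_of_lt, Nat.mod_eq_of_lt] <;> rw [← Nat.size_le] <;> omega

@[fun_prop]
theorem PS.numEq {f g : α → Num} (hf : PS ord f) (hg : PS ord g) :
    PS ord (fun x => decide (f x = g x)) := by
  have h1 := (hf.numLt hg).not.and (hg.numLt hf).not
  refine h1.recode (fun x => x) (fun _ => rfl) fun x => ?_
  rcases hx : f x with ⟨a⟩
  rcases hy : g x with ⟨b⟩
  rw [← decide_not, ← decide_not, ← Bool.decide_and]
  congr 1
  rw [decide_eq_decide, Num.mk.injEq]
  dsimp only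
  omega

/-- Horner's scheme from the most significant digit, cut off at every step. A prefix above the bound
stays above it, so cutting early does not change the result, while the unary intermediate values
stay small. -/
theorem PS.numCap {f : α → ℕ} {g : α → Num} (hf : PS ord f) (hg : PS ord g) :
    PS ord (fun x => min (f x) (g x).val) := by
  have hdig : PS ord (fun y : (α × ℕ) × Bool => digit y.2) := by unfold digit; fun_prop
  have := PS.foldl_of_le (δ := α) (g := fun x (n : ℕ) b => min (f x) (n + n + digit b))
    (a := fun x => 0) (l := fun x => (Nat.bits (g x).val).reverse) (.natMin (by fun_prop)
      (.natAdd (by fun_prop) hdig)) (by fun_prop) (by fun_prop)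
    (((PB.of_ps hf).mul (PB.const 9)).add (PB.const 5)) fun x l₁ l₂ _ => ?_
  · refine this.recode (fun x => x) (fun _ => rfl) fun x => ?_
    congr 1
    generalize f x = N
    generalize (g x).val = n
    induction n using Nat.binaryRec' with
    | zero => simp
    | bit b n h ih =>
      rw [Nat.bits_append_bit _ _ h, List.reverse_cons, List.foldl_append, ← ih]
      cases b <;> simp [digit, Nat.bit] <;> omega
  · rw [sz_nat]
    have : l₁.foldl (fun (n : ℕ) b => min (f x) (n + n + digit b)) 0 ≤ f x := by
      rcases List.eq_nil_or_concat l₁ with rfl | ⟨l, b, rfl⟩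
      · simp
      · simp
    omega

end Recursion

/-! ### Readers -/

section Readers

variable {K : Type*} [CommSemiring K] [Nontrivial K] {ord : Option (SemiringOrder K)}

variable {α β γ δ : Type*} [Enc K α] [Enc K β] [Enc K γ] [Enc K δ]

/-- The code of a natural number as a word over `K`. -/
def numCode (K : Type*) [CommSemiring K] (n : ℕ) : List K := (natCode n).map (bit K)

theorem numCode_eq (n : ℕ) :
    numCode K n = (Nat.bits n).flatMap (fun b => [1, bit K b]) ++ [0] := by
  simp [numCode, natCode, List.map_flatMap, bit]

/-- Reads digits, least significant first, and stores them in reverse order. -/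
def readBits : List Bool → List K → Option (List Bool × List K)
  | _, [] => none
  | acc, [k] => bif keq k 0 then some (acc, []) else none
  | acc, k :: b :: w => bif keq k 0 then some (acc, b :: w) else bif keq k 1 then
      (bif keq b 0 then readBits (false :: acc) w else
        bif keq b 1 then readBits (true :: acc) w else none) else none

theorem readBits_code (bs acc : List Bool) (r : List K) :
    readBits acc (bs.flatMap (fun b => [1, bit K b]) ++ [0] ++ r) = some (bs.reverse ++ acc, r) := by
  induction bs generalizing acc with
  | nil => rcases r with _ | ⟨k, r⟩ <;> simp [readBits, keq]
  | cons b bs ih =>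
    have := ih (b :: acc)
    cases b <;> simpa [readBits, keq, bit] using this

theorem readBits_eq_some : ∀ {w : List K} {acc l : List Bool} {r : List K},
    readBits acc w = some (l, r) →
    ∃ bs : List Bool, l = bs.reverse ++ acc ∧
      w = bs.flatMap (fun b => [1, bit K b]) ++ [0] ++ r
  | [], acc, l, r, h => by simp [readBits] at h
  | [k], acc, l, r, h => by
    by_cases hk : k = 0
    · simp [readBits, keq, hk] at h
      exact ⟨[], by simp [h], by simp [h, hk]⟩
    · simp [readBits, keq, hk] at h
  | k :: b :: w, acc, l, r, h => by
    by_cases hk : k = 0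
    · simp [readBits, keq, hk] at h
      exact ⟨[], by simp [h], by simp [h, hk]⟩
    by_cases hk1 : k = 1
    · by_cases hb : b = 0
      · simp [readBits, keq, hk1, hb] at h
        obtain ⟨bs, h1, h2⟩ := readBits_eq_some h
        exact ⟨false :: bs, by simp [h1], by simp [hk1, hb, h2, bit]⟩
      by_cases hb1 : b = 1
      · simp [readBits, keq, hk1, hb1] at h
        obtain ⟨bs, h1, h2⟩ := readBits_eq_some h
        exact ⟨true :: bs, by simp [h1], by simp [hk1, hb1, h2, bit]⟩
      · simp [readBits, keq, hk1, hb, hb1] at h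
    · simp [readBits, keq, hk, hk1] at h

/-- The number with given digits, least significant first. -/
def ofBits (l : List Bool) : ℕ := l.foldr Nat.bit 0

theorem ofBits_bits (n : ℕ) : ofBits (Nat.bits n) = n := by
  induction n using Nat.binaryRec' with
  | zero => simp [ofBits]
  | bit b n h ih =>
    rw [Nat.bits_append_bit _ _ h]
    simp only [ofBits, List.foldr_cons] at ih ⊢
    rw [ih]

theorem ofBits_ne_zero {l : List Bool} (h : l.getLast? = some true) : ofBits l ≠ 0 := by
  induction l with
  | nil => simp at h
  | cons b l ih =>
    rcases l with _ | ⟨c, l⟩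
    · simp at h
      simp [ofBits, h, Nat.bit]
    · have := ih (by simpa [List.getLast?_cons_cons] using h)
      simp only [ofBits, List.foldr_cons] at this ⊢
      cases b <;> simp only [Nat.bit_false, Nat.bit_true] <;> omega

/-- The digit lists of numbers are those without leading zeros, that is, without a zero at their
end. `readNum` rejects the others, so it accepts nothing but genuine codes. -/
theorem bits_ofBits {l : List Bool} (h : l.getLast?.elim true (fun b => b) = true) :
    Nat.bits (ofBits l) = l := by
  induction l with
  | nil => simp [ofBits]
  | cons b l ih =>
    have h1 : ofBits (b :: l) = Nat.bit b (ofBits l) := rfl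
    rcases l with _ | ⟨c, l⟩
    · simp at h
      simp [ofBits, h]
    · have h2 : (c :: l).getLast?.elim true (fun b => b) = true := by
        simpa [List.getLast?_cons_cons] using h
      rw [h1, Nat.bits_append_bit, ih h2]
      intro h0
      refine absurd h0 (ofBits_ne_zero ?_)
      rcases hx : (c :: l).getLast? with _ | x
      · simp at hx
      · rw [hx] at h2; simpa using h2

theorem getLast?_bits (n : ℕ) : (Nat.bits n).getLast?.elim true (fun b => b) = true := by
  induction n using Nat.binaryRec' with
  | zero => simp
  | bit b n h ih =>
    rw [Nat.bits_append_bit _ _ h]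
    rcases hn : Nat.bits n with _ | ⟨c, l⟩
    · have : n = 0 := by rw [← ofBits_bits n, hn]; rfl
      simp [h this]
    · rw [List.getLast?_cons_cons, ← hn, ih]

/-- Reads a number. -/
def readNum (w : List K) : Option (Num × List K) :=
  (readBits [] w).bind fun x =>
    bif x.1.head?.elim true (fun b => b) then some (⟨ofBits x.1.reverse⟩, x.2) else none

/-- The reader recognizes exactly the words that begin with a code. -/
def Parses {α : Type*} (rd : List K → Option (α × List K)) (code : α → List K) : Prop :=
  ∀ w t r, rd w = some (t, r) ↔ w = code t ++ r

theorem parses_readNum : Parses (readNum (K := K)) (fun n => numCode K n.val) := by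
  intro w t r
  constructor
  · intro h
    unfold readNum at h
    rcases hb : readBits [] w with _ | ⟨l, r'⟩
    · simp [hb] at h
    rw [hb, Option.bind_some] at h
    obtain ⟨bs, rfl, rfl⟩ := readBits_eq_some hb
    simp only [List.append_nil, List.head?_reverse, List.reverse_reverse] at h
    cases hc : bs.getLast?.elim true (fun b => b)
    · simp [hc] at h
    · simp only [hc, cond_true, Option.some.injEq, Prod.mk.injEq] at h
      dsimp only
      rw [← h.1, ← h.2, numCode_eq, bits_ofBits hc]
  · rintro rfl
    dsimp only
    unfold readNum
    rw [numCode_eq, readBits_code, Option.bind_some, List.append_nil]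
    simp only [List.head?_reverse, List.reverse_reverse, getLast?_bits, cond_true, ofBits_bits]

theorem sz_word (w : List K) : sz K w = 10 * w.length + 5 := by
  induction w with
  | nil => rfl
  | cons a w ih => rw [sz_cons, sz_self, ih, List.length_cons]; ring

theorem length_numCode (n : ℕ) : (numCode K n).length = 2 * (Nat.bits n).length + 1 := by
  rw [numCode_eq]
  simp [List.length_flatMap]
  ring

theorem sz_num_le (n : Num) : sz K n ≤ 15 * (Nat.bits n.val).length + 5 := by
  have : sz K n = sz K (Nat.bits n.val) := rfl
  rw [this]
  have := sz_le_of_forall (K := K) (l := Nat.bits n.val) (C := 8) fun b _ => sz_bool K b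
  omega

/-- A digit takes two letters, of size 10 each, in the word but at most 15 in the number. Hence
reading does not increase the total size. -/
theorem readNum_sz {w r : List K} {t : Num} (h : readNum w = some (t, r)) :
    sz K t + sz K r ≤ sz K w ∧ r.length < w.length := by
  have h := (parses_readNum _ _ _).1 h
  dsimp only at h
  have h1 := sz_num_le (K := K) t
  have h2 := length_numCode (K := K) t.val
  rw [h, sz_word, sz_word, List.length_append]
  omega

/-- One step of reading digits. -/
def readBitsStep (s : List Bool × List K) :
    Option (List Bool × List K) ⊕ (List Bool × List K) :=
  (uncons s.2).elim (.inl none) fun y =>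
    bif keq y.1 0 then .inl (some (s.1, y.2)) else bif keq y.1 1 then
      (uncons y.2).elim (.inl none) (fun z => bif keq z.1 0 then .inr (false :: s.1, z.2) else
        bif keq z.1 1 then .inr (true :: s.1, z.2) else .inl none) else .inl none

theorem chain_readBits : ∀ (w : List K) (acc : List Bool) (N : ℕ), sz K acc + sz K w + 1 ≤ N →
    Chain K readBitsStep N (acc, w) (readBits acc w)
  | [], acc, N, hN => .done (by rw [sz_prod]; exact hN) rfl
  | [k], acc, N, hN => by
    refine .done (by rw [sz_prod]; exact hN) ?_
    by_cases hk : k = 0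
    · simp [uncons, keq, hk, readBits, readBitsStep]
    · simp [uncons, keq, hk, readBits, readBitsStep]
  | k :: b :: w, acc, N, hN => by
    have hsz : sz K (acc, k :: b :: w) ≤ N := by rw [sz_prod]; exact hN
    simp only [sz_cons, sz_self] at hN
    by_cases hk : k = 0
    · refine .done hsz ?_
      simp [uncons, keq, hk, readBits, readBitsStep]
    by_cases hk1 : k = 1
    · by_cases hb : b = 0
      · refine .next hsz (a' := (false :: acc, w)) ?_ ?_
        · simp [uncons, keq, hk1, hb, readBitsStep]
        · have := chain_readBits w (false :: acc) N
            (by rw [sz_cons]; have := sz_bool K false; omega)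
          simpa [keq, hk1, hb, readBits] using this
      by_cases hb1 : b = 1
      · refine .next hsz (a' := (true :: acc, w)) ?_ ?_
        · simp [uncons, keq, hk1, hb1, readBitsStep]
        · have := chain_readBits w (true :: acc) N
            (by rw [sz_cons]; have := sz_bool K true; omega)
          simpa [keq, hk1, hb1, readBits] using this
      · refine .done hsz ?_
        simp [uncons, keq, hk1, hb, hb1, readBits, readBitsStep]
    · refine .done hsz ?_
      simp [uncons, keq, hk, hk1, readBits, readBitsStep]

theorem ps_readBits : PS ord (fun w : List K => readBits [] w) :=
  PS.loop (step := readBitsStep) (init := fun w => ([], w)) (by unfold readBitsStep; fun_prop)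
    (by fun_prop) (W := fun w => sz K w + 6) ((PB.sz (PS.id (ord := ord))).add (PB.const 6))
    fun w => chain_readBits w [] _ (by rw [sz_nil]; omega)

@[fun_prop]
theorem ps_readNum {w : α → List K} (hw : PS ord w) : PS ord (fun x => readNum (w x)) := by
  refine PS.comp (g := readNum) (f := w) ?_ hw
  -- The program returns the digits themselves. As they are canonical, they already are the
  -- representation of the number, and no arithmetic is needed.
  have h : PS ord (fun w : List K => (readBits [] w).bind fun x =>
      bif x.1.head?.elim true (fun b => b) then some (x.1.reverse, x.2) else none) :=
    PS.bind ps_readBits (by fun_prop)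
  refine h.recode (fun x => x) (fun _ => rfl) fun w => ?_
  unfold readNum
  rcases readBits [] w with _ | ⟨l, r⟩
  · rfl
  · simp only [Option.bind_some]
    cases hc : l.head?.elim true (fun b => b)
    · rfl
    · show (Enc.enc (some ((⟨ofBits l.reverse⟩ : Num), r)) : KTree K) =
        Enc.enc (some (l.reverse, r))
      have : (Enc.enc (⟨ofBits l.reverse⟩ : Num) : KTree K) = Enc.enc l.reverse := by
        show (Enc.enc (Nat.bits (ofBits l.reverse)) : KTree K) = Enc.enc l.reverse
        rw [bits_ofBits (by rw [List.getLast?_reverse]; exact hc)]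
      simp only [Enc.enc, optSum, Sum.elim_inr] at this ⊢
      rw [this]

/-! #### Repeated reading -/

/-- Reads an item for each element of a list. -/
def readEach {β γ : Type*} (rd : β → List K → Option (γ × List K)) :
    List β → List K → Option (List γ × List K)
  | [], w => some ([], w)
  | b :: l, w => (rd b w).bind fun x => (readEach rd l x.2).map fun y => (x.1 :: y.1, y.2)

/-- Reads a given number of items. -/
def readMany {γ : Type*} (rd : List K → Option (γ × List K)) (n : ℕ) (w : List K) :
    Option (List γ × List K) := readEach (fun _ => rd) (units n) w

theorem readMany_succ {γ : Type*} (rd : List K → Option (γ × List K)) (n : ℕ) (w : List K) :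
    readMany rd (n + 1) w =
      (rd w).bind fun x => (readMany rd n x.2).map fun y => (x.1 :: y.1, y.2) := rfl

theorem readMany_eq_some {γ : Type*} {rd : List K → Option (γ × List K)} {code : γ → List K}
    (h : Parses rd code) {n : ℕ} {w : List K} {l : List γ} {r : List K} :
    readMany rd n w = some (l, r) ↔ l.length = n ∧ w = l.flatMap code ++ r := by
  induction n generalizing w l with
  | zero =>
    constructor
    · intro h
      simp [readMany, readEach, units] at h
      simp [h]
    · rintro ⟨h1, rfl⟩
      rw [List.length_eq_zero_iff] at h1
      simp [readMany, readEach, units, h1]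
  | succ n ih =>
    rw [readMany_succ]
    constructor
    · intro h'
      simp only [Option.bind_eq_some_iff, Option.map_eq_some_iff, Prod.exists, Prod.mk.injEq] at h'
      obtain ⟨t, r', h1, l', r'', h2, rfl, rfl⟩ := h'
      rw [h] at h1
      rw [ih] at h2
      simp [h1, h2]
    · rintro ⟨h1, rfl⟩
      rcases l with _ | ⟨t, l⟩
      · simp at h1
      · rw [(h _ t (l.flatMap code ++ r)).2 (by simp), Option.bind_some,
          ih.2 ⟨by simpa using h1, rfl⟩]
        rfl

/-- A fold whose state consists of the items read, in reverse order, and the remaining word. By `h`,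
what an item gains the word loses, up to `C x`, so the state grows by bounded amounts. -/
theorem ps_readEach {rd : δ → β → List K → Option (γ × List K)} {l : δ → List β} {w : δ → List K}
    (hrd : PS ord (fun y : (δ × β) × List K => rd y.1.1 y.1.2 y.2)) (hl : PS ord l)
    (hw : PS ord w) {C : δ → ℕ} (hC : PB K C)
    (h : ∀ x b w t r, rd x b w = some (t, r) → sz K t + sz K r ≤ sz K w + C x) :
    PS ord (fun x => readEach (rd x) (l x) (w x)) := by
  have := PS.foldl_of_add (δ := δ)
    (g := fun x (st : Option (List γ × List K)) b => st.bind fun y =>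
      (rd x b y.2).map fun z => (z.1 :: y.1, z.2)) (a := fun x => some ([], w x)) (l := l) ?_
    (by fun_prop) hl (hC.add (PB.const 7)) ?_
  · refine PS.recode (g := fun x => ((l x).foldl (fun (st : Option (List γ × List K)) b =>
      st.bind fun y => (rd x b y.2).map fun z => (z.1 :: y.1, z.2)) (some ([], w x))).map
        fun y => (y.1.reverse, y.2)) (fun x => x) (.optMap this (by fun_prop)) (fun _ => rfl)
        fun x => ?_
    congr 1
    have hnone : ∀ l : List β, l.foldl (fun (st : Option (List γ × List K)) b => st.bind fun y =>
      (rd x b y.2).map fun z => (z.1 :: y.1, z.2)) none = none := by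
      intro l
      induction l with
      | nil => rfl
      | cons b l ih => exact ih
    have key : ∀ (l : List β) (acc : List γ) (w : List K),
        l.foldl (fun (st : Option (List γ × List K)) b => st.bind fun y =>
          (rd x b y.2).map fun z => (z.1 :: y.1, z.2)) (some (acc, w)) =
        (readEach (rd x) l w).map fun y => (y.1.reverse ++ acc, y.2) := by
      intro l
      induction l with
      | nil => intro acc w; simp [readEach]
      | cons b l ih =>
        intro acc w
        rw [List.foldl_cons, Option.bind_some, readEach]
        rcases rd x b w with _ | z
        · exact hnone l
        · rw [Option.map_some, ih, Option.bind_some, Option.map_map]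
          congr 1
          funext y
          simp
    rw [key]
    rcases readEach (rd x) (l x) (w x) with _ | ⟨a, b⟩ <;> simp
  · refine .bind (by fun_prop) (.optMap (hrd.comp
      (f := fun y : ((δ × Option (List γ × List K)) × β) × (List γ × List K) =>
        ((y.1.1.1, y.1.2), y.2.2)) (by fun_prop)) (by fun_prop))
  · rintro x (_ | ⟨acc, w⟩) b -
    · simp
    · rw [Option.bind_some]
      rcases hr : rd x b w with _ | ⟨t, r⟩
      · rw [Option.map_none, sz_none, sz_some, sz_prod]; omega
      · have := h x b w t r hr
        simp only [Option.map_some, sz_some, sz_prod, sz_cons]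
        omega

@[fun_prop]
theorem ps_readNums {n : α → ℕ} {w : α → List K} (hn : PS ord n) (hw : PS ord w) :
    PS ord (fun x => readMany readNum (n x) (w x)) :=
  ps_readEach (rd := fun _ (_ : Unit) => readNum) (by fun_prop) (by fun_prop) hw
    (PB.const 0) fun _ _ _ _ _ h => (readNum_sz h).1

/-- Reads a pair of numbers. -/
def readPair (w : List K) : Option ((Num × Num) × List K) :=
  (readNum w).bind fun x => (readNum x.2).map fun y => ((x.1, y.1), y.2)

theorem parses_readPair :
    Parses (readPair (K := K)) (fun p => numCode K p.1.val ++ numCode K p.2.val) := by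
  intro w t r
  unfold readPair
  constructor
  · intro h
    simp only [Option.bind_eq_some_iff, Option.map_eq_some_iff, Prod.exists, Prod.mk.injEq] at h
    obtain ⟨a, r', h1, b, r'', h2, rfl, rfl⟩ := h
    have h1 := (parses_readNum _ _ _).1 h1
    have h2 := (parses_readNum _ _ _).1 h2
    simp [h1, h2]
  · rintro rfl
    rw [(parses_readNum _ t.1 (numCode K t.2.val ++ r)).2 (by simp), Option.bind_some,
      (parses_readNum _ t.2 r).2 rfl]
    rfl

@[fun_prop]
theorem ps_readPairs {n : α → ℕ} {w : α → List K} (hn : PS ord n) (hw : PS ord w) :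
    PS ord (fun x => readMany readPair (n x) (w x)) := by
  refine ps_readEach (rd := fun _ (_ : Unit) => readPair) (by unfold readPair; fun_prop)
    (by fun_prop) hw (PB.const 1) fun _ _ w t r h => ?_
  simp only [readPair, Option.bind_eq_some_iff, Option.map_eq_some_iff, Prod.exists,
    Prod.mk.injEq] at h
  obtain ⟨a, r', h1, b, r'', h2, rfl, rfl⟩ := h
  have := readNum_sz h1
  have := readNum_sz h2
  rw [sz_prod]
  dsimp only
  omega

end Readers

/-! ### The evaluator -/

/-! ### Environments, ranks of tuples and tables of literal values -/

section Tables

variable {K : Type*} [CommSemiring K] [Nontrivial K] {ord : Option (SemiringOrder K)}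

variable {α β γ δ : Type*} [Enc K α] [Enc K β] [Enc K γ] [Enc K δ]

/-- The list of values if all of them are present. -/
def seqOpt {α : Type*} : List (Option α) → Option (List α)
  | [] => some []
  | o :: l => o.bind fun a => (seqOpt l).map fun m => a :: m

-- The definition is a right fold, which is a left fold over the reversed list. `look` and `indexIn`
-- are treated in the same way.
@[fun_prop]
theorem ps_seqOpt {f : α → List (Option β)} (hf : PS ord f) : PS ord (fun x => seqOpt (f x)) := by
  have := PS.foldl_of_add (g := fun (_ : α) (acc : Option (List β)) c => c.bind fun a =>
    acc.map fun m => a :: m) (a := fun _ => some []) (by fun_prop) (by fun_prop) hf.reverse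
    (PB.sz hf) fun x b c hc => by
      have h1 := sz_le_of_mem (K := K) (List.mem_reverse.1 hc)
      rcases c with _ | c
      · simp only [Option.bind_none, sz_none] at h1 ⊢; omega
      rcases b with _ | b
      · rw [Option.bind_some, Option.map_none]; omega
      · rw [Option.bind_some, Option.map_some, sz_some, sz_some, sz_cons]
        rw [sz_some] at h1
        omega
  refine this.recode (fun x => x) (fun _ => rfl) fun x => ?_
  congr 1
  induction f x with
  | nil => rfl
  | cons c l ih =>
    rw [seqOpt, ih, List.reverse_cons, List.foldl_append, List.foldl_cons, List.foldl_nil]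

/-- Variables with the indices of their values. -/
abbrev Env := List (Num × ℕ)

/-- The entry of a variable. -/
def look : Env → Num → Option ℕ
  | [], _ => none
  | p :: env, x => bif decide (p.1 = x) then some p.2 else look env x

@[fun_prop]
theorem ps_look {f : α → Env} {g : α → Num} (hf : PS ord f) (hg : PS ord g) :
    PS ord (fun x => look (f x) (g x)) := by
  have := PS.foldl_of_add (g := fun (x : α) (acc : Option ℕ) (p : Num × ℕ) =>
    bif decide (p.1 = g x) then some p.2 else acc) (a := fun _ => none) (by fun_prop)
    (by fun_prop) hf.reverse (PB.sz hf) fun x b c hc => by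
      have h1 := sz_le_of_mem (K := K) (List.mem_reverse.1 hc)
      rw [sz_prod] at h1
      have h2 := sz_some K c.2
      cases decide (c.1 = g x)
      · rw [cond_false]; omega
      · rw [cond_true]; omega
  refine this.recode (fun x => x) (fun _ => rfl) fun x => ?_
  congr 1
  induction f x with
  | nil => rfl
  | cons c l ih =>
    rw [look, ih, List.reverse_cons, List.foldl_append, List.foldl_cons, List.foldl_nil]

/-- The position of a number in a list. -/
def indexIn : List Num → Num → Option ℕ
  | [], _ => none
  | a :: l, x => bif decide (a = x) then some 0 else (indexIn l x).map fun i => i + 1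

@[fun_prop]
theorem ps_indexIn {f : α → List Num} {g : α → Num} (hf : PS ord f) (hg : PS ord g) :
    PS ord (fun x => indexIn (f x) (g x)) := by
  have := PS.foldl_of_add (g := fun (x : α) (acc : Option ℕ) (a : Num) =>
    bif decide (a = g x) then some 0 else acc.map fun i => i + 1) (a := fun _ => none) (by fun_prop)
    (by fun_prop) hf.reverse (PB.const 11) fun x b c hc => by
      cases decide (c = g x)
      · rw [cond_false]
        rcases b with _ | b
        · rw [Option.map_none]; omega
        · rw [Option.map_some, sz_some, sz_some, sz_nat, sz_nat]; omega
      · rw [cond_true, sz_some, sz_nat]; omega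
  refine this.recode (fun x => x) (fun _ => rfl) fun x => ?_
  congr 1
  induction f x with
  | nil => rfl
  | cons c l ih =>
    rw [indexIn, ih, List.reverse_cons, List.foldl_append, List.foldl_cons, List.foldl_nil]

/-- The rank of a tuple of digits to base `c`, cut off at `N`. -/
def rank (N c : ℕ) (l : List ℕ) : ℕ := l.foldl (fun r i => min N (r * c + i)) 0

@[fun_prop]
theorem ps_rank {N c : α → ℕ} {l : α → List ℕ} (hN : PS ord N) (hc : PS ord c) (hl : PS ord l) :
    PS ord (fun x => rank (N x) (c x) (l x)) := by
  refine PS.foldl_of_le (g := fun x r i => min (N x) (r * c x + i)) (by fun_prop) (by fun_prop)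
    hl (((PB.of_ps hN).mul (PB.const 9)).add (PB.const 5)) fun x l₁ l₂ _ => ?_
  rw [sz_nat]
  have : l₁.foldl (fun r i => min (N x) (r * c x + i)) 0 ≤ N x := by
    rcases List.eq_nil_or_concat l₁ with rfl | ⟨l, b, rfl⟩
    · simp
    · simp
  omega

/-- The power of `c`, cut off at `N`. -/
def cpow (N c k : ℕ) : ℕ := (fun y => min N (y * c))^[k] 1

@[fun_prop]
theorem ps_cpow {N c k : α → ℕ} (hN : PS ord N) (hc : PS ord c) (hk : PS ord k) :
    PS ord (fun x => cpow (N x) (c x) (k x)) := by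
  refine PS.iterate_of_le (g := fun x y => min (N x) (y * c x)) (by fun_prop) (by fun_prop)
    hk (((PB.of_ps hN).mul (PB.const 9)).add (PB.const 14)) fun x k _ => ?_
  rw [sz_nat]
  rcases k with _ | k
  · rw [Function.iterate_zero, id_eq]; omega
  · rw [Function.iterate_succ_apply']; omega

/-- Whether all entries of a list are equal. -/
def allSame (l : List K) : Bool := l.all fun v => l.head?.elim true fun u => keq u v

/-- Reads the values of the literals with a given sign and a symbol of arity `k`. -/
def readBlock (N c k : ℕ) (w : List K) : Option (List K × List K) :=
  -- The value for a symbol of arity `0` is present `c` times and not `c ^ 0` times, and the copies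
  -- must agree.
  bif decide (k = 0) then
    (bif decide (w.length < c) then none else bif allSame (w.take c) then
      some (w.take c, w.drop c) else none)
  -- The words that occur are shorter than `N`, so a power that reaches the cut-off makes reading
  -- fail, as it should.
  else bif decide (w.length < cpow N c k) then none else
    some (w.take (cpow N c k), w.drop (cpow N c k))

/-- Reads the values of the literals with a symbol of arity `k`. -/
def readEntry (N c k : ℕ) (w : List K) : Option ((List K × List K) × List K) :=
  (readBlock N c k w).bind fun x => (readBlock N c k x.2).map fun y => ((x.1, y.1), y.2)

theorem readBlock_eq {N c k : ℕ} {w p r : List K} (h : readBlock N c k w = some (p, r)) :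
    w = p ++ r := by
  unfold readBlock at h
  cases h1 : decide (k = 0)
  · rw [h1, cond_false] at h
    cases h2 : decide (w.length < cpow N c k)
    · rw [h2, cond_false, Option.some.injEq, Prod.mk.injEq] at h
      rw [← h.1, ← h.2, List.take_append_drop]
    · simp [h2] at h
  · rw [h1, cond_true] at h
    cases h2 : decide (w.length < c)
    · cases h3 : allSame (w.take c)
      · simp [h2, h3] at h
      · rw [h2, h3, cond_false, cond_true, Option.some.injEq, Prod.mk.injEq] at h
        rw [← h.1, ← h.2, List.take_append_drop]
    · simp [h2] at h

/-- Reads the values of all literals for symbols of the given arities. -/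
def readTable (N c : ℕ) (ars : List ℕ) (w : List K) : Option (List (List K × List K) × List K) :=
  readEach (readEntry N c) ars w

@[fun_prop]
theorem ps_readTable {N c : α → ℕ} {l : α → List ℕ} {w : α → List K} (hN : PS ord N)
    (hc : PS ord c) (hl : PS ord l) (hw : PS ord w) :
    PS ord (fun x => readTable (N x) (c x) (l x) (w x)) := by
  have hb : PS ord (fun y : ℕ × ℕ × ℕ × List K => readBlock y.1 y.2.1 y.2.2.1 y.2.2.2) := by
    unfold readBlock allSame
    fun_prop
  refine ps_readEach (rd := fun x => readEntry (N x) (c x)) ?_ hl hw (PB.const 11)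
    fun x b w t r h => ?_
  · unfold readEntry
    exact .bind (hb.comp (f := fun y : (α × ℕ) × List K => (N y.1.1, c y.1.1, y.1.2, y.2))
      (by fun_prop)) (.optMap (hb.comp (f := fun y : ((α × ℕ) × List K) × (List K × List K) =>
      (N y.1.1.1, c y.1.1.1, y.1.1.2, y.2.2)) (by fun_prop)) (by fun_prop))
  · simp only [readEntry, Option.bind_eq_some_iff, Option.map_eq_some_iff, Prod.exists,
      Prod.mk.injEq] at h
    obtain ⟨p, r', h1, q, r'', h2, rfl, rfl⟩ := h
    have h1 := readBlock_eq h1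
    have h2 := readBlock_eq h2
    simp only [sz_prod, sz_word, h1, h2, List.length_append]
    omega

/-- A binary number as a unary number, cut off at `N`. -/
def ncap (N : ℕ) (x : Num) : ℕ := min N x.val

@[fun_prop]
theorem ps_ncap {f : α → ℕ} {g : α → Num} (hf : PS ord f) (hg : PS ord g) :
    PS ord (fun x => ncap (f x) (g x)) := PS.numCap hf hg

end Tables

section Evaluator

variable {K : Type*} [CommSemiring K] [Nontrivial K] {ord : Option (SemiringOrder K)}

/-- The parameters of the evaluator: a bound `N`, the size of the universe, the arities, the values
of the literals, and whether all variables are given the index `0`. -/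
abbrev Cfg (K : Type*) := ℕ × ℕ × List ℕ × List (List K × List K) × Bool

/-- A recursive call: the operation, whether comparisons are permitted, whether all calls start at
the same place, the environments of the calls, and the word to be read. -/
abbrev Call (K : Type*) := ℕ × Bool × Bool × List Env × List K

/-- The index of the value of a variable. -/
def lookD (dflt : Bool) (env : Env) (x : Num) : Option ℕ := bif dflt then some 0 else look env x

/-- The value of a literal. -/
def tabVal (cfg : Cfg K) (neg : Bool) (R : ℕ) (l : List ℕ) : K :=
  (cfg.2.2.2.1[R]?).elim 0 fun e =>
    (bif neg then e.2 else e.1)[rank cfg.1 cfg.2.1 l]?.elim 0 fun v => v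

/-- Evaluates an equation or the negation of an equation. -/
def evalEq (cfg : Cfg K) (neg : Bool) (env : Env) (w : List K) : Option (K × List K) :=
  (readNum w).bind fun x => (readNum x.2).bind fun y => (lookD cfg.2.2.2.2 env x.1).bind fun i =>
    (lookD cfg.2.2.2.2 env y.1).map fun j => (bif decide (i = j) ^^ neg then 1 else 0, y.2)

/-- Evaluates a relational literal. -/
def evalRel (cfg : Cfg K) (neg : Bool) (env : Env) (w : List K) : Option (K × List K) :=
  (readNum w).bind fun x => (cfg.2.2.1[ncap cfg.1 x.1]?).bind fun k =>
    (readMany readNum k x.2).bind fun y =>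
      (seqOpt (y.1.map fun z => lookD cfg.2.2.2.2 env z)).map fun l =>
        (tabVal cfg neg (ncap cfg.1 x.1) l, y.2)

/-- Prepares the evaluation of a quantifier. -/
def evalQuant (cfg : Cfg K) (op : ℕ) (fl : Bool) (env : Env) (w : List K) :
    Option (K × List K) ⊕ Call K :=
  (readNum w).elim (.inl none) fun y =>
    .inr (op, fl, true, (List.range cfg.2.1).map fun i => (y.1, i) :: env, y.2)

/-- Prepares the evaluation of a comparison. -/
def evalCmp (ok : Bool) (op : ℕ) (fl : Bool) (env : Env) (w : List K) :
    Option (K × List K) ⊕ Call K :=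
  -- The operands of a comparison must be free of comparisons, so the first flag becomes false.
  bif fl && ok then .inr (op, false, false, [env, env], w) else .inl none

/-- Reads the first symbol of a formula. -/
def header (O : Set Cmp) (cfg : Cfg K) (fl : Bool) (env : Env) (w : List K) :
    Option (K × List K) ⊕ Call K :=
  (readNum w).elim (.inl none) fun x =>
    -- All tokens that are not symbols are cut off to `12`, which matches no case.
    bif decide (ncap 12 x.1 = 0) then .inl (evalEq cfg false env x.2) else
    bif decide (ncap 12 x.1 = 1) then .inl (evalEq cfg true env x.2) else
    bif decide (ncap 12 x.1 = 2) then .inl (evalRel cfg false env x.2) else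
    bif decide (ncap 12 x.1 = 3) then .inl (evalRel cfg true env x.2) else
    -- Operation `0` is the product and `1` the sum, for connectives and quantifiers alike; `2` to
    -- `5` are the comparisons.
    bif decide (ncap 12 x.1 = 4) then .inr (0, fl, false, [env, env], x.2) else
    bif decide (ncap 12 x.1 = 5) then .inr (1, fl, false, [env, env], x.2) else
    bif decide (ncap 12 x.1 = 6) then evalQuant cfg 1 fl env x.2 else
    bif decide (ncap 12 x.1 = 7) then evalQuant cfg 0 fl env x.2 else
    bif decide (ncap 12 x.1 = 8) then evalCmp (decide (Cmp.eq ∈ O)) 2 fl env x.2 else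
    bif decide (ncap 12 x.1 = 9) then evalCmp (decide (Cmp.ne ∈ O)) 3 fl env x.2 else
    bif decide (ncap 12 x.1 = 10) then evalCmp (decide (Cmp.le ∈ O)) 4 fl env x.2 else
    bif decide (ncap 12 x.1 = 11) then evalCmp (decide (Cmp.nle ∈ O)) 5 fl env x.2 else
    .inl none

/-- The value of a comparison. -/
def cmpVal (ord : Option (SemiringOrder K)) (c : Cmp) (acc : List K) : K :=
  (uncons acc).elim 0 fun x => (uncons x.2).elim 0 fun y =>
    -- The values come in reverse order, so `y.1` is the left operand.
    bif decide (c.Holds ord y.1 x.1) then 1 else 0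

/-- The value of an operation, given the values of the operands in reverse order. -/
def combine (ord : Option (SemiringOrder K)) (op : ℕ) (acc : List K) : K :=
  bif decide (op = 0) then acc.foldl (fun a b => a * b) 1 else
  bif decide (op = 1) then acc.foldl (fun a b => a + b) 0 else
  bif decide (op = 2) then cmpVal ord .eq acc else
  bif decide (op = 3) then cmpVal ord .ne acc else
  bif decide (op = 4) then cmpVal ord .le acc else cmpVal ord .nle acc

/-- The remaining calls, after `acc` has been computed. -/
def callRest (ord : Option (SemiringOrder K))
    (f : Bool → Env → List K → Option (K × List K)) (op : ℕ) (fl rs : Bool) (w₀ : List K) :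
    List Env → List K → List K → Option (K × List K)
  | [], acc, w => some (combine ord op acc, w)
  -- The instances of a quantified formula all read the same word; the operands of a connective or a
  -- comparison read consecutive ones.
  | e :: envs, acc, w => (f fl e (bif rs then w₀ else w)).bind fun x =>
      callRest ord f op fl rs w₀ envs (x.1 :: acc) x.2

/-- Reads and evaluates a formula. -/
def peval (ord : Option (SemiringOrder K)) (O : Set Cmp) (cfg : Cfg K) :
    ℕ → Bool → Env → List K → Option (K × List K)
  -- The numerical argument bounds the depth of the recursion; exhausting it counts as failure.
  | 0, _, _, _ => none
  | n + 1, fl, env, w => Sum.elim (fun o => o) (fun s =>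
      callRest ord (peval ord O cfg n) s.1 s.2.1 s.2.2.1 s.2.2.2.2 s.2.2.2.1 [] s.2.2.2.2)
      (header O cfg fl env w)

/-! #### Its space requirement -/

/-- The arguments of a call of the evaluator. -/
abbrev Prob (K : Type*) := Cfg K × ℕ × Bool × Env × List K

/-- The data to be kept during a call: the parameters, the call, and the values computed so far. -/
abbrev Frame (K : Type*) := Cfg K × ℕ × Call K × List K

/-- The next action for a frame, at a given position of the input. -/
def pnext (ord : Option (SemiringOrder K)) (g : Frame K) (w : List K) :
    Option (K × List K) ⊕ (Prob K × Frame K) :=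
  (uncons g.2.2.1.2.2.2.1).elim (.inl (some (combine ord g.2.2.1.1 g.2.2.2, w))) fun y =>
    .inr ((g.1, g.2.1, g.2.2.1.2.1, y.1, bif g.2.2.1.2.2.1 then g.2.2.1.2.2.2.2 else w),
      (g.1, g.2.1, (g.2.2.1.1, g.2.2.1.2.1, g.2.2.1.2.2.1, y.2, g.2.2.1.2.2.2.2), g.2.2.2))

/-- The first action for a call. -/
def pstart (ord : Option (SemiringOrder K)) (O : Set Cmp) (x : Prob K) :
    Option (K × List K) ⊕ (Prob K × Frame K) :=
  bif decide (x.2.1 = 0) then .inl none else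
    Sum.elim (fun o => .inl o) (fun s => pnext ord (x.1, x.2.1 - 1, s, []) s.2.2.2.2)
      (header O x.1 x.2.2.1 x.2.2.2.1 x.2.2.2.2)

/-- The action after the return of a call. -/
def presume (ord : Option (SemiringOrder K)) (g : Frame K) (o : Option (K × List K)) :
    Option (K × List K) ⊕ (Prob K × Frame K) :=
  o.elim (.inl none) fun x => pnext ord (g.1, g.2.1, g.2.2.1, x.1 :: g.2.2.2) x.2

section

variable {α : Type*} [Enc K α] {cfg : α → Cfg K} {fl : α → Bool} {env : α → Env} {w : α → List K}

@[fun_prop]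
theorem ps_evalEq (neg : Bool) (hc : PS ord cfg) (he : PS ord env) (hw : PS ord w) :
    PS ord (fun x => evalEq (cfg x) neg (env x) (w x)) := by
  unfold evalEq lookD
  fun_prop

@[fun_prop]
theorem ps_evalRel (neg : Bool) (hc : PS ord cfg) (he : PS ord env) (hw : PS ord w) :
    PS ord (fun x => evalRel (cfg x) neg (env x) (w x)) := by
  unfold evalRel lookD tabVal
  fun_prop

@[fun_prop]
theorem ps_evalQuant (op : ℕ) (hc : PS ord cfg) (hf : PS ord fl) (he : PS ord env)
    (hw : PS ord w) : PS ord (fun x => evalQuant (cfg x) op (fl x) (env x) (w x)) := by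
  unfold evalQuant
  fun_prop

@[fun_prop]
theorem ps_evalCmp (ok : Bool) (op : ℕ) (hf : PS ord fl) (he : PS ord env) (hw : PS ord w) :
    PS ord (fun x => evalCmp ok op (fl x) (env x) (w x)) := by
  unfold evalCmp
  fun_prop

end

theorem ps_header (O : Set Cmp) : PS ord (fun x : Cfg K × Bool × Env × List K =>
    header O x.1 x.2.1 x.2.2.1 x.2.2.2) := by
  unfold header
  fun_prop

/-- Every element of `K` has size 3, so folds of sums and products need no estimate. The relation
`≤` is the test of the branch nodes if `K` is ordered; without an order it is constantly false by
convention. -/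
theorem ps_combine : PS ord (fun x : ℕ × List K => combine ord x.1 x.2) := by
  have hm : PS ord (fun x : ℕ × List K => x.2.foldl (fun a b => a * b) 1) :=
    PS.foldl_of_le (g := fun _ a b => a * b) (by fun_prop) (by fun_prop) (by fun_prop) (PB.const 3)
      fun _ _ _ _ => le_rfl
  have ha : PS ord (fun x : ℕ × List K => x.2.foldl (fun a b => a + b) 0) :=
    PS.foldl_of_le (g := fun _ a b => a + b) (by fun_prop) (by fun_prop) (by fun_prop) (PB.const 3)
      fun _ _ _ _ => le_rfl
  have hc (c : Cmp) : PS ord (fun x : K × K => decide (c.Holds ord x.1 x.2)) := by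
    have hle : PS ord (fun x : K × K => decide (Cmp.le.Holds ord x.1 x.2)) := by
      rcases ord with _ | o
      · exact (PS.const false).recode (fun x => x) (fun _ => rfl) fun x => congrArg _ (by
        rw [Bool.eq_iff_iff]; simp [Cmp.Holds])
      · exact PS.branchTest'.recode (fun x => x) (fun _ => rfl) fun x => congrArg _ (by
          rw [Bool.eq_iff_iff]; simp [Cmp.Holds, branchTest, BranchRel]; exact decide_eq_true_iff.symm)
    have heq : PS ord (fun x : K × K => decide (Cmp.eq.Holds ord x.1 x.2)) := by
      refine PS.recode (g := fun x : K × K => keq x.1 x.2) (fun x => x) (by fun_prop)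
        (fun _ => rfl) fun x => rfl
    rcases c
    · exact heq
    · exact heq.not.recode (fun x => x) (fun _ => rfl) fun x => congrArg _ (by
        rw [Bool.eq_iff_iff, decide_eq_true_iff, Bool.not_eq_true', decide_eq_false_iff_not]; rfl)
    · exact hle
    · exact hle.not.recode (fun x => x) (fun _ => rfl) fun x => congrArg _ (by
        rw [Bool.eq_iff_iff, decide_eq_true_iff, Bool.not_eq_true', decide_eq_false_iff_not]; rfl)
  have hv (c : Cmp) : PS ord (fun x : ℕ × List K => cmpVal ord c x.2) := by
    unfold cmpVal
    refine .optElim (by fun_prop) (by fun_prop) (.optElim (by fun_prop) (by fun_prop) (.cond ((hc c).comp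
      (f := fun y : ((ℕ × List K) × (K × List K)) × (K × List K) => (y.2.1, y.1.2.1))
      (by fun_prop)) (by fun_prop) (by fun_prop)))
  unfold combine
  fun_prop

theorem ps_pnext : PS ord (fun x : Frame K × List K => pnext ord x.1 x.2) := by
  unfold pnext
  refine .optElim (by fun_prop) (.inl (.some (.prodMk (ps_combine.comp
    (f := fun x : Frame K × List K => (x.1.2.2.1.1, x.1.2.2.2)) (by fun_prop)) (by fun_prop))))
    (by fun_prop)

theorem ps_pstart (O : Set Cmp) : PS ord (pstart ord O : Prob K → _) := by
  unfold pstart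
  exact .cond (by fun_prop) (by fun_prop) (.sumElim ((ps_header O).comp
    (f := fun x : Prob K => (x.1, x.2.2.1, x.2.2.2.1, x.2.2.2.2)) (by fun_prop)) (by fun_prop)
    (ps_pnext.comp (f := fun y : Prob K × Call K => ((y.1.1, y.1.2.1 - 1, y.2, []), y.2.2.2.2.2))
      (by fun_prop)))

theorem ps_presume :
    PS ord (fun x : Frame K × Option (K × List K) => presume ord x.1 x.2) := by
  unfold presume
  exact .optElim (by fun_prop) (by fun_prop) (ps_pnext.comp
    (f := fun y : (Frame K × Option (K × List K)) × (K × List K) =>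
      ((y.1.1.1, y.1.1.2.1, y.1.1.2.2.1, y.2.1 :: y.1.1.2.2.2), y.2.2)) (by fun_prop))

end Evaluator

/-! ### Size of the data during the evaluation -/

section EvaluatorSpace

variable {K : Type*} [CommSemiring K] [Nontrivial K] {ord : Option (SemiringOrder K)}

theorem readMany_length {n : ℕ} {w r : List K} {l : List Num}
    (h : readMany readNum n w = some (l, r)) : r.length ≤ w.length := by
  rw [((readMany_eq_some parses_readNum).1 h).2, List.length_append]
  omega

theorem evalEq_length {cfg : Cfg K} {neg : Bool} {env : Env} {w r : List K} {v : K}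
    (h : evalEq cfg neg env w = some (v, r)) : r.length ≤ w.length := by
  simp only [evalEq, Option.bind_eq_some_iff, Option.map_eq_some_iff, Prod.exists,
    Prod.mk.injEq] at h
  obtain ⟨a, r₁, h₁, b, r₂, h₂, i, -, j, -, -, rfl⟩ := h
  have := (readNum_sz h₁).2
  have := (readNum_sz h₂).2
  omega

theorem evalRel_length {cfg : Cfg K} {neg : Bool} {env : Env} {w r : List K} {v : K}
    (h : evalRel cfg neg env w = some (v, r)) : r.length ≤ w.length := by
  simp only [evalRel, Option.bind_eq_some_iff, Option.map_eq_some_iff, Prod.exists,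
    Prod.mk.injEq] at h
  obtain ⟨a, r₁, h₁, k, -, l, r₂, h₂, i, -, -, rfl⟩ := h
  have := (readNum_sz h₁).2
  have := readMany_length h₂
  omega

/-- The bounds for the data that `header` produces. -/
def HeaderBound (cfg : Cfg K) (env : Env) (w : List K) :
    Option (K × List K) ⊕ Call K → Prop
  | .inl none => True
  | .inl (some x) => x.2.length ≤ w.length
  | .inr s => s.1 ≤ 5 ∧ s.2.2.2.1.length ≤ cfg.2.1 + 2 ∧ s.2.2.2.2.length ≤ w.length ∧
      ∀ e ∈ s.2.2.2.1, sz K e ≤ sz K env + (10 * w.length + 9 * cfg.2.1 + 20)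

/-- Only quantifiers enlarge the environment, by a variable whose code was part of `w` and an index
below the size of the universe. This gives the increment `10 * w.length + 9 * cfg.2.1 + 20`. -/
theorem headerBound (O : Set Cmp) (cfg : Cfg K) (fl : Bool) (env : Env) (w : List K) :
    HeaderBound cfg env w (header O cfg fl env w) := by
  unfold header
  rcases h : readNum w with _ | ⟨t, r⟩
  · trivial
  have hr := (readNum_sz h).2
  have hsome : ∀ o : Option (K × List K), (∀ v r', o = some (v, r') → r'.length ≤ r.length) →
      HeaderBound cfg env w (.inl o) := by
    rintro (_ | ⟨v, r'⟩) ho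
    · trivial
    · exact (ho v r' rfl).trans hr.le
  have hpair : ∀ op fl' rs, op ≤ 5 → HeaderBound cfg env w (.inr (op, fl', rs, [env, env], r)) :=
    fun op fl' rs hop => ⟨hop, by simp, hr.le, by simp⟩
  have hquant : ∀ op, op ≤ 5 → HeaderBound cfg env w (evalQuant cfg op fl env r) := by
    intro op hop
    unfold evalQuant
    rcases h' : readNum r with _ | ⟨t', r'⟩
    · trivial
    · have hr' := readNum_sz h'
      refine ⟨hop, by simp, by dsimp only; omega, ?_⟩
      intro e he
      simp only [Option.elim_some, List.mem_map, List.mem_range] at he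
      obtain ⟨i, hi, rfl⟩ := he
      have := hr'.1
      rw [sz_word, sz_word] at this
      rw [sz_cons, sz_prod, sz_nat]
      dsimp only
      omega
  have hcmp : ∀ ok op, op ≤ 5 → HeaderBound cfg env w (evalCmp ok op fl env r) := by
    intro ok op hop
    unfold evalCmp
    cases fl && ok
    · trivial
    · exact hpair op false false hop
  have hcond : ∀ (b : Bool) (x y : Option (K × List K) ⊕ Call K), HeaderBound cfg env w x →
      HeaderBound cfg env w y → HeaderBound cfg env w (bif b then x else y) := by
    rintro (_ | _) x y hx hy
    exacts [hy, hx]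
  rw [Option.elim_some]
  refine hcond _ _ _ (hsome _ fun v r' h => evalEq_length h) <|
    hcond _ _ _ (hsome _ fun v r' h => evalEq_length h) <|
    hcond _ _ _ (hsome _ fun v r' h => evalRel_length h) <|
    hcond _ _ _ (hsome _ fun v r' h => evalRel_length h) <|
    hcond _ _ _ (hpair _ _ _ (by omega)) <| hcond _ _ _ (hpair _ _ _ (by omega)) <|
    hcond _ _ _ (hquant _ (by omega)) <| hcond _ _ _ (hquant _ (by omega)) <|
    hcond _ _ _ (hcmp _ _ (by omega)) <| hcond _ _ _ (hcmp _ _ (by omega)) <|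
    hcond _ _ _ (hcmp _ _ (by omega)) <| hcond _ _ _ (hcmp _ _ (by omega)) trivial

/-- A bound for the size of the data during the evaluation. -/
def evalBound (s c n v l : ℕ) : ℕ :=
  -- The terms pay for the parameters, the depth, an environment, words, the pending environments,
  -- the computed values, and the constants, in this order.
  s + 9 * n + v + 30 * l + (c + 2) * (v + 7) + (c + 2) * 10 + 200

/-- An environment grows by a bounded increment per level, and `v` reserves that increment for each
of the `n` levels below. The number of operands, pending or computed, is at most `cfg.2.1 + 2`: the
size of the universe for a quantifier, two otherwise. -/
theorem ev_callRest {O : Set Cmp} {cfg : Cfg K} {n n₀ v l op : ℕ} {fl rs : Bool} {w₀ : List K}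
    (hn : n ≤ n₀) (hop : op ≤ 5) (hw₀ : w₀.length ≤ l)
    (ih : ∀ env w, w.length ≤ l →
      sz K env + n * (10 * l + 9 * cfg.2.1 + 20) ≤ v →
      (∀ k r, peval ord O cfg n fl env w = some (k, r) → r.length ≤ l) ∧
      Ev K (pstart ord O) (presume ord) (evalBound (sz K cfg) cfg.2.1 n₀ v l) n
        (pstart ord O (cfg, n, fl, env, w)) (peval ord O cfg n fl env w))
    (envs : List Env) : ∀ (acc w : List K), envs.length + acc.length ≤ cfg.2.1 + 2 → w.length ≤ l →
    (∀ e ∈ envs, sz K e + n * (10 * l + 9 * cfg.2.1 + 20) ≤ v) →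
    (∀ k r, callRest ord (peval ord O cfg n) op fl rs w₀ envs acc w = some (k, r) →
      r.length ≤ l) ∧
    Ev K (pstart ord O) (presume ord) (evalBound (sz K cfg) cfg.2.1 n₀ v l) (n + 1)
      (pnext ord (cfg, n, (op, fl, rs, envs, w₀), acc) w)
      (callRest ord (peval ord O cfg n) op fl rs w₀ envs acc w) := by
  induction envs with
  | nil =>
    intro acc w hacc hw _
    refine ⟨fun k r h => ?_, .ret ?_⟩
    · simp only [callRest, Option.some.injEq, Prod.mk.injEq] at h
      rwa [← h.2]
    · rw [sz_some, sz_prod, sz_self, sz_word, evalBound]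
      dsimp only
      omega
  | cons e envs ihe =>
    intro acc w hacc hw he
    rw [List.length_cons] at hacc
    have hw' : (bif rs then w₀ else w).length ≤ l := by cases rs <;> assumption
    obtain ⟨h1, h2⟩ := ih e (bif rs then w₀ else w) hw' (he e (by simp))
    have hsze := he e (by simp)
    rw [callRest]
    have hprob : sz K ((cfg, n, fl, e, bif rs then w₀ else w) : Prob K) ≤
        evalBound (sz K cfg) cfg.2.1 n₀ v l := by
      have := sz_bool K fl
      simp only [sz_prod, sz_nat, sz_word, evalBound]
      omega
    have hframe : sz K ((cfg, n, (op, fl, rs, envs, w₀), acc) : Frame K) ≤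
        evalBound (sz K cfg) cfg.2.1 n₀ v l := by
      have := sz_bool K fl
      have := sz_bool K rs
      have h3 := sz_le_of_forall (K := K) (l := envs) (C := v) fun e' he' => by
        have := he e' (by simp [he'])
        omega
      have h4 : envs.length * (v + 7) ≤ (cfg.2.1 + 2) * (v + 7) :=
        Nat.mul_le_mul_right _ (by omega)
      simp only [sz_prod, sz_nat, sz_word, evalBound]
      omega
    rcases h : peval ord O cfg n fl e (bif rs then w₀ else w) with _ | ⟨k, r⟩
    · rw [Option.bind_none]
      refine ⟨by simp, .call hprob hframe (b' := none) (h ▸ h2) (.ret ?_)⟩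
      rw [sz_none, evalBound]
      omega
    · rw [Option.bind_some]
      obtain ⟨h5, h6⟩ := ihe (k :: acc) r (by rw [List.length_cons]; omega) (h1 k r h)
        fun e' he' => he e' (by simp [he'])
      exact ⟨h5, .call hprob hframe (b' := some (k, r)) (h ▸ h2) h6⟩

theorem ev_peval (ord : Option (SemiringOrder K)) (O : Set Cmp) (cfg : Cfg K) {n n₀ v l : ℕ}
    (hn : n ≤ n₀) : ∀ (fl : Bool) (env : Env) (w : List K), w.length ≤ l →
      sz K env + n * (10 * l + 9 * cfg.2.1 + 20) ≤ v →
      (∀ k r, peval ord O cfg n fl env w = some (k, r) → r.length ≤ l) ∧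
      Ev K (pstart ord O) (presume ord) (evalBound (sz K cfg) cfg.2.1 n₀ v l) n
        (pstart ord O (cfg, n, fl, env, w)) (peval ord O cfg n fl env w) := by
  induction n with
  | zero =>
    intro fl env w _ _
    refine ⟨by simp [peval], .ret ?_⟩
    rw [sz_none, evalBound]
    omega
  | succ n ih =>
    intro fl env w hw henv
    rw [Nat.succ_mul] at henv
    have hb := headerBound O cfg fl env w
    have hs : pstart ord O (cfg, n + 1, fl, env, w) =
        Sum.elim (fun o => .inl o) (fun s => pnext ord (cfg, n, s, []) s.2.2.2.2)
          (header O cfg fl env w) := rfl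
    rw [hs, peval]
    rcases h : header O cfg fl env w with (_ | ⟨k, r⟩) | ⟨op, fl', rs, envs, w₀⟩
    · refine ⟨by simp, .ret ?_⟩
      rw [sz_none, evalBound]
      omega
    · rw [h] at hb
      have hb : r.length ≤ w.length := hb
      refine ⟨fun k' r' h' => ?_, .ret ?_⟩
      · simp only [Sum.elim_inl, Option.some.injEq, Prod.mk.injEq] at h'
        rw [← h'.2]
        omega
      · rw [sz_some, sz_prod, sz_self, sz_word, evalBound]
        dsimp only
        omega
    · rw [h] at hb
      obtain ⟨h1, h2, h3, h4⟩ := hb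
      refine ev_callRest (by omega) h1 (h3.trans hw) (ih (by omega) fl') envs [] w₀
        (by simpa using h2) (h3.trans hw) fun e he => ?_
      have := h4 e he
      omega

theorem ps_peval' (O : Set Cmp) :
    PS ord (fun x : Prob K => peval ord O x.1 x.2.1 x.2.2.1 x.2.2.2.1 x.2.2.2.2) := by
  have h1 : PB K (fun x : Prob K => sz K x.1) := PB.sz (ord := ord) (by fun_prop)
  have h2 : PB K (fun x : Prob K => x.1.2.1) := PB.of_ps (ord := ord) (by fun_prop)
  have h3 : PB K (fun x : Prob K => x.2.1) := PB.of_ps (ord := ord) (by fun_prop)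
  have h4 : PB K (fun x : Prob K => sz K x.2.2.2.1) := PB.sz (ord := ord) (by fun_prop)
  have h5 : PB K (fun x : Prob K => x.2.2.2.2.length) := PB.of_ps (ord := ord) (by fun_prop)
  have hv : PB K (fun x : Prob K => sz K x.2.2.2.1 +
      x.2.1 * (10 * x.2.2.2.2.length + 9 * x.1.2.1 + 20)) :=
    h4.add (h3.mul ((((PB.const 10).mul h5).add ((PB.const 9).mul h2)).add (PB.const 20)))
  have hW : PB K (fun x : Prob K => evalBound (sz K x.1) x.1.2.1 x.2.1 (sz K x.2.2.2.1 +
      x.2.1 * (10 * x.2.2.2.2.length + 9 * x.1.2.1 + 20)) x.2.2.2.2.length + sz K x) := by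
    unfold evalBound
    exact ((((((h1.add ((PB.const 9).mul h3)).add hv).add ((PB.const 30).mul h5)).add
      ((h2.add (PB.const 2)).mul (hv.add (PB.const 7)))).add
      ((h2.add (PB.const 2)).mul (PB.const 10))).add (PB.const 200)).add
      (PB.sz (PS.id (ord := ord)))
  -- The bound on the depth is the fuel, whose unary code is part of the argument.
  refine PS.recursion (ps_pstart O) ps_presume PS.id hW h3 fun x => ⟨Nat.le_add_left _ _, ?_⟩
  have := (ev_peval ord O x.1 (n := x.2.1) le_rfl x.2.2.1 x.2.2.2.1 x.2.2.2.2 le_rfl le_rfl).2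
  exact this.mono (Nat.le_add_right _ _)

@[fun_prop]
theorem ps_peval {α : Type*} [Enc K α] (O : Set Cmp) {cfg : α → Cfg K} {n : α → ℕ}
    {fl : α → Bool} {env : α → Env} {w : α → List K} (hc : PS ord cfg) (hn : PS ord n)
    (hf : PS ord fl) (he : PS ord env) (hw : PS ord w) :
    PS ord (fun x => peval ord O (cfg x) (n x) (fl x) (env x) (w x)) :=
  (ps_peval' O).comp (f := fun x => (cfg x, n x, fl x, env x, w x)) (by fun_prop)

/-! ### The decision procedure -/

/-- Whether a list is strictly increasing. -/
def increasing (l : List Num) : Bool :=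
  (List.range l.length).all fun i => l[i]?.elim true fun a => l[i + 1]?.elim true fun b =>
    decide (a.val < b.val)

/-- Evaluates the formula that begins at `wf`, given the universe, the assignment, and the word
`wt` with the values of the literals. -/
def decideValue (ord : Option (SemiringOrder K)) (O : Set Cmp) (N c : ℕ) (ars : List ℕ)
    (env : Env) (wf wt : List K) : Bool :=
  -- The table of values has to exhaust the word.
  (readTable N c ars wt).elim false fun t => bif decide (t.2.length = 0) then
    (peval ord O (N, c, ars, t.1, false) N true env wf).elim false fun x => !keq x.1 0
  else false

/-- Reads the assignment. -/
def decideAssignment (ord : Option (SemiringOrder K)) (O : Set Cmp) (N : ℕ) (ars : List ℕ)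
    (A : List Num) (wf ws : List K) : Bool :=
  (readNum ws).elim false fun m => (readMany readPair (ncap N m.1) m.2).elim false fun p =>
    bif increasing (p.1.map fun y => y.1) then
      (seqOpt (p.1.map fun y => (indexIn A y.2).map fun i => (y.1, i))).elim false fun env =>
        decideValue ord O N A.length ars env wf p.2
    else false

/-- Reads the universe and finds the end of the formula. -/
def decideUniverse (ord : Option (SemiringOrder K)) (O : Set Cmp) (N : ℕ) (ars : List ℕ)
    (w : List K) : Bool :=
  (readNum w).elim false fun c => (readMany readNum (ncap N c.1) c.2).elim false fun A =>
    bif increasing A.1 && decide (0 < A.1.length) then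
      -- A trial run with one element, no table and index `0` for every variable. Its value is
      -- discarded; only the remaining word `x.2` matters.
      (peval ord O (N, 1, ars, [], true) N true [] A.2).elim false fun x =>
        decideAssignment ord O N ars A.1 A.2 x.2
    else false

/-- Decides the model checking problem. -/
def decideMC (ord : Option (SemiringOrder K)) (O : Set Cmp) (w : List K) : Bool :=
  (readNum w).elim false fun m =>
    -- The cut-off `w.length + 1` exceeds the length of every suffix of the input, so no list in it
    -- can have that many items.
    (readMany readNum (ncap (w.length + 1) m.1) m.2).elim false fun a =>
      decideUniverse ord O (w.length + 1) (a.1.map fun k => ncap (w.length + 1) k) a.2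

section

variable {α : Type*} [Enc K α] {N c : α → ℕ} {ars : α → List ℕ} {A : α → List Num}
  {env : α → Env} {w w' : α → List K}

@[fun_prop]
theorem ps_increasing (hA : PS ord A) : PS ord (fun x => increasing (A x)) := by
  unfold increasing
  have := PS.numLt (ord := ord) (f := fun y : ((α × ℕ) × Num) × Num => y.1.2)
    (g := fun y : ((α × ℕ) × Num) × Num => y.2) (by fun_prop) (by fun_prop)
  refine .all ?_ (by fun_prop)
  exact .optElim (by fun_prop) (by fun_prop) (.optElim (by fun_prop) (by fun_prop) this)

@[fun_prop]
theorem ps_decideValue (O : Set Cmp) (hN : PS ord N) (hc : PS ord c) (hars : PS ord ars)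
    (he : PS ord env) (hw : PS ord w) (hw' : PS ord w') :
    PS ord (fun x => decideValue ord O (N x) (c x) (ars x) (env x) (w x) (w' x)) := by
  unfold decideValue
  fun_prop

@[fun_prop]
theorem ps_decideAssignment (O : Set Cmp) (hN : PS ord N) (hars : PS ord ars)
    (hA : PS ord A) (hw : PS ord w) (hw' : PS ord w') :
    PS ord (fun x => decideAssignment ord O (N x) (ars x) (A x) (w x) (w' x)) := by
  unfold decideAssignment
  fun_prop

@[fun_prop]
theorem ps_decideUniverse (O : Set Cmp) (hN : PS ord N) (hars : PS ord ars) (hw : PS ord w) :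
    PS ord (fun x => decideUniverse ord O (N x) (ars x) (w x)) := by
  unfold decideUniverse
  fun_prop

theorem ps_decideMC (O : Set Cmp) : PS ord (decideMC ord O : List K → Bool) := by
  unfold decideMC
  fun_prop

end

end EvaluatorSpace

/-! ### Reading the input -/

section Input

variable {K : Type*} [CommSemiring K] [Nontrivial K] {ord : Option (SemiringOrder K)} {B : ℕ}

/-- For loops whose number `N` of passes is known in advance: `F j` is the configuration after `j`
passes. -/
theorem runs_whileTest_family {l c d : List (ℤ × Op K)} {P : Cmd K} (F : ℕ → (ℤ → K) × ℤ) (N : ℕ)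
    (v : ℕ → Prop) (ht : ∀ j ≤ N, IsTest ord l c d (F j).1 (F j).2 (v j)) (hv : ∀ j < N, v j)
    (hN : ¬ v N) (hP : ∀ j < N, Runs ord B P (F j) (F (j + 1)))
    {s t : (ℤ → K) × ℤ} (hs : s = F 0) (ht' : t = F N) :
    Runs ord B (.whileTest l c d P) s t := by
  subst hs ht'
  have key : ∀ i j, j + i = N → Runs ord B (.whileTest l c d P) (F j) (F N) := by
    intro i
    induction i with
    | zero =>
      intro j hj
      obtain rfl : j = N := hj
      exact (ht j le_rfl).runs_done hN
    | succ i ih =>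
      intro j hj
      exact (ht j (by omega)).runs_step (hv j (by omega)) (hP j (by omega)) (ih (j + 1) (by omega))
  exact key N 0 (by omega)

theorem runs_left {b : ℤ → K} {p q : ℤ} (hq : q = p - 1) (h : |q| ≤ (B : ℤ)) :
    Runs ord B .left (b, p) (b, q) := by
  subst hq
  exact .left _ _ h

theorem runs_right {b : ℤ → K} {p q : ℤ} (hq : q = p + 1) (h : |q| ≤ (B : ℤ)) :
    Runs ord B .right (b, p) (b, q) := by
  subst hq
  exact .right _ _ h

theorem runs_sets_left {l : List (ℤ × Op K)} {b b' : ℤ → K} {p q : ℤ} (hb : execs l b p = b')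
    (hq : q = p - 1) (h : |q| ≤ (B : ℤ)) :
    Runs ord B (.seq (.sets l) .left) (b, p) (b', q) :=
  .seq (runs_sets' hb) (runs_left hq h)

/-- The while statement for the condition that coordinate `1` is `e`, with coordinate `2` known. -/
def Cmd.whileL (ord : Option (SemiringOrder K)) (e : Bool) (k : K) (P : Cmd K) : Cmd K :=
  .whileTest (loadL ord e) [(1, .const (bit K e)), (2, .const k)]
    [(1, .const (bit K (!e))), (2, .const k)] P

/-- The while statement for the condition that coordinate `2` is `e`, with coordinate `1` known. -/
def Cmd.whileR (ord : Option (SemiringOrder K)) (e : Bool) (k : K) (P : Cmd K) : Cmd K :=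
  .whileTest (loadR ord e) [(2, .const (bit K e)), (1, .const k)]
    [(2, .const (bit K (!e))), (1, .const k)] P

/-- The part of the input that remains after the first `k` letters have been fetched: a unary
counter, a gap, and the remaining letters. -/
def trail (w : List K) (k : ℕ) (a : ℤ) : K :=
  -- Letters may be `0`, so a blank cannot mark their end; the counter has a one for each letter
  -- that is left. Per letter its left end advances by two and its right end by one, so that it
  -- always stops one gap before the next letter.
  if 7 + 2 * k ≤ a ∧ a < w.length + 7 + k then 1
  else if w.length + 7 + k < a then w.getD (a - (w.length + 8)).toNat 0 else 0

/-- The right half of the tape after the first `k` letters have been fetched. -/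
def inR (w : List K) (u : K) (k : ℕ) (a : ℤ) : K :=
  if a = 3 then 1 else if a = 6 then u else trail w k a

theorem trail_one {w : List K} {k : ℕ} {a : ℤ} (h₁ : 7 + 2 * k ≤ a) (h₂ : a < w.length + 7 + k) :
    trail w k a = 1 := if_pos ⟨h₁, h₂⟩

theorem trail_zero {w : List K} {k : ℕ} {a : ℤ} (hk : k ≤ w.length) (h : a < 7 + 2 * k) :
    trail w k a = 0 := by
  unfold trail
  rw [if_neg (by omega)]
  split_ifs with h'
  · exact List.getD_eq_default _ _ (by omega)
  · rfl

theorem trail_mark {w : List K} {k : ℕ} : trail w k (w.length + 7 + k) = 0 := by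
  unfold trail
  rw [if_neg (by omega), if_neg (by omega)]

theorem trail_next {w : List K} {k : ℕ} : trail w k (w.length + 8 + k) = w.getD k 0 := by
  unfold trail
  rw [if_neg (by omega), if_pos (by omega)]
  congr 1
  omega

theorem home_inR {w : List K} (u : K) {k : ℕ} (hk : k ≤ w.length) : Home (inR w u k) := by
  constructor <;> simp [inR]
  all_goals exact trail_zero hk (by omega)

/-- The tape while a letter is carried over the counter. -/
def carryR (b : ℤ → K) (m q : ℤ) (x : K) (a : ℤ) : K :=
  if a = q then x else if a = m + 1 then 0 else if a = m then 1 else b a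

/-- The tape while a letter and a flag are carried home. -/
def carryL (b : ℤ → K) (q : ℤ) (x u : K) (a : ℤ) : K :=
  if a = q then x else if a = q + 1 then u else b a

/-- The letter sits on a cell of the counter or on the gap `m`. Writing `1` on leaving restores the
former and fills the latter. -/
theorem carryR_step {b : ℤ → K} {m q q' p : ℤ} {x : K} (hp : p + 3 = q) (hq' : q' = q - 1)
    (hq : b q = 1 ∨ q = m) (hm : q ≤ m) :
    execs [(2, .const 0), (2, .add 2 3), (3, .const 1)] (carryR b m q x) p =
      carryR b m q' x := by
  funext a
  subst hq' hp
  simp only [execs, Op.val, Function.update_apply, carryR]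
  rcases eq_or_ne a (p + 3) with rfl | h3
  · rw [if_pos rfl, if_neg (by omega), if_neg (by omega)]
    split_ifs with h
    · rfl
    · exact (hq.resolve_right h).symm
  have e2 : p + 3 - 1 = p + 2 := by ring
  rcases eq_or_ne a (p + 2) with rfl | h2
  · simp [e2]
  · have h4 : a = p + 3 ↔ False := by simpa using h3
    have h5 : a = p + 2 ↔ False := by simpa using h2
    simp only [e2, h4, h5, if_false]

theorem carryL_step {b : ℤ → K} {q q' p : ℤ} {x u : K} (hp : p + 3 = q) (hq' : q' = q - 1)
    (h0 : b (q - 1) = 0) (h1 : b (q + 1) = 0) :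
    execs [(2, .add 2 3), (3, .const 0), (3, .add 3 4), (4, .const 0)] (carryL b q x u) p =
      carryL b q' x u := by
  funext a
  subst hq' hp
  have e2 : p + 3 - 1 = p + 2 := by ring
  have e4 : p + 3 + 1 = p + 4 := by ring
  rw [e2] at h0
  rw [e4] at h1
  simp only [execs, Op.val, Function.update_apply, carryL, e2, e4]
  have e5 : p + 2 + 1 = p + 3 := by ring
  rcases eq_or_ne a (p + 4) with rfl | h4
  · simp [h1, e5]
  rcases eq_or_ne a (p + 3) with rfl | h3
  · simp [add_assoc]
  rcases eq_or_ne a (p + 2) with rfl | h2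
  · simp [h0]
  · simp [h2, h3, h4, e5]

/-- The program that fetches the next letter. -/
def Cmd.fetch (ord : Option (SemiringOrder K)) : Cmd K :=
  .seq (.sets [(6, .const 0)]) <| .seq (.rights 3) <| .seq (.whileR ord false 0 .right) <|
  .seq .right <| .seq (.whileR ord true 1 .right) <| .seq (.sets [(2, .add 2 3), (3, .const 0)]) <|
  .seq .left <| .seq (.whileL ord true 1
    (.seq (.sets [(2, .const 0), (2, .add 2 3), (3, .const 1)]) .left)) <|
  .seq (.sets [(2, .const 0), (2, .add 2 3), (3, .const 0), (3, .add 3 4)]) <|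
  .seq .left <| .seq (.whileL ord false 0
    (.seq (.sets [(2, .add 2 3), (3, .const 0), (3, .add 3 4), (4, .const 0)]) .left)) <|
  .lefts 2

/-- The next letter is brought home over the counter. Filling the gap and dropping the two leftmost
cells turns the counter for `k` into the one for `k + 1`. -/
theorem runs_fetch {w : List K} {k : ℕ} (hk : k < w.length) {st : ℕ → List K}
    (hB : 2 * w.length + 10 ≤ B) :
    Runs ord B (.fetch ord) (carry st (inR w 1 k) 0 0)
      (carry st (inR w (bit K (decide (k + 1 < w.length))) (k + 1)) (w.getD k 0) 0) := by
  set b := tape st (inR w 0 k) with hb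
  set b' := tape st (inR w 0 (k + 1)) with hb'
  set n := w.length with hn
  set x := w.getD k 0 with hx
  set u := bit K (decide (k + 1 < n)) with hu
  have b_nonneg : ∀ a : ℤ, 7 ≤ a → b a = trail w k a := fun a ha => by
    rw [hb, tape_of_nonneg _ _ (by omega), inR, if_neg (by omega), if_neg (by omega)]
  have b_zero : ∀ a : ℤ, 4 ≤ a → a < 7 + 2 * k → b a = 0 := fun a ha ha' => by
    rw [hb, tape_of_nonneg _ _ (by omega), inR, if_neg (by omega)]
    split_ifs
    · rfl
    · exact trail_zero hk.le ha'
  have b_one : ∀ a : ℤ, 7 + 2 * (k : ℤ) ≤ a → a < n + 7 + k → b a = 1 := fun a ha ha' => by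
    rw [b_nonneg a (by omega), trail_one ha ha']
  have b'_zero : ∀ a : ℤ, 4 ≤ a → a < 9 + 2 * k → b' a = 0 := fun a ha ha' => by
    rw [hb', tape_of_nonneg _ _ (by omega), inR, if_neg (by omega)]
    split_ifs
    · rfl
    · exact trail_zero (by omega) (by push_cast; omega)
  refine .seq (t := (b, 0)) (runs_sets' ?_) ?_
  · funext a
    have h5 := trail_zero (a := 5) hk.le (by omega)
    simp only [execs, Op.val, Function.update_apply, hb, tape, inR, carry, Nat.cast_zero, mul_zero,
      zero_add]
    split_ifs <;> first | rfl | omega | (subst_vars; exact h5.symm)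
  refine .seq (runs_rights 3 (q := 3) rfl (by simp) (by rw [abs_le]; omega)) ?_
  -- The test looks two cells ahead, so the head stops two cells before the left end `7 + 2 * k` of
  -- the counter.
  refine .seq (t := (b, 5 + 2 * k)) ?_ ?_
  · refine runs_whileTest_family (P := .right) (fun j => (b, 3 + j))
      (2 + 2 * k) (fun j => decide (7 + 2 * (k : ℤ) ≤ 5 + j) = false) (fun j hj => isTest_R
      (e := false) (k := 0) (by dsimp only; exact b_zero _ (by omega) (by omega)) ?_)
      (fun j hj => by rw [decide_eq_false]; omega) (by simp; omega)
      (fun j hj => runs_right (by push_cast; ring) (by rw [abs_le]; omega))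
      (by simp) (Prod.ext rfl (by push_cast; ring))
    · dsimp only
      by_cases h : 7 + 2 * (k : ℤ) ≤ 5 + j
      · rw [decide_eq_true h, b_one _ (by omega) (by omega)]; rfl
      · rw [decide_eq_false h, b_zero _ (by omega) (by omega)]; rfl
  refine .seq (.right _ _ (by rw [abs_le]; omega)) ?_
  -- The end of the counter is recognized by the gap at `n + 7 + k`; the letter lies right behind
  -- it.
  refine .seq (t := (b, n + 5 + k)) ?_ ?_
  · refine runs_whileTest_family (P := .right)
      (fun j => (b, 5 + 2 * k + 1 + j)) (n - 1 - k)
      (fun j => decide (8 + 2 * (k : ℤ) + j < n + 7 + k) = true) (fun j hj => isTest_R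
      (e := true) (k := 1) (by dsimp only; exact b_one _ (by omega) (by omega)) ?_)
      (fun j hj => by rw [decide_eq_true]; omega) (by simp; omega)
      (fun j hj => runs_right (by push_cast; ring) (by rw [abs_le]; omega))
      (by simp) (Prod.ext rfl (by dsimp only; omega))
    · dsimp only
      by_cases h : 8 + 2 * (k : ℤ) + j < n + 7 + k
      · rw [decide_eq_true h, b_one _ (by omega) (by omega)]; rfl
      · have e : 5 + 2 * (k : ℤ) + 1 + j + 2 = n + 7 + k := by omega
        rw [decide_eq_false h, e, b_nonneg _ (by omega), trail_mark]; rfl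
  refine .seq (t := (carryR b (n + 7 + k) (n + 7 + k) x, n + 5 + k)) (runs_sets' ?_) ?_
  · have e2 : (n : ℤ) + 5 + k + 2 = n + 7 + k := by ring
    have e3 : (n : ℤ) + 5 + k + 3 = n + 8 + k := by ring
    have e4 : (n : ℤ) + 7 + k + 1 = n + 8 + k := by ring
    have h2 : b (n + 7 + k) = 0 := by rw [b_nonneg _ (by omega), trail_mark]
    have h3 : b (n + 8 + k) = x := by rw [b_nonneg _ (by omega), trail_next]
    funext a
    simp only [execs, Op.val, Function.update_apply, carryR, e2, e3, e4, h2, h3, zero_add]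
    split_ifs <;> first | rfl | omega
  refine .seq (.left _ _ (by rw [abs_le]; omega)) ?_
  refine .seq (t := (carryR b (n + 7 + k) (8 + 2 * k) x, 5 + 2 * k)) ?_ ?_
  · refine runs_whileTest_family (P := (.seq (.sets [(2, .const 0),
        (2, .add 2 3), (3, .const 1)]) .left))
      (fun j => (carryR b (n + 7 + k) (n + 7 + k - j) x, n + 5 + k - 1 - j)) (n - 1 - k)
      (fun j => decide (7 + 2 * (k : ℤ) ≤ n + 5 + k - j) = true) (fun j hj => isTest_L
      (e := true) (k := 1) ?_ ?_)
      (fun j hj => by rw [decide_eq_true]; omega) (by simp; omega)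
      (fun j hj => by
        refine runs_sets_left (carryR_step (by ring) (by push_cast; ring) ?_ (by omega))
          (by push_cast; ring) (by rw [abs_le]; omega)
        rcases Nat.eq_zero_or_pos j with rfl | hj'
        · right; simp
        · left; exact b_one _ (by omega) (by omega)) (by simp) (Prod.ext (congrArg
        (fun q => carryR b (n + 7 + k) q x) (by omega)) (by dsimp only; omega))
    · dsimp only
      rw [carryR, if_neg (by omega), if_neg (by omega), if_neg (by omega),
        b_one _ (by omega) (by omega)]
    · dsimp only
      rw [carryR, if_neg (by omega), if_neg (by omega), if_neg (by omega)]
      by_cases h : 7 + 2 * (k : ℤ) ≤ n + 5 + k - j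
      · rw [decide_eq_true h, b_one _ (by omega) (by omega)]; rfl
      · rw [decide_eq_false h, b_zero _ (by omega) (by omega)]; rfl
  -- The letter lies on the second cell of the counter and moves to the first. The flag `u` is a
  -- copy of the third cell, which is `1` exactly if another letter is left.
  refine .seq (t := (carryL b' (7 + 2 * k) x u, 5 + 2 * k)) (runs_sets' ?_) ?_
  · have e2 : (5 : ℤ) + 2 * k + 2 = 7 + 2 * k := by ring
    have e3 : (5 : ℤ) + 2 * k + 3 = 8 + 2 * k := by ring
    have e4 : (5 : ℤ) + 2 * k + 4 = 9 + 2 * k := by ring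
    have e5 : (7 : ℤ) + 2 * k + 1 = 8 + 2 * k := by ring
    have h4 : carryR b (n + 7 + k) (8 + 2 * k) x (9 + 2 * k) = u := by
      rw [carryR, if_neg (by omega), hu]
      by_cases h : k + 1 < n
      · rw [if_neg (by omega), decide_eq_true h]
        split_ifs
        · rfl
        · rw [b_one _ (by omega) (by omega)]; rfl
      · rw [if_pos (by omega), decide_eq_false h]; rfl
    have h3 : carryR b (n + 7 + k) (8 + 2 * k) x (8 + 2 * k) = x := if_pos rfl
    funext a
    simp only [execs, Op.val, Function.update_apply, carryL, e2, e3, e4, e5]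
    rcases eq_or_ne a (7 + 2 * k) with rfl | h7
    · simp [h3]
    rcases eq_or_ne a (8 + 2 * k) with rfl | h8
    · simp [h4]
    rw [if_neg h8, if_neg h8, if_neg h7, if_neg h7, if_neg h7, if_neg h8, carryR, if_neg h8]
    rcases lt_or_ge a 0 with ha | ha
    · rw [if_neg (by omega), if_neg (by omega), hb, hb', tape, tape, if_neg (by omega),
        if_neg (by omega)]
    · rw [hb, hb', tape_of_nonneg _ _ ha, tape_of_nonneg _ _ ha, inR, inR, trail, trail]
      push_cast
      split_ifs <;> first | rfl | omega
  -- Letter and flag travel side by side to coordinates `5` and `6`; the home mark at `3` ends the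
  -- loop.
  refine .seq (.left _ _ (by rw [abs_le]; omega)) ?_
  refine .seq (t := (carryL b' 5 x u, 2)) ?_ ?_
  · refine runs_whileTest_family (P := (.seq (.sets [(2, .add 2 3),
        (3, .const 0), (3, .add 3 4), (4, .const 0)]) .left))
      (fun j => (carryL b' (7 + 2 * k - j) x u, 5 + 2 * k - 1 - j)) (2 + 2 * k)
      (fun j => decide (7 + 2 * k - (j : ℤ) ≤ 5) = false) (fun j hj => isTest_L
      (e := false) (k := 0) ?_ ?_)
      (fun j hj => by rw [decide_eq_false]; omega) (by simp)
      (fun j hj => by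
        exact runs_sets_left (carryL_step (by ring) (by push_cast; ring)
          (b'_zero _ (by omega) (by omega)) (b'_zero _ (by omega) (by omega)))
          (by push_cast; ring) (by rw [abs_le]; omega)) (by simp)
      (Prod.ext (congrArg (fun q => carryL b' q x u) (by push_cast; ring)) (by dsimp only; push_cast; ring))
    · dsimp only
      rw [carryL, if_neg (by omega), if_neg (by omega), b'_zero _ (by omega) (by omega)]
    · dsimp only
      rw [carryL, if_neg (by omega), if_neg (by omega)]
      by_cases h : 7 + 2 * k - (j : ℤ) ≤ 5
      · have e : (5 : ℤ) + 2 * k - 1 - j + 1 = 3 := by omega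
        rw [decide_eq_true h, e, hb', tape_of_nonneg _ _ (by omega), inR, if_pos rfl]; rfl
      · rw [decide_eq_false h, b'_zero _ (by omega) (by omega)]; rfl
  have hfin : (carry st (inR w u (k + 1)) x 0) = (carryL b' 5 x u, 0) := by
    simp only [carry, Nat.cast_zero, mul_zero, zero_add]
    congr 1
    funext a
    simp only [Function.update_apply, carryL, hb', tape, inR]
    split_ifs <;> first | rfl | omega
  rw [hfin]
  exact runs_lefts 2 (by norm_num) (by rw [abs_le]; omega) (by simp)

/-- The program that places the head and the home mark, and the empty list on the main stack. -/
def Cmd.initHome (ord : Option (SemiringOrder K)) : Cmd K :=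
  .seq (.seq (.lefts 2) (.iteTest (loadL ord true) [(1, .const (bit K true)), (2, .const 0)]
    [(1, .const (bit K (!true))), (2, .const 0)]
    (.seq .left (.seq (.whileL ord true 1 .left) (.seq (.lefts 5)
      (.sets [(3, .const 1), (6, .const 1)]))))
    (.seq (.lefts 5) (.sets [(3, .const 1)])))) (.pushList ord [1, 0, 0, 0, 0])

theorem tape_nil {R : ℤ → K} {a : ℤ} (h : a < 0) : tape (stk [] [] [] []) R a = 0 := by
  have hst : ∀ s, stk ([] : List K) [] [] [] s = [] := by
    intro s
    unfold stk
    split <;> rfl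
  rw [tape, if_neg (by omega), cell]
  simp [hst, sval]

/-- With the initial head position called `n + 7`, the unary length that accompanies the input is
the counter for `k = 0`. It begins at `7`, just to the right of the cells that are needed at home.
-/
theorem inputMap_trail (w : List K) :
    (fun a => inputMap w (a - (w.length + 7 : ℤ))) = trail w 0 := by
  funext a
  simp only [inputMap, Finsupp.onFinset_apply, trail]
  split_ifs <;> first | rfl | omega | skip
  congr 1
  omega

/-- The ones of the counter lead the head to its left end and thereby home. The empty word has no
ones and is treated apart. -/
theorem runs_initHome (w : List K) {S : ℕ} (hS : 10 * w.length + 20 ≤ S) :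
    Runs ord (16 * (S + 1)) (.initHome ord) (trail w 0, w.length + 7)
      (rest (inR w (bit K (decide (0 < w.length))) 0) (Enc.enc ([] : List K) : KTree K).code) := by
  refine .seq (t := carry (stk [] [] [] []) (inR w (bit K (decide (0 < w.length))) 0) 0 0) ?_
    (runs_pushList (home_inR _ (Nat.zero_le _)) [1, 0, 0, 0, 0] (by simp; omega) 0)
  have hfin : ∀ u : K, ∀ l, (u = 1 ∧ l = [(3, Op.const 1), (6, Op.const 1)] ∨
      u = 0 ∧ l = [(3, Op.const 1)]) →
      Runs ord (16 * (S + 1)) (.sets l) (trail w 0, 0) (carry (stk [] [] [] []) (inR w u 0) 0 0) := by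
    intro u l hl
    refine runs_sets' ?_
    have h5 := trail_zero (w := w) (k := 0) (a := 5) (Nat.zero_le _) (by omega)
    have h6 := trail_zero (w := w) (k := 0) (a := 6) (Nat.zero_le _) (by omega)
    funext a
    simp only [carry, Nat.cast_zero, mul_zero, zero_add, Function.update_apply]
    rcases lt_or_ge a 0 with ha | ha
    · rw [if_neg (by omega), tape_nil ha]
      rcases hl with ⟨rfl, rfl⟩ | ⟨rfl, rfl⟩
      · simp only [execs, Op.val, Function.update_apply, zero_add]
        rw [if_neg (by omega), if_neg (by omega), trail_zero (Nat.zero_le _) (by push_cast; omega)]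
      · simp only [execs, Op.val, Function.update_apply, zero_add]
        rw [if_neg (by omega), trail_zero (Nat.zero_le _) (by push_cast; omega)]
    · rw [tape_of_nonneg _ _ ha, inR]
      rcases hl with ⟨rfl, rfl⟩ | ⟨rfl, rfl⟩ <;>
        simp only [execs, Op.val, Function.update_apply, zero_add] <;>
        split_ifs <;> first | rfl | omega | (subst_vars; assumption)
  refine .seq (runs_lefts 2 (q := w.length + 5) (by push_cast; ring) (by rw [abs_le]; omega)
    (by rw [abs_le]; omega)) ?_
  have ht : IsTest ord (loadL ord true) [(1, .const (bit K true)), (2, .const 0)]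
      [(1, .const (bit K (!true))), (2, .const 0)] (trail w 0) (w.length + 5)
      (decide (0 < w.length) = true) := by
    refine isTest_L ?_ ?_
    · have := trail_mark (w := w) (k := 0)
      rw [← this]
      congr 1
    · by_cases h : 0 < w.length
      · rw [trail_one (by push_cast; omega) (by push_cast; omega), decide_eq_true h]; rfl
      · rw [trail_zero (Nat.zero_le _) (by push_cast; omega), decide_eq_false h]; rfl
  by_cases h : 0 < w.length
  · refine ht.runs_pos (decide_eq_true h) ?_
    rw [decide_eq_true h]
    refine .seq (runs_left rfl (by rw [abs_le]; omega)) (.seq (t := (trail w 0, 5)) ?_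
      (.seq (runs_lefts 5 (q := 0) (by norm_num) (by rw [abs_le]; omega) (by rw [abs_le]; omega))
        (hfin _ _ (.inl ⟨rfl, rfl⟩))))
    refine runs_whileTest_family (P := .left) (fun j => (trail w 0, w.length + 4 - j))
      (w.length - 1) (fun j => decide ((j : ℤ) + 2 ≤ w.length) = true) (fun j hj => isTest_L
      (e := true) (k := 1) ?_ ?_) (fun j hj => by rw [decide_eq_true]; omega) (by simp; omega)
      (fun j hj => runs_left (by push_cast; ring) (by rw [abs_le]; omega))
      (Prod.ext rfl (by dsimp only; push_cast; ring)) (Prod.ext rfl (by dsimp only; omega))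
    · dsimp only
      rw [trail_one (by push_cast; omega) (by push_cast; omega)]
    · dsimp only
      by_cases h' : (j : ℤ) + 2 ≤ w.length
      · rw [trail_one (by push_cast; omega) (by push_cast; omega), decide_eq_true h']; rfl
      · rw [trail_zero (Nat.zero_le _) (by push_cast; omega), decide_eq_false h']; rfl
  · refine ht.runs_neg (by simpa using h) ?_
    rw [decide_eq_false h]
    have : w.length = 0 := by omega
    exact .seq (runs_lefts 5 (q := 0) (by rw [this]; norm_num) (by rw [abs_le]; omega)
      (by rw [abs_le]; omega))
        (hfin _ _ (.inr ⟨rfl, rfl⟩))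

/-- The program that transfers the input to the main stack. -/
def Cmd.readInput (ord : Option (SemiringOrder K)) : Cmd K :=
  .seq (.initHome ord) (.whileAt ord true 6 (.seq (.fetch ord) (.seq (.push ord 0)
    (.pushList ord [1, 1, 0, 0, 0, 0, 1, 0, 1]))))

theorem runs_readInput (w : List K) {S : ℕ} (hS : 10 * w.length + 20 ≤ S) :
    Runs ord (16 * (S + 1)) (.readInput ord) (trail w 0, w.length + 7)
      (rest (homeR 0) (Enc.enc w.reverse : KTree K).code) := by
  refine .seq (runs_initHome w hS) ?_
  refine runs_whileTest_family (fun k => rest (inR w (bit K (decide (k < w.length))) k)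
    (Enc.enc (w.take k).reverse : KTree K).code) w.length (fun k => decide (k < w.length) = true)
    (fun k hk => isTest_carry (home_inR _ hk) (by omega) ?_) (fun k hk => decide_eq_true hk)
    (by simp) (fun k hk => ?_) (by simp) ?_
  · simp [rest, carry, tape, inR]
  · have hsz : (Enc.enc (w.take k).reverse : KTree K).code.length = 10 * k + 5 := by
      have := sz_word (w.take k).reverse
      rw [sz] at this
      rw [this, List.length_reverse, List.length_take, min_eq_left hk.le]
    have htake : (w.take (k + 1)).reverse = w.getD k 0 :: (w.take k).reverse := by
      rw [List.take_add_one, List.reverse_append]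
      simp [hk]
    -- These nine symbols are what the code of a nonempty list has in front of the payload of its
    -- first letter: the list node, its tag, the pair node and the mark of a leaf.
    have hcode : (Enc.enc (w.take (k + 1)).reverse : KTree K).code =
        [1, 1, 0, 0, 0, 0, 1, 0, 1] ++ w.getD k 0 ::
          (Enc.enc (w.take k).reverse : KTree K).code := by
      rw [htake]; rfl
    rw [hcode, decide_eq_true hk]
    refine .seq (runs_fetch hk (by omega)) (.seq (runs_pushMain (home_inR _ hk) (by omega))
      (runs_pushList (home_inR _ hk) _ (by simp; omega) _))
  · rw [List.take_length, decide_eq_false (by simp)]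
    congr 1
    funext a
    simp only [homeR, inR, trail]
    split_ifs <;> first | rfl | omega | skip
    exact (List.getD_eq_default _ _ (by omega)).symm

/-- The stack reverses the input, so the program for `f` after reversal is run. A word of length `n`
has size `10 * n + 5`, and the second symbol of the code of a truth value is its bit. -/
theorem mem_PSPACE_of_ps {f : List K → Bool} (hf : PS ord f) {L : Set (List K)}
    (h : ∀ w, f w = true ↔ w ∈ L) : L ∈ PSPACE ord := by
  have hf' : PS ord (fun w : List K => f w.reverse) := hf.comp (by fun_prop)
  obtain ⟨c, q, hc⟩ := hf'
  refine mem_PSPACE_of_runs (.seq (.readInput ord) (.seq c (.seq (.pops ord (1 + 1))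
    -- The output is the bit at `1`, of unary length one. Coordinate `-2` belongs to an unused track
    -- and is zero.
    (.sets [(-1, .const 1), (1, .add 1 5)]))))
    (16 * (q.comp (10 * Polynomial.X + 5) + 10 * Polynomial.X + 30 + 1)) fun w => ?_
  set S := (q.comp (10 * Polynomial.X + 5) + 10 * Polynomial.X + 30).eval w.length with hS
  have hS' : S = q.eval (10 * w.length + 5) + 10 * w.length + 30 := by simp [hS]
  have hB : (16 * (q.comp (10 * Polynomial.X + 5) + 10 * Polynomial.X + 30 + 1)).eval w.length =
      16 * (S + 1) := by
    rw [Polynomial.eval_mul, Polynomial.eval_add, ← hS]; simp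
  rw [hB]
  have h1 := hc w.reverse
  rw [sz_word, List.length_reverse] at h1
  dsimp only at h1
  rw [List.reverse_reverse] at h1
  have h2 := h1.2 S [] (by simp; omega)
  rw [List.append_nil, List.append_nil] at h2
  obtain ⟨l, hl⟩ : ∃ l : List K, (Enc.enc (f w) : KTree K).code = [1] ++ bit K (f w) :: l ∧
      l.length ≤ 6 := by
    cases f w
    · exact ⟨[0, 0, 0], rfl, by simp⟩
    · exact ⟨[0, 0, 0, 0, 0, 0], rfl, by simp⟩
  rw [hl.1] at h2
  have hrun := (runs_readInput (ord := ord) w (S := S) (by omega)).seq (h2.seq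
    ((runs_pops (M := l) (home_homeR 0) [1] _ (by simp at hl ⊢; omega) 0).seq
    (runs_sets [(-1, .const 1), (1, .add 1 5)] _ _)))
  rw [← inputMap_trail] at hrun
  refine ⟨w.length + 7, _, _, by rw [abs_le]; omega, hrun, ?_, ?_, ?_⟩
  · simp [execs, Op.val, Function.update_apply, carry]
  · simp only [execs, Op.val, Function.update_apply, carry]
    simp [tape, cell]
  · simp only [execs, Op.val, Function.update_apply, carry]
    simp [tape, homeR, bit, ← h]

end Input

/-! ### Correctness of the evaluator -/

section Evaluation

variable {K : Type*} [CommSemiring K] [Nontrivial K] {ord : Option (SemiringOrder K)}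

/-- The code of a list of natural numbers. -/
def tcode (K : Type*) [CommSemiring K] (l : List ℕ) : List K := l.flatMap (numCode K)

theorem tcode_cons (n : ℕ) (l : List ℕ) : tcode K (n :: l) = numCode K n ++ tcode K l := rfl

theorem tcode_append (l m : List ℕ) : tcode K (l ++ m) = tcode K l ++ tcode K m :=
  List.flatMap_append

theorem numCode_pos (n : ℕ) : 0 < (numCode K n).length := by
  rw [length_numCode]; omega

theorem length_le_tcode (l : List ℕ) : l.length ≤ (tcode K l).length := by
  induction l with
  | nil => simp
  | cons n l ih =>
    have := numCode_pos (K := K) n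
    rw [tcode_cons, List.length_append, List.length_cons]
    omega

theorem readNum_code (n : ℕ) (r : List K) : readNum (numCode K n ++ r) = some (⟨n⟩, r) :=
  (parses_readNum _ ⟨n⟩ r).2 rfl

theorem readNums_eq_some {n : ℕ} {w r : List K} {l : List Num} :
    readMany readNum n w = some (l, r) ↔
      l.length = n ∧ w = tcode K (l.map Num.val) ++ r := by
  rw [readMany_eq_some parses_readNum, tcode, List.flatMap_map]

theorem readNums_code (l : List ℕ) (r : List K) :
    readMany readNum l.length (tcode K l ++ r) = some (l.map Num.mk, r) :=
  readNums_eq_some.2 ⟨by simp, by simp [Function.comp_def]⟩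

theorem seqOpt_eq_some {α : Type*} {l : List (Option α)} {m : List α} :
    seqOpt l = some m ↔ l = m.map some := by
  induction l generalizing m with
  | nil => cases m <;> simp [seqOpt]
  | cons o l ih =>
    rcases o with _ | a
    · cases m <;> simp [seqOpt]
    · rw [seqOpt, Option.bind_some]
      rcases h : seqOpt l with _ | m'
      · cases m with
        | nil => simp
        | cons b m =>
          simp only [Option.map_none, List.map_cons, List.cons.injEq, reduceCtorEq, false_iff,
            not_and]
          intro _ h'
          rw [ih.2 h'] at h
          simp at h
      · rw [ih] at h
        subst h
        cases m with
        | nil => simp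
        | cons b m =>
          simp only [Option.map_some, Option.some.injEq, List.cons.injEq, List.map_cons]
          refine and_congr Iff.rfl ⟨fun h => h ▸ rfl, fun h => ?_⟩
          exact List.map_injective_iff.2 (Option.some_injective _) h

/-- The fragment of formulas that the evaluator accepts. -/
def Fragment (O : Set Cmp) {τ : Vocabulary} (fl : Bool) (φ : Formula τ) : Prop :=
  match fl with
  | true => φ.InFO O
  | false => φ.IsFO

/-- The index of an element of a finite set of natural numbers. -/
def idx {A : Finset ℕ} (a : A) : ℕ := ((A.orderIsoOfFin rfl).symm a : Fin A.card).val

theorem idx_lt {A : Finset ℕ} (a : A) : idx a < A.card := Fin.is_lt _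

theorem idx_inj {A : Finset ℕ} {a b : A} : idx a = idx b ↔ a = b := by
  unfold idx
  rw [Fin.val_inj, EmbeddingLike.apply_eq_iff_eq]

theorem idx_orderIso {A : Finset ℕ} (i : Fin A.card) : idx (A.orderIsoOfFin rfl i) = i := by
  simp [idx]

/-- The list of the arities, cut off at `N`. -/
def Arities (N : ℕ) (τ : Vocabulary) (ars : List ℕ) : Prop :=
  ars.length = τ.num ∧ ∀ R : Fin τ.num, ars[(R : ℕ)]? = some (min N (τ.ar R))

variable {O : Set Cmp} {τ : Vocabulary} {N : ℕ} {ars : List ℕ}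

theorem header_code (cfg : Cfg K) (fl : Bool) (env : Env) (t : ℕ) (w : List K) :
    header O cfg fl env (numCode K t ++ w) =
    bif decide (ncap 12 ⟨t⟩ = 0) then .inl (evalEq cfg false env w) else
    bif decide (ncap 12 ⟨t⟩ = 1) then .inl (evalEq cfg true env w) else
    bif decide (ncap 12 ⟨t⟩ = 2) then .inl (evalRel cfg false env w) else
    bif decide (ncap 12 ⟨t⟩ = 3) then .inl (evalRel cfg true env w) else
    bif decide (ncap 12 ⟨t⟩ = 4) then .inr (0, fl, false, [env, env], w) else
    bif decide (ncap 12 ⟨t⟩ = 5) then .inr (1, fl, false, [env, env], w) else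
    bif decide (ncap 12 ⟨t⟩ = 6) then evalQuant cfg 1 fl env w else
    bif decide (ncap 12 ⟨t⟩ = 7) then evalQuant cfg 0 fl env w else
    bif decide (ncap 12 ⟨t⟩ = 8) then evalCmp (decide (Cmp.eq ∈ O)) 2 fl env w else
    bif decide (ncap 12 ⟨t⟩ = 9) then evalCmp (decide (Cmp.ne ∈ O)) 3 fl env w else
    bif decide (ncap 12 ⟨t⟩ = 10) then evalCmp (decide (Cmp.le ∈ O)) 4 fl env w else
    bif decide (ncap 12 ⟨t⟩ = 11) then evalCmp (decide (Cmp.nle ∈ O)) 5 fl env w else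
    .inl none := by
  rw [header, readNum_code]
  rfl

section Headers

variable (cfg : Cfg K) (fl : Bool) (env : Env) (w : List K)

theorem header_zero :
    header O cfg fl env (numCode K 0 ++ w) = .inl (evalEq cfg false env w) := header_code ..

theorem header_one :
    header O cfg fl env (numCode K 1 ++ w) = .inl (evalEq cfg true env w) := header_code ..

theorem header_two :
    header O cfg fl env (numCode K 2 ++ w) = .inl (evalRel cfg false env w) := header_code ..

theorem header_three :
    header O cfg fl env (numCode K 3 ++ w) = .inl (evalRel cfg true env w) := header_code ..

theorem header_four :
    header O cfg fl env (numCode K 4 ++ w) = .inr (0, fl, false, [env, env], w) := header_code ..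

theorem header_five :
    header O cfg fl env (numCode K 5 ++ w) = .inr (1, fl, false, [env, env], w) := header_code ..

theorem header_six :
    header O cfg fl env (numCode K 6 ++ w) = evalQuant cfg 1 fl env w := header_code ..

theorem header_seven :
    header O cfg fl env (numCode K 7 ++ w) = evalQuant cfg 0 fl env w := header_code ..

theorem header_cmp (c : Cmp) : header O cfg fl env (numCode K (8 + c.code) ++ w) =
    evalCmp (decide (c ∈ O)) (2 + c.code) fl env w := by
  cases c <;> exact header_code ..

theorem header_large {t : ℕ} (ht : 12 ≤ t) :
    header O cfg fl env (numCode K t ++ w) = .inl none := by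
  have : ncap 12 ⟨t⟩ = 12 := min_eq_left ht
  rw [header_code, this]
  rfl

end Headers

theorem combine_zero (acc : List K) : combine ord 0 acc = acc.prod := by
  rw [List.prod_eq_foldl]
  rfl

theorem combine_one (acc : List K) : combine ord 1 acc = acc.sum := by
  rw [List.sum_eq_foldl]
  rfl

theorem combine_cmp (c : Cmp) (a b : K) :
    combine ord (2 + c.code) [b, a] = if c.Holds ord a b then 1 else 0 := by
  have h : cmpVal ord c [b, a] = if c.Holds ord a b then 1 else 0 := by
    show (bif decide (c.Holds ord a b) then (1 : K) else 0) = _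
    rw [Bool.cond_decide]
  rw [← h]
  cases c <;> rfl

theorem callRest_pair (f : Bool → Env → List K → Option (K × List K)) (op : ℕ) (fl : Bool)
    (env : Env) (w : List K) : callRest ord f op fl false w [env, env] [] w =
      (f fl env w).bind fun x => (f fl env x.2).map fun y => (combine ord op [y.1, x.1], y.2) := by
  rw [callRest, cond_false]
  congr 1
  funext x
  rw [callRest, cond_false]
  rcases f fl env x.2 with _ | y <;> rfl

/-- Without any call the remaining word would be `w'` and not `r`, hence `L ≠ []`. -/
theorem callRest_map {ι : Type*} {f : Bool → Env → List K → Option (K × List K)} {op : ℕ}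
    {fl : Bool} {w r : List K} {E : ι → Env} {G : ι → K} {L : List ι}
    (h : ∀ i ∈ L, f fl (E i) w = some (G i, r)) (acc : List K) (hL : L ≠ []) (w' : List K) :
    callRest ord f op fl true w (L.map E) acc w' =
      some (combine ord op ((L.map G).reverse ++ acc), r) := by
  induction L generalizing acc w' with
  | nil => exact absurd rfl hL
  | cons i L ih =>
    rw [List.map_cons, callRest, cond_true, h i (by simp), Option.bind_some]
    rcases L with _ | ⟨j, L⟩
    · rfl
    · rw [ih (fun i hi => h i (by simp [hi])) _ (by simp)]
      simp

theorem callRest_true {f : Bool → Env → List K → Option (K × List K)} {op : ℕ}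
    {fl : Bool} {w r w' : List K} {envs : List Env} {acc : List K} {v : K}
    (h : callRest ord f op fl true w envs acc w' = some (v, r)) (he : envs ≠ []) :
    ∃ e ∈ envs, ∃ v', f fl e w = some (v', r) := by
  induction envs generalizing acc w' with
  | nil => exact absurd rfl he
  | cons e envs ih =>
    rw [callRest, cond_true, Option.bind_eq_some_iff] at h
    obtain ⟨⟨v', r'⟩, h1, h2⟩ := h
    rcases envs with _ | ⟨e', envs⟩
    · simp only [callRest, Option.some.injEq, Prod.mk.injEq] at h2
      exact ⟨e, by simp, v', h2.2 ▸ h1⟩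
    · obtain ⟨e₁, h3, h4⟩ := ih h2 (by simp)
      exact ⟨e₁, by simp [h3], h4⟩

theorem look_cons_self (x : Num) (i : ℕ) (env : Env) : look ((x, i) :: env) x = some i := by
  simp [look]

theorem look_cons_of_ne {x y : Num} (h : x ≠ y) (i : ℕ) (env : Env) :
    look ((x, i) :: env) y = look env y := by
  simp [look, h]

/-- Over a one-element universe all indices are `0`, so the default agrees with every assignment. -/
theorem lookD_update {A : Finset ℕ} {dflt : Bool} (hd : dflt = true → A.card = 1) {env : Env}
    {x y : ℕ} {s : ℕ → A} {i : Fin A.card}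
    (h : y ≠ x → lookD dflt env ⟨y⟩ = some (idx (s y))) :
    lookD dflt ((⟨x⟩, i) :: env) ⟨y⟩ =
      some (idx (Function.update s x (A.orderIsoOfFin rfl i) y)) := by
  cases dflt
  · by_cases hxy : y = x
    · subst hxy
      rw [Function.update_self, idx_orderIso]
      exact look_cons_self _ _ _
    · rw [Function.update_of_ne hxy, ← h hxy]
      exact look_cons_of_ne (by simpa using fun h => hxy h.symm) _ _
  · have h1 := hd rfl
    have h2 := idx_lt (Function.update s x (A.orderIsoOfFin rfl i) y)
    have h3 : idx (Function.update s x (A.orderIsoOfFin rfl i) y) = 0 := by omega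
    rw [h3]
    rfl

theorem evalEq_code {cfg : Cfg K} {neg : Bool} {env : Env} {x y i j : ℕ} {r : List K}
    (hx : lookD cfg.2.2.2.2 env ⟨x⟩ = some i) (hy : lookD cfg.2.2.2.2 env ⟨y⟩ = some j) :
    evalEq cfg neg env (tcode K [x, y] ++ r) = some (bif decide (i = j) ^^ neg then 1 else 0, r) := by
  have e : tcode K [x, y] ++ r = numCode K x ++ (numCode K y ++ r) := by simp [tcode]
  rw [evalEq, e, readNum_code, Option.bind_some, readNum_code, Option.bind_some, hx,
    Option.bind_some, hy, Option.map_some]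

/-- The arguments are written out in a word shorter than `N`, so cutting off the arity and the
number of the symbol has no effect. -/
theorem evalRel_code {A : Finset ℕ} {c : ℕ} {tab : List (List K × List K)} {dflt neg : Bool}
    {env : Env} {R : Fin τ.num} {x : Fin (τ.ar R) → ℕ} {r : List K} {s : ℕ → A}
    (hars : Arities N τ ars)
    (hN : (tcode K (2 :: (R : ℕ) :: List.ofFn x) ++ r).length < N) (hnum : τ.num ≤ N)
    (hx : ∀ i, lookD dflt env ⟨x i⟩ = some (idx (s (x i)))) :
    evalRel (N, c, ars, tab, dflt) neg env (tcode K ((R : ℕ) :: List.ofFn x) ++ r) =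
      some (tabVal (N, c, ars, tab, dflt) neg R (List.ofFn fun i => idx (s (x i))), r) := by
  have hR := R.is_lt
  have h1 := length_le_tcode (K := K) (2 :: (R : ℕ) :: List.ofFn x)
  rw [List.length_append] at hN
  simp only [List.length_cons, List.length_ofFn] at h1
  have hcap : ncap N ⟨R⟩ = R := min_eq_right (by dsimp only; omega)
  rw [evalRel, tcode_cons, List.append_assoc, readNum_code, Option.bind_some]
  dsimp only
  rw [hcap, hars.2 R, Option.bind_some, min_eq_right (by omega)]
  have h2 := readNums_code (List.ofFn x) r
  rw [List.length_ofFn] at h2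
  rw [h2, Option.bind_some]
  have h3 : seqOpt (((List.ofFn x).map Num.mk).map fun z => lookD dflt env z) =
      some (List.ofFn fun i => idx (s (x i))) := by
    rw [seqOpt_eq_some, List.map_map, List.map_ofFn, List.map_ofFn]
    congr 1
    funext i
    exact hx i
  dsimp only
  rw [h3]
  rfl

/-- The evaluator computes the values of formulas. -/
theorem peval_code {A : Finset ℕ} {π : Lit τ A → K} {tab : List (List K × List K)}
    {dflt : Bool} (hA : 0 < A.card) (hars : Arities N τ ars) (hnum : τ.num ≤ N)
    (hd : dflt = true → A.card = 1)
    (htab : ∀ neg (R : Fin τ.num) (t : Fin (τ.ar R) → A),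
      tabVal (N, A.card, ars, tab, dflt) neg R (List.ofFn fun i => idx (t i)) = π ⟨neg, R, t⟩)
    (φ : Formula τ) : ∀ (n : ℕ) (fl : Bool) (env : Env) (s : ℕ → A) (r : List K),
      Fragment O fl φ → (tcode K φ.tokens ++ r).length < n →
      (tcode K φ.tokens ++ r).length < N →
      (∀ x ∈ φ.FV, lookD dflt env ⟨x⟩ = some (idx (s x))) →
      peval ord O (N, A.card, ars, tab, dflt) n fl env (tcode K φ.tokens ++ r) =
        some (φ.eval ord π s, r) := by
  have hpair : ∀ (φ ψ : Formula τ) (t : ℕ), (tcode K (t :: (φ.tokens ++ ψ.tokens))) =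
      numCode K t ++ (tcode K φ.tokens ++ tcode K ψ.tokens) := fun φ ψ t => by
    rw [tcode_cons, tcode_append]
  induction φ with
  | eq x y =>
    intro n fl env s r _ hn _ hx
    obtain ⟨n, rfl⟩ : ∃ m, n = m + 1 := ⟨n - 1, by omega⟩
    rw [Formula.tokens, tcode_cons, List.append_assoc, peval, header_zero, Sum.elim_inl,
      evalEq_code (hx x (by simp [Formula.FV])) (hx y (by simp [Formula.FV]))]
    simp [Formula.eval, idx_inj]
  | ne x y =>
    intro n fl env s r _ hn _ hx
    obtain ⟨n, rfl⟩ : ∃ m, n = m + 1 := ⟨n - 1, by omega⟩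
    rw [Formula.tokens, tcode_cons, List.append_assoc, peval, header_one, Sum.elim_inl,
      evalEq_code (hx x (by simp [Formula.FV])) (hx y (by simp [Formula.FV]))]
    by_cases h : s x = s y <;> simp [Formula.eval, idx_inj, h]
  | rel R x =>
    intro n fl env s r _ hn hN hx
    obtain ⟨n, rfl⟩ : ∃ m, n = m + 1 := ⟨n - 1, by omega⟩
    rw [Formula.tokens, tcode_cons, List.append_assoc, peval, header_two, Sum.elim_inl,
      evalRel_code hars hN hnum fun i => hx _ (by simp [Formula.FV]), htab]
    rfl
  | nrel R x =>
    intro n fl env s r _ hn hN hx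
    obtain ⟨n, rfl⟩ : ∃ m, n = m + 1 := ⟨n - 1, by omega⟩
    -- The codes of the tokens `2` and `3` have the same length.
    have hN' : (tcode K (2 :: (R : ℕ) :: List.ofFn x) ++ r).length < N := by
      refine lt_of_eq_of_lt ?_ hN
      simp only [Formula.tokens, tcode_cons, length_numCode, List.length_append]
      rfl
    rw [Formula.tokens, tcode_cons, List.append_assoc, peval, header_three, Sum.elim_inl,
      evalRel_code hars hN' hnum fun i => hx _ (by simp [Formula.FV]), htab]
    rfl
  | and φ ψ ihφ ihψ =>
    intro n fl env s r hO hn hN hx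
    obtain ⟨n, rfl⟩ : ∃ m, n = m + 1 := ⟨n - 1, by omega⟩
    have hO' : Fragment O fl φ ∧ Fragment O fl ψ := by cases fl <;> exact hO
    have h1 := numCode_pos (K := K) 4
    rw [Formula.tokens, hpair] at hn hN ⊢
    simp only [List.length_append] at hn hN
    rw [List.append_assoc, List.append_assoc, peval, header_four, Sum.elim_inr]
    dsimp only
    rw [callRest_pair, ihφ n fl env s _ hO'.1 (by simp; omega) (by simp; omega)
      fun x hx' => hx x (by simp [Formula.FV, hx']), Option.bind_some, ihψ n fl env s _ hO'.2
      (by simp; omega) (by simp; omega) fun x hx' => hx x (by simp [Formula.FV, hx']),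
      Option.map_some, combine_zero]
    -- The operands were collected in reverse order; commutativity makes up for it.
    simp [Formula.eval, mul_comm]
  | or φ ψ ihφ ihψ =>
    intro n fl env s r hO hn hN hx
    obtain ⟨n, rfl⟩ : ∃ m, n = m + 1 := ⟨n - 1, by omega⟩
    have hO' : Fragment O fl φ ∧ Fragment O fl ψ := by cases fl <;> exact hO
    have h1 := numCode_pos (K := K) 5
    rw [Formula.tokens, hpair] at hn hN ⊢
    simp only [List.length_append] at hn hN
    rw [List.append_assoc, List.append_assoc, peval, header_five, Sum.elim_inr]
    dsimp only
    rw [callRest_pair, ihφ n fl env s _ hO'.1 (by simp; omega) (by simp; omega)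
      fun x hx' => hx x (by simp [Formula.FV, hx']), Option.bind_some, ihψ n fl env s _ hO'.2
      (by simp; omega) (by simp; omega) fun x hx' => hx x (by simp [Formula.FV, hx']),
      Option.map_some, combine_one]
    simp [Formula.eval, add_comm]
  | cmp c φ ψ ihφ ihψ =>
    intro n fl env s r hO hn hN hx
    obtain ⟨n, rfl⟩ : ∃ m, n = m + 1 := ⟨n - 1, by omega⟩
    cases fl
    · exact absurd hO id
    obtain ⟨hc, hφ, hψ⟩ : c ∈ O ∧ φ.IsFO ∧ ψ.IsFO := hO
    have h1 := numCode_pos (K := K) (8 + c.code)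
    rw [Formula.tokens, hpair] at hn hN ⊢
    simp only [List.length_append] at hn hN
    rw [List.append_assoc, List.append_assoc, peval, header_cmp, evalCmp, decide_eq_true hc,
      Bool.and_true, cond_true, Sum.elim_inr]
    dsimp only
    rw [callRest_pair, ihφ n false env s _ hφ (by simp; omega) (by simp; omega)
      fun x hx' => hx x (by simp [Formula.FV, hx']), Option.bind_some, ihψ n false env s _ hψ
      (by simp; omega) (by simp; omega) fun x hx' => hx x (by simp [Formula.FV, hx']),
      Option.map_some, combine_cmp]
    rfl
  | ex x φ ih =>
    intro n fl env s r hO hn hN hx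
    obtain ⟨n, rfl⟩ : ∃ m, n = m + 1 := ⟨n - 1, by omega⟩
    have hO' : Fragment O fl φ := by cases fl <;> exact hO
    have h1 := numCode_pos (K := K) 6
    rw [Formula.tokens, tcode_cons, tcode_cons] at hn hN ⊢
    simp only [List.length_append] at hn hN
    rw [List.append_assoc, List.append_assoc, peval, header_six, evalQuant, readNum_code,
      Option.elim_some, Sum.elim_inr]
    dsimp only
    -- The calls run over indices; reindexing by the order isomorphism yields the sum over `A`.
    rw [← List.map_coe_finRange_eq_range, List.map_map, callRest_map
      (E := (fun i => (⟨x⟩, i) :: env) ∘ fun i : Fin A.card => (i : ℕ)) (G := fun i =>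
      φ.eval ord π (Function.update s x (A.orderIsoOfFin rfl i))) (r := r)
      (fun i _ => ih n fl _ _ r hO' (by simp; omega) (by simp; omega)
        fun y hy => lookD_update hd fun hyx => hx y (by simp [Formula.FV, hy, hyx])) [] ?_,
      combine_one, List.append_nil, List.sum_reverse, ← Fin.sum_univ_def, Formula.eval]
    · congr 2
      exact Equiv.sum_comp (A.orderIsoOfFin rfl).toEquiv
        fun a => φ.eval ord π (Function.update s x a)
    · rw [ne_eq, List.finRange_eq_nil_iff]; omega
  | all x φ ih =>
    intro n fl env s r hO hn hN hx
    obtain ⟨n, rfl⟩ : ∃ m, n = m + 1 := ⟨n - 1, by omega⟩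
    have hO' : Fragment O fl φ := by cases fl <;> exact hO
    have h1 := numCode_pos (K := K) 7
    rw [Formula.tokens, tcode_cons, tcode_cons] at hn hN ⊢
    simp only [List.length_append] at hn hN
    rw [List.append_assoc, List.append_assoc, peval, header_seven, evalQuant, readNum_code,
      Option.elim_some, Sum.elim_inr]
    dsimp only
    rw [← List.map_coe_finRange_eq_range, List.map_map, callRest_map
      (E := (fun i => (⟨x⟩, i) :: env) ∘ fun i : Fin A.card => (i : ℕ)) (G := fun i =>
      φ.eval ord π (Function.update s x (A.orderIsoOfFin rfl i))) (r := r)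
      (fun i _ => ih n fl _ _ r hO' (by simp; omega) (by simp; omega)
        fun y hy => lookD_update hd fun hyx => hx y (by simp [Formula.FV, hy, hyx])) [] ?_,
      combine_zero, List.append_nil, List.prod_reverse, ← Fin.prod_univ_def, Formula.eval]
    · congr 2
      exact Equiv.prod_comp (A.orderIsoOfFin rfl).toEquiv
        fun a => φ.eval ord π (Function.update s x a)
    · rw [ne_eq, List.finRange_eq_nil_iff]; omega

/-- If the evaluator succeeds, then its input begins with a formula. -/
theorem exists_of_peval {c : ℕ} {tab : List (List K × List K)} {dflt : Bool} (hc : 0 < c)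
    (hars : Arities N τ ars) (hnum : τ.num ≤ N) : ∀ (n : ℕ) (fl : Bool) (env : Env) (w r : List K)
    (v : K), w.length < N → peval ord O (N, c, ars, tab, dflt) n fl env w = some (v, r) →
    ∃ φ : Formula τ, Fragment O fl φ ∧ w = tcode K φ.tokens ++ r ∧
      ∀ x ∈ φ.FV, lookD dflt env ⟨x⟩ ≠ none := by
  have hEq : ∀ (neg : Bool) (env : Env) (w r : List K) (v : K),
      evalEq (N, c, ars, tab, dflt) neg env w = some (v, r) → ∃ x y : ℕ,
      w = tcode K [x, y] ++ r ∧ lookD dflt env ⟨x⟩ ≠ none ∧ lookD dflt env ⟨y⟩ ≠ none := by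
    intro neg env w r v h
    simp only [evalEq, Option.bind_eq_some_iff, Option.map_eq_some_iff, Prod.exists,
      Prod.mk.injEq] at h
    obtain ⟨⟨x⟩, r₁, h₁, ⟨y⟩, r₂, h₂, i, hi, j, hj, -, rfl⟩ := h
    have h₁ := (parses_readNum _ _ _).1 h₁
    have h₂ := (parses_readNum _ _ _).1 h₂
    exact ⟨x, y, by simp [h₁, h₂, tcode], by simp [hi], by simp [hj]⟩
  have hRel : ∀ (neg : Bool) (env : Env) (w r : List K) (v : K), w.length < N →
      evalRel (N, c, ars, tab, dflt) neg env w = some (v, r) → ∃ (R : Fin τ.num)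
      (x : Fin (τ.ar R) → ℕ), w = tcode K ((R : ℕ) :: List.ofFn x) ++ r ∧
        ∀ i, lookD dflt env ⟨x i⟩ ≠ none := by
    intro neg env w r v hw h
    simp only [evalRel, Option.bind_eq_some_iff, Option.map_eq_some_iff, Prod.exists,
      Prod.mk.injEq] at h
    obtain ⟨⟨R⟩, r₁, h₁, k, hk, l, r₂, h₂, m, hm, -, rfl⟩ := h
    have h₁ := (parses_readNum _ _ _).1 h₁
    dsimp only at h₁
    rw [readNums_eq_some] at h₂
    obtain ⟨rfl, h₂⟩ := h₂
    have hlen := length_le_tcode (K := K) (l.map Num.val)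
    rw [h₁, h₂] at hw
    simp only [List.length_append, List.length_map] at hw hlen
    -- A number below `τ.num ≤ N` was not cut off, and neither was an arity that is matched by fewer
    -- than `N` arguments.
    have hR : ncap N ⟨R⟩ < τ.num := by
      rw [← hars.1]
      exact (List.getElem?_eq_some_iff.1 hk).1
    have hcap : ncap N ⟨R⟩ = R := by
      have : ncap N ⟨R⟩ = min N R := rfl
      omega
    rw [hcap] at hR hk
    have hk' := hars.2 ⟨R, hR⟩
    dsimp only at hk'
    rw [hk', Option.some.injEq] at hk
    have hlen' : l.length = τ.ar ⟨R, hR⟩ := by omega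
    refine ⟨⟨R, hR⟩, fun i => (l[(i : ℕ)]'(by omega)).val, ?_, fun i => ?_⟩
    · have : List.ofFn (fun i : Fin (τ.ar ⟨R, hR⟩) => (l[(i : ℕ)]'(by omega)).val) =
          l.map Num.val := by
        refine List.ext_getElem (by simp [hlen']) fun i h1 h2 => by simp
      rw [this, h₁, h₂, tcode_cons, List.append_assoc]
    · rw [seqOpt_eq_some] at hm
      have h3 := congrArg (fun L => L[(i : ℕ)]?) hm
      have h4 : (i : ℕ) < l.length := by omega
      rw [List.getElem?_map, List.getElem?_eq_getElem h4, List.getElem?_map, Option.map_some] at h3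
      intro h5
      have h6 : lookD dflt env l[(i : ℕ)] = none := h5
      rw [h6] at h3
      rcases m[(i : ℕ)]? with _ | a <;> simp at h3
  intro n
  induction n with
  | zero => intro fl env w r v _ h; simp [peval] at h
  | succ n ih =>
    intro fl env w r v hw h
    rcases hr : readNum w with _ | ⟨⟨t⟩, w₁⟩
    · rw [peval, header, hr] at h
      simp at h
    have hr := (parses_readNum _ _ _).1 hr
    dsimp only at hr
    subst hr
    have hpos := numCode_pos (K := K) t
    rw [List.length_append] at hw
    have hPair : ∀ (op : ℕ) (fl' : Bool), callRest ord (peval ord O (N, c, ars, tab, dflt) n) op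
        fl' false w₁ [env, env] [] w₁ = some (v, r) → ∃ φ ψ : Formula τ, Fragment O fl' φ ∧
        Fragment O fl' ψ ∧ w₁ = tcode K (φ.tokens ++ ψ.tokens) ++ r ∧
        ∀ x ∈ φ.FV ∪ ψ.FV, lookD dflt env ⟨x⟩ ≠ none := by
      intro op fl' h
      rw [callRest_pair] at h
      simp only [Option.bind_eq_some_iff, Option.map_eq_some_iff, Prod.exists,
        Prod.mk.injEq] at h
      obtain ⟨a, r₁, h₁, b, r₂, h₂, -, rfl⟩ := h
      obtain ⟨φ, h3, rfl, h5⟩ := ih fl' env w₁ r₁ a (by omega) h₁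
      rw [List.length_append] at hw
      obtain ⟨ψ, h6, rfl, h8⟩ := ih fl' env r₁ r₂ b (by omega) h₂
      refine ⟨φ, ψ, h3, h6, by rw [tcode_append, List.append_assoc], fun x hx => ?_⟩
      rcases Finset.mem_union.1 hx with hx | hx
      exacts [h5 x hx, h8 x hx]
    have hQuant : ∀ (op : ℕ) , Sum.elim (fun o => o) (fun s : Call K =>
        callRest ord (peval ord O (N, c, ars, tab, dflt) n) s.1 s.2.1 s.2.2.1 s.2.2.2.2 s.2.2.2.1 []
          s.2.2.2.2) (evalQuant (N, c, ars, tab, dflt) op fl env w₁) = some (v, r) →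
        ∃ (x : ℕ) (φ : Formula τ), Fragment O fl φ ∧ w₁ = tcode K (x :: φ.tokens) ++ r ∧
        ∀ y ∈ φ.FV.erase x, lookD dflt env ⟨y⟩ ≠ none := by
      intro op hq
      unfold evalQuant at hq
      rcases hr : readNum w₁ with _ | ⟨⟨x⟩, w₂⟩
      · simp [hr] at hq
      rw [hr, Option.elim_some, Sum.elim_inr] at hq
      have hr := (parses_readNum _ _ _).1 hr
      dsimp only at hr
      subst hr
      -- As `0 < c`, at least one instance was evaluated; all of them start at `w₂`, so one suffices
      -- to find the formula.
      obtain ⟨e, he, v', h'⟩ := callRest_true hq (by simp; omega)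
      rw [List.length_append] at hw
      obtain ⟨φ, h3, h4, h5⟩ := ih fl e w₂ r v' (by omega) h'
      refine ⟨x, φ, h3, by rw [h4, tcode_cons, List.append_assoc], fun y hy => ?_⟩
      rw [Finset.mem_erase] at hy
      have h6 := h5 y hy.2
      obtain ⟨i, -, rfl⟩ := List.mem_map.1 he
      cases dflt
      · have h7 : lookD false ((⟨x⟩, i) :: env) ⟨y⟩ = lookD false env ⟨y⟩ :=
          look_cons_of_ne (by simpa using fun h => hy.1 h.symm) _ _
        rwa [h7] at h6
      · exact h6
    have hCmp : ∀ cm : Cmp, t = 8 + cm.code → ∃ φ : Formula τ, Fragment O fl φ ∧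
        numCode K t ++ w₁ = tcode K φ.tokens ++ r ∧ ∀ x ∈ φ.FV, lookD dflt env ⟨x⟩ ≠ none := by
      rintro cm rfl
      rw [peval, header_cmp, evalCmp] at h
      cases hf : fl && decide (cm ∈ O)
      · simp [hf] at h
      · rw [hf] at h
        obtain ⟨rfl, hO⟩ : fl = true ∧ cm ∈ O := by simpa using hf
        obtain ⟨φ, ψ, h1, h2, rfl, h4⟩ := hPair _ _ h
        exact ⟨.cmp cm φ ψ, ⟨hO, h1, h2⟩, by simp [Formula.tokens, tcode_cons], h4⟩
    rcases Nat.lt_or_ge t 12 with ht | ht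
    · have hcase : t = 0 ∨ t = 1 ∨ t = 2 ∨ t = 3 ∨ t = 4 ∨ t = 5 ∨ t = 6 ∨ t = 7 ∨
          ∃ cm : Cmp, t = 8 + cm.code := by
        rcases Nat.lt_or_ge t 8 with ht' | ht'
        · omega
        · obtain rfl | rfl | rfl | rfl : t = 8 ∨ t = 9 ∨ t = 10 ∨ t = 11 := by omega
          · exact .inr (.inr (.inr (.inr (.inr (.inr (.inr (.inr ⟨.eq, rfl⟩)))))))
          · exact .inr (.inr (.inr (.inr (.inr (.inr (.inr (.inr ⟨.ne, rfl⟩)))))))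
          · exact .inr (.inr (.inr (.inr (.inr (.inr (.inr (.inr ⟨.le, rfl⟩)))))))
          · exact .inr (.inr (.inr (.inr (.inr (.inr (.inr (.inr ⟨.nle, rfl⟩)))))))
      rcases hcase with rfl | rfl | rfl | rfl | rfl | rfl | rfl | rfl | ⟨cm, hcm⟩
      · rw [peval, header_zero] at h
        obtain ⟨x, y, rfl, hx, hy⟩ := hEq _ _ _ _ _ h
        exact ⟨.eq x y, by cases fl <;> trivial, by simp [Formula.tokens, tcode_cons],
          by simp [Formula.FV, hx, hy]⟩
      · rw [peval, header_one] at h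
        obtain ⟨x, y, rfl, hx, hy⟩ := hEq _ _ _ _ _ h
        exact ⟨.ne x y, by cases fl <;> trivial, by simp [Formula.tokens, tcode_cons],
          by simp [Formula.FV, hx, hy]⟩
      · rw [peval, header_two] at h
        obtain ⟨R, x, rfl, hx⟩ := hRel _ _ _ _ _ (by omega) h
        exact ⟨.rel R x, by cases fl <;> trivial, by simp [Formula.tokens, tcode_cons],
          by simpa [Formula.FV] using hx⟩
      · rw [peval, header_three] at h
        obtain ⟨R, x, rfl, hx⟩ := hRel _ _ _ _ _ (by omega) h
        exact ⟨.nrel R x, by cases fl <;> trivial, by simp [Formula.tokens, tcode_cons],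
          by simpa [Formula.FV] using hx⟩
      · rw [peval, header_four] at h
        obtain ⟨φ, ψ, h1, h2, rfl, h4⟩ := hPair _ _ h
        exact ⟨.and φ ψ, by cases fl <;> exact ⟨h1, h2⟩, by simp [Formula.tokens, tcode_cons], h4⟩
      · rw [peval, header_five] at h
        obtain ⟨φ, ψ, h1, h2, rfl, h4⟩ := hPair _ _ h
        exact ⟨.or φ ψ, by cases fl <;> exact ⟨h1, h2⟩, by simp [Formula.tokens, tcode_cons], h4⟩
      · rw [peval, header_six] at h
        obtain ⟨x, φ, h1, rfl, h3⟩ := hQuant _ h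
        exact ⟨.ex x φ, by cases fl <;> exact h1, by simp [Formula.tokens, tcode_cons], h3⟩
      · rw [peval, header_seven] at h
        obtain ⟨x, φ, h1, rfl, h3⟩ := hQuant _ h
        exact ⟨.all x φ, by cases fl <;> exact h1, by simp [Formula.tokens, tcode_cons], h3⟩
      · exact hCmp cm hcm
    · rw [peval, header_large _ _ _ _ ht] at h
      simp at h

end Evaluation

/-! ### Correctness of the reader of interpretations -/

section Interpretations

/-- The position of a tuple of indices below `c` in the lexicographic order. -/
def lexRank (c : ℕ) : List ℕ → ℕ
  | [] => 0
  | i :: l => i * c ^ l.length + lexRank c l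

/-- Horner's scheme may be cut off at every step because `r * c + i ≥ r` for `c ≥ 1`. -/
theorem rank_eq {N c : ℕ} (hc : 0 < c) (l : List ℕ) : rank N c l = min N (lexRank c l) := by
  have h : ∀ a, l.foldl (fun r i => min N (r * c + i)) (min N a) =
      min N (a * c ^ l.length + lexRank c l) := by
    induction l with
    | nil => intro a; simp [lexRank]
    | cons i l ih =>
      intro a
      have h1 : min N (min N a * c + i) = min N (a * c + i) := by
        rcases Nat.le_total N a with h | h
        · have h2 : N * 1 ≤ N * c := Nat.mul_le_mul_left _ hc
          have h3 : N * c ≤ a * c := Nat.mul_le_mul_right _ h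
          rw [min_eq_left h]
          omega
        · rw [min_eq_right h]
      rw [List.foldl_cons, h1, ih, lexRank, List.length_cons]
      congr 1
      ring
  simpa [rank] using h 0

theorem cpow_eq {N c : ℕ} (hN : 0 < N) (hc : 0 < c) (k : ℕ) : cpow N c k = min N (c ^ k) := by
  induction k with
  | zero => simp [cpow]; omega
  | succ k ih =>
    unfold cpow at ih ⊢
    rw [Function.iterate_succ_apply', ih, pow_succ]
    rcases Nat.le_total N (c ^ k) with h | h
    · have h2 : N * 1 ≤ N * c := Nat.mul_le_mul_left _ hc
      have h3 : N * c ≤ c ^ k * c := Nat.mul_le_mul_right _ h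
      rw [min_eq_left h]
      omega
    · rw [min_eq_right h]

/-- For `c ≥ 2` and `N ≤ k` both powers are at least `N`, as `c ^ N > N`; for `c = 1` the exponent
is irrelevant. The latter case matters: over a one-element universe, a short input may declare
arities of exponential size. -/
theorem min_pow_min {N c : ℕ} (hc : 0 < c) (k : ℕ) : min N (c ^ min N k) = min N (c ^ k) := by
  rcases Nat.le_total k N with h | h
  · rw [min_eq_right h]
  · rw [min_eq_left h]
    rcases Nat.lt_or_ge 1 c with hc' | hc'
    · have h1 := Nat.lt_pow_self (n := N) hc'
      have h2 := Nat.pow_le_pow_right hc h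
      omega
    · obtain rfl : c = 1 := by omega
      simp

theorem range_mul (c m : ℕ) :
    List.range (c * m) = (List.range c).flatMap fun i => (List.range m).map fun j => i * m + j := by
  induction c with
  | zero => simp
  | succ c ih => rw [Nat.succ_mul, List.range_add, ih, List.range_succ, List.flatMap_append]; simp

variable {A : Finset ℕ}

theorem map_idx_sortedElems : (sortedElems A).map idx = List.range A.card := by
  unfold sortedElems
  rw [List.map_ofFn]
  refine List.ext_getElem (by simp) fun i h1 h2 => ?_
  simp [idx_orderIso]

/-- The position of a tuple of elements of a finite set in the lexicographic order. -/
def tupleRank {k : ℕ} (t : Fin k → A) : ℕ := lexRank A.card (List.ofFn fun i => idx (t i))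

/-- The enumeration lists the tuples by increasing rank, so the rank of a tuple is its position in
the encoding. -/
theorem map_tupleRank (k : ℕ) :
    (tuples (sortedElems A) k).map tupleRank = List.range (A.card ^ k) := by
  induction k with
  | zero => simp [tuples, tupleRank, lexRank]
  | succ k ih =>
    rw [pow_succ', range_mul, ← map_idx_sortedElems, List.flatMap_map, tuples, List.map_flatMap]
    congr 1
    funext a
    rw [← ih, List.map_map, List.map_map]
    refine List.map_congr_left fun t _ => ?_
    simp [tupleRank, lexRank, List.ofFn_succ]

theorem length_tuples (k : ℕ) : (tuples (sortedElems A) k).length = A.card ^ k := by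
  rw [← List.length_map (f := tupleRank), map_tupleRank, List.length_range]

theorem mem_sortedElems (a : A) : a ∈ sortedElems A := by
  rw [sortedElems, List.mem_ofFn]
  exact (A.orderIsoOfFin rfl).surjective a

theorem mem_tuples {k : ℕ} (t : Fin k → A) : t ∈ tuples (sortedElems A) k := by
  induction k with
  | zero => rw [tuples, List.mem_singleton]; exact Subsingleton.elim _ _
  | succ k ih =>
    rw [tuples, List.mem_flatMap]
    exact ⟨t 0, mem_sortedElems _, List.mem_map.2 ⟨Fin.tail t, ih _, Fin.cons_self_tail t⟩⟩

theorem tuples_getElem? {k : ℕ} (t : Fin k → A) :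
    (tuples (sortedElems A) k)[tupleRank t]? = some t := by
  obtain ⟨i, hi, h⟩ := List.getElem_of_mem (mem_tuples t)
  have h1 := congrArg (fun l => l[i]?) (map_tupleRank (A := A) k)
  have h2 : i < A.card ^ k := by rwa [← length_tuples]
  simp only [List.getElem?_map, List.getElem?_eq_getElem hi, h, Option.map_some,
    List.getElem?_range h2, Option.some.injEq] at h1
  rw [h1, List.getElem?_eq_getElem hi, h]

variable {K : Type*} [CommSemiring K] [Nontrivial K]

/-- The lists that can be the list of the values of the literals with a given sign and a symbol of
arity `k`. -/
def IsBlock (c k : ℕ) (p : List K) : Prop :=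
  if k = 0 then p.length = c ∧ allSame p = true else p.length = c ^ k

/-- The list of the values of a function on tuples. -/
def block (A : Finset ℕ) (k : ℕ) (g : (Fin k → A) → K) : List K :=
  ((tuples (sortedElems A) k).map g).flatMap fun v =>
    if k = 0 then List.replicate A.card v else [v]

theorem block_zero (g : (Fin 0 → A) → K) :
    block A 0 g = List.replicate A.card (g Fin.elim0) := by
  simp [block, tuples]

theorem block_of_ne {k : ℕ} (hk : k ≠ 0) (g : (Fin k → A) → K) :
    block A k g = (tuples (sortedElems A) k).map g := by
  simp [block, hk]

theorem allSame_iff {p : List K} : allSame p = true ↔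
    p = List.replicate p.length (p[0]?.elim 0 id) := by
  rw [List.eq_replicate_iff, allSame, List.all_eq_true]
  rcases p with _ | ⟨a, p⟩
  · simp
  · simp [keq, eq_comm]

theorem isBlock_block (k : ℕ) (g : (Fin k → A) → K) : IsBlock A.card k (block A k g) := by
  unfold IsBlock
  split_ifs with h
  · subst h
    rw [block_zero, allSame_iff, List.length_replicate]
    refine ⟨rfl, ?_⟩
    rcases Nat.eq_zero_or_pos A.card with h | h
    · simp [h]
    · simp [List.getElem?_replicate, h]
  · rw [block_of_ne h, List.length_map, length_tuples]

theorem block_getElem? {k : ℕ} (hA : 0 < A.card) (g : (Fin k → A) → K) (t : Fin k → A) :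
    (block A k g)[tupleRank t]? = some (g t) := by
  rcases Nat.eq_zero_or_pos k with rfl | hk
  · rw [block_zero, show tupleRank t = 0 by simp [tupleRank, lexRank], List.getElem?_replicate,
      if_pos hA]
    exact congrArg some (congrArg g (Subsingleton.elim _ _))
  · rw [block_of_ne hk.ne', List.getElem?_map, tuples_getElem?, Option.map_some]

/-- Every list of the right shape is the value list of the function that looks up ranks. For arity
`0` this uses that all copies agree. -/
theorem IsBlock.block_eq {k : ℕ} {p : List K} (hp : IsBlock A.card k p) :
    block A k (fun t => p[tupleRank t]?.elim 0 id) = p := by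
  unfold IsBlock at hp
  split_ifs at hp with h
  · subst h
    obtain ⟨h1, h2⟩ := hp
    rw [block_zero, ← h1]
    exact (allSame_iff.1 h2).symm
  · rw [block_of_ne h]
    have : (fun t : Fin k → A => p[tupleRank t]?.elim 0 id) =
      (fun i => p[i]?.elim 0 id) ∘ tupleRank := rfl
    rw [this, ← List.map_map, map_tupleRank]
    refine List.ext_getElem (by simp [hp]) fun i h1 h2 => ?_
    simp [h2]

theorem take_drop_eq {α : Type*} {n : ℕ} {w p r : List α} (hn : n ≤ w.length) :
    (w.take n = p ∧ w.drop n = r) ↔ w = p ++ r ∧ p.length = n := by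
  constructor
  · rintro ⟨rfl, rfl⟩
    simp [hn]
  · rintro ⟨rfl, rfl⟩
    simp

theorem readBlock_eq_some {N c k : ℕ} (hc : 0 < c) {w p r : List K} (hw : w.length < N) :
    readBlock N c (min N k) w = some (p, r) ↔ w = p ++ r ∧ IsBlock c k p := by
  have hN : 0 < N := by omega
  unfold readBlock IsBlock
  rcases Nat.eq_zero_or_pos k with rfl | hk
  · rw [Nat.min_zero, if_pos rfl]
    rcases Nat.lt_or_ge w.length c with h | h
    · simp only [decide_true, cond_true, h, reduceCtorEq, false_iff, not_and]
      rintro rfl h1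
      rw [List.length_append] at h
      omega
    · simp only [decide_true, cond_true, not_lt.2 h, decide_false, cond_false]
      rw [← and_assoc, ← take_drop_eq h]
      cases h1 : allSame (w.take c)
      · simp only [cond_false, reduceCtorEq, false_iff, not_and]
        rintro ⟨rfl, -⟩
        simp [h1]
      · simp only [cond_true, Option.some.injEq, Prod.mk.injEq]
        constructor
        · rintro ⟨rfl, rfl⟩; exact ⟨⟨rfl, rfl⟩, h1⟩
        · rintro ⟨h, -⟩; exact h
  · rw [if_neg hk.ne', cpow_eq hN hc, min_pow_min hc]
    have : min N k ≠ 0 := by omega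
    rw [decide_eq_false this, cond_false]
    rcases Nat.lt_or_ge w.length (c ^ k) with h | h
    · simp only [lt_min_iff, hw, h, and_self, decide_true, cond_true, reduceCtorEq, false_iff,
        not_and]
      rintro rfl h1
      rw [List.length_append] at h
      omega
    · rw [min_eq_right (h.trans hw.le), ← take_drop_eq h]
      simp [not_lt.2 h]

theorem readEntry_eq_some {N c k : ℕ} (hc : 0 < c) {w r : List K} {p : List K × List K}
    (hw : w.length < N) : readEntry N c (min N k) w = some (p, r) ↔
      w = p.1 ++ p.2 ++ r ∧ IsBlock c k p.1 ∧ IsBlock c k p.2 := by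
  unfold readEntry
  obtain ⟨p, q⟩ := p
  simp only [Option.bind_eq_some_iff, Option.map_eq_some_iff, Prod.exists, Prod.mk.injEq]
  constructor
  · rintro ⟨a, r₁, h1, b, r₂, h2, ⟨rfl, rfl⟩, rfl⟩
    rw [readBlock_eq_some hc hw] at h1
    obtain ⟨rfl, h1⟩ := h1
    rw [List.length_append] at hw
    rw [readBlock_eq_some hc (by omega)] at h2
    obtain ⟨rfl, h2⟩ := h2
    exact ⟨by simp, h1, h2⟩
  · rintro ⟨rfl, h1, h2⟩
    refine ⟨p, q ++ r, (readBlock_eq_some hc hw).2 ⟨by simp, h1⟩, q, r,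
      (readBlock_eq_some hc ?_).2 ⟨rfl, h2⟩, ⟨rfl, rfl⟩, rfl⟩
    rw [List.append_assoc, List.length_append] at hw
    omega

theorem readTable_iff {N c : ℕ} (hc : 0 < c) {ι : Type*} (ar : ι → ℕ) {L : List ι}
    {w r : List K} {tab : List (List K × List K)} (hw : w.length < N) :
    readTable N c (L.map fun R => min N (ar R)) w = some (tab, r) ↔
      List.Forall₂ (fun R e => IsBlock c (ar R) e.1 ∧ IsBlock c (ar R) e.2) L tab ∧
      w = tab.flatMap (fun e => e.1 ++ e.2) ++ r := by
  unfold readTable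
  induction L generalizing w tab with
  | nil =>
    simp only [List.map_nil, readEach, Option.some.injEq, Prod.mk.injEq, List.forall₂_nil_left_iff]
    constructor
    · rintro ⟨rfl, rfl⟩; simp
    · rintro ⟨rfl, rfl⟩; simp
  | cons R L ih =>
    simp only [List.map_cons, readEach, Option.bind_eq_some_iff, Option.map_eq_some_iff,
      Prod.exists, Prod.mk.injEq, List.forall₂_cons_left_iff]
    constructor
    · rintro ⟨p, q, r₁, h1, tab, r₂, h2, rfl, rfl⟩
      rw [readEntry_eq_some hc hw] at h1
      obtain ⟨rfl, h1⟩ := h1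
      rw [ih (by simp only [List.length_append] at hw; omega)] at h2
      exact ⟨⟨_, _, _, h1, h2.1, rfl⟩, by simp [h2.2]⟩
    · rintro ⟨⟨p, q, tab, h1, h2, rfl⟩, rfl⟩
      refine ⟨p, q, tab.flatMap (fun e => e.1 ++ e.2) ++ r,
        (readEntry_eq_some hc hw).2 ⟨by simp, h1⟩, tab, r, (ih ?_).2 ⟨h2, rfl⟩, rfl, rfl⟩
      simp only [List.flatMap_cons, List.length_append] at hw ⊢
      omega

variable {τ : Vocabulary}

/-- The table of the values of all literals. -/
def interpTable (π : Lit τ A → K) : List (List K × List K) :=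
  (List.finRange τ.num).map fun R => (encLits π R false, encLits π R true)

theorem encLits_eq (π : Lit τ A → K) (R : Fin τ.num) (neg : Bool) :
    encLits π R neg = block A (τ.ar R) fun t => π ⟨neg, R, t⟩ := rfl

theorem flatMap_interpTable (π : Lit τ A → K) :
    (interpTable π).flatMap (fun e => e.1 ++ e.2) = encInterp π := by
  rw [interpTable, List.flatMap_map]
  rfl

theorem readTable_eq_some {N : ℕ} (hA : 0 < A.card) {w : List K} {tab : List (List K × List K)}
    (hw : w.length < N) :
    readTable N A.card ((List.finRange τ.num).map fun R => min N (τ.ar R)) w = some (tab, []) ↔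
      ∃ π : Lit τ A → K, w = encInterp π ∧ tab = interpTable π := by
  rw [readTable_iff hA _ hw, List.append_nil]
  constructor
  · rintro ⟨h, rfl⟩
    have hlen : tab.length = τ.num := by rw [← h.length_eq, List.length_finRange]
    have hlt : ∀ R : Fin τ.num, (R : ℕ) < tab.length := fun R => hlen.symm ▸ R.2
    have hR : ∀ R : Fin τ.num, IsBlock A.card (τ.ar R) (tab[(R : ℕ)]'(hlt R)).1 ∧
        IsBlock A.card (τ.ar R) (tab[(R : ℕ)]'(hlt R)).2 := by
      intro R
      have := (List.forall₂_iff_get.1 h).2 R (by simp) (hlt R)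
      simpa using this
    -- The interpretation is recovered from the table: a literal gets the entry at the rank of its
    -- arguments.
    let π : Lit τ A → K := fun l =>
      (bif l.neg then (tab[(l.R : ℕ)]'(hlt l.R)).2
        else (tab[(l.R : ℕ)]'(hlt l.R)).1)[tupleRank l.args]?.elim 0 id
    have htab : tab = interpTable π := by
      refine List.ext_getElem (by simp [interpTable, hlen]) fun i h1 h2 => ?_
      have h3 := hR ⟨i, by rwa [← hlen]⟩
      have h4 : (List.finRange τ.num)[i]'(by simpa [hlen] using h1) = ⟨i, by rwa [← hlen]⟩ := by
        simp
      simp only [interpTable, List.getElem_map]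
      rw [h4]
      exact Prod.ext h3.1.block_eq.symm h3.2.block_eq.symm
    exact ⟨π, by rw [← flatMap_interpTable, ← htab], htab⟩
  · rintro ⟨π, rfl, rfl⟩
    refine ⟨?_, (flatMap_interpTable π).symm⟩
    rw [interpTable, List.forall₂_map_right_iff, List.forall₂_same]
    exact fun R _ => ⟨isBlock_block _ _, isBlock_block _ _⟩

/-- The rank is a position in a list shorter than `N`, so the cut-off in `rank` is not reached. -/
theorem tabVal_interpTable {N : ℕ} (hA : 0 < A.card) (ars : List ℕ) (dflt : Bool)
    (π : Lit τ A → K) (hw : (encInterp π).length < N) (neg : Bool) (R : Fin τ.num)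
    (t : Fin (τ.ar R) → A) :
    tabVal (N, A.card, ars, interpTable π, dflt) neg R (List.ofFn fun i => idx (t i)) =
      π ⟨neg, R, t⟩ := by
  have h1 := block_getElem? hA (fun t => π ⟨neg, R, t⟩) t
  rw [← encLits_eq] at h1
  have h2 : tupleRank t < (encLits π R neg).length := by
    by_contra h
    rw [List.getElem?_eq_none (not_lt.1 h)] at h1
    simp at h1
  have h3 : (encLits π R neg).length ≤ (encInterp π).length := by
    rw [encInterp]
    refine le_trans ?_ (List.Sublist.length_le (List.sublist_flatten_of_mem
      (List.mem_map_of_mem (List.mem_finRange R))))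
    cases neg <;> simp
  have h4 : (interpTable π)[(R : ℕ)]? = some (encLits π R false, encLits π R true) := by
    simp [interpTable]
  rw [tabVal, h4, rank_eq hA, Option.elim_some]
  have h5 : min N (lexRank A.card (List.ofFn fun i => idx (t i))) = tupleRank t :=
    min_eq_right (h2.le.trans (h3.trans hw.le))
  dsimp only
  rw [h5]
  cases neg <;> simp [h1]

end Interpretations

/-! ### Correctness of the decision procedure -/

section Decision

variable {K : Type*} [CommSemiring K] [Nontrivial K] {ord : Option (SemiringOrder K)}

/-- Each item takes at least one letter, so a list contained in `w` has fewer than `N` items.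
Reading with the cut-off count succeeds exactly if the true count is present. -/
theorem readCounted_iff {γ : Type*} {rd : List K → Option (γ × List K)} {code : γ → List K}
    (h : Parses rd code) (hpos : ∀ t, 0 < (code t).length) {N : ℕ} {w : List K}
    (hw : w.length < N) (f : List γ × List K → Bool) :
    ((readNum w).elim false fun m => (readMany rd (ncap N m.1) m.2).elim false f) = true ↔
      ∃ l r, w = numCode K l.length ++ (l.flatMap code ++ r) ∧ f (l, r) = true := by
  have hlen : ∀ l : List γ, l.length ≤ (l.flatMap code).length := by
    intro l
    induction l with
    | nil => simp
    | cons a l ih =>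
      have := hpos a
      rw [List.flatMap_cons, List.length_append, List.length_cons]
      omega
  constructor
  · intro h1
    rcases h2 : readNum w with _ | ⟨⟨m⟩, r₀⟩
    · simp [h2] at h1
    rw [h2, Option.elim_some] at h1
    dsimp only at h1
    rcases h3 : readMany rd (ncap N ⟨m⟩) r₀ with _ | ⟨l, r⟩
    · simp [h3] at h1
    rw [h3, Option.elim_some] at h1
    have h2 := (parses_readNum _ _ _).1 h2
    dsimp only at h2
    obtain ⟨h7, rfl⟩ := (readMany_eq_some h).1 h3
    have h4 := hlen l
    have h5 : m = l.length := by
      subst h2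
      simp only [List.length_append] at hw
      have h6 : l.length = min N m := h7
      omega
    exact ⟨l, r, by rw [h2, h5], h1⟩
  · rintro ⟨l, r, rfl, h1⟩
    have h4 := hlen l
    simp only [List.length_append] at hw
    have h5 : ncap N ⟨l.length⟩ = l.length := min_eq_right (show l.length ≤ N by omega)
    rw [readNum_code, Option.elim_some]
    dsimp only
    rw [h5, (readMany_eq_some h).2 ⟨rfl, rfl⟩, Option.elim_some, h1]

theorem readNums_iff {N : ℕ} {w : List K} (hw : w.length < N) (f : List Num × List K → Bool) :
    ((readNum w).elim false fun m => (readMany readNum (ncap N m.1) m.2).elim false f) = true ↔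
      ∃ l r, w = tcode K (l.length :: l.map Num.val) ++ r ∧ f (l, r) = true := by
  rw [readCounted_iff parses_readNum (fun _ => numCode_pos _) hw]
  simp only [tcode, List.flatMap_cons, List.flatMap_map, List.append_assoc]

/-- The list of the arities of a vocabulary, cut off at `N`. -/
def cappedArities (N : ℕ) (τ : Vocabulary) : List ℕ :=
  (List.finRange τ.num).map fun R => min N (τ.ar R)

theorem arities_cappedArities (N : ℕ) (τ : Vocabulary) : Arities N τ (cappedArities N τ) :=
  ⟨by simp [cappedArities], fun R => by simp [cappedArities]⟩

variable {O : Set Cmp}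

theorem decideMC_iff_exists {w : List K} : decideMC ord O w = true ↔
    ∃ (τ : Vocabulary) (r : List K), w = tcode K τ.tokens ++ r ∧
      decideUniverse ord O (w.length + 1) (cappedArities (w.length + 1) τ) r = true := by
  rw [decideMC, readNums_iff (Nat.lt_succ_self _)]
  constructor
  · rintro ⟨l, r, h1, h2⟩
    refine ⟨⟨l.length, fun i => (l[(i : ℕ)]).val⟩, r, ?_, ?_⟩
    · rw [Vocabulary.tokens]
      convert h1 using 4
      exact List.ext_getElem (by simp) fun i h1 h2 => by simp
    · rw [← h2]
      congr 1
      exact List.ext_getElem (by simp [cappedArities]) fun i h1 h2 => by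
        simp [cappedArities, ncap]
  · rintro ⟨τ, r, h1, h2⟩
    refine ⟨List.ofFn fun R => ⟨τ.ar R⟩, r, ?_, ?_⟩
    · rw [Vocabulary.tokens] at h1
      rw [List.length_ofFn, List.map_ofFn]
      exact h1
    · rw [← h2]
      dsimp only
      congr 1
      exact List.ext_getElem (by simp [cappedArities]) fun i h1 h2 => by
        simp [cappedArities, ncap]

/-- The elements of a finite set in increasing order. -/
def setList (A : Finset ℕ) : List Num := (sortedElems A).map fun a => ⟨a.1⟩

theorem length_setList (A : Finset ℕ) : (setList A).length = A.card := by
  simp [setList, sortedElems]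

theorem map_val_sortedElems (A : Finset ℕ) :
    (sortedElems A).map (fun a : A => a.1) = A.sort := by
  rw [sortedElems, List.map_ofFn]
  refine List.ext_getElem (by simp) fun i h1 h2 => ?_
  simp only [List.getElem_ofFn, Function.comp_apply, Finset.coe_orderIsoOfFin_apply,
    Finset.orderEmbOfFin_apply]
  rfl

theorem increasing_iff {l : List Num} : increasing l = true ↔ ∃ A, l = setList A := by
  have h : increasing l = true ↔ (l.map Num.val).SortedLT := by
    rw [List.sortedLT_iff_pairwise, ← List.isChain_iff_pairwise, List.isChain_iff_getElem,
      increasing, List.all_eq_true]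
    simp only [List.mem_range, List.length_map, List.getElem_map]
    constructor
    · intro h i hi
      have := h i (by omega)
      rw [List.getElem?_eq_getElem (by omega), List.getElem?_eq_getElem hi] at this
      simpa using this
    · intro h i hi
      rw [List.getElem?_eq_getElem hi, Option.elim_some]
      rcases Nat.lt_or_ge (i + 1) l.length with h1 | h1
      · rw [List.getElem?_eq_getElem h1]
        simpa using h i h1
      · rw [List.getElem?_eq_none h1]
        rfl
  have hval : ∀ A, (setList A).map Num.val = A.sort := fun A => by
    rw [setList, List.map_map, ← map_val_sortedElems]
    rfl
  rw [h]
  constructor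
  · intro h1
    refine ⟨(l.map Num.val).toFinset, ?_⟩
    refine (List.map_injective_iff (f := Num.val)).2 (fun a b h => ?_) ?_
    · cases a; cases b; exact congrArg Num.mk h
    · rw [hval]
      exact ((List.toFinset_sort _ h1.nodup).2 h1.sortedLE.pairwise).symm
  · rintro ⟨A, rfl⟩
    rw [hval]
    exact A.sortedLT_sort

theorem decideUniverse_iff {N : ℕ} {ars : List ℕ} {w : List K} (hw : w.length < N) :
    decideUniverse ord O N ars w = true ↔
      ∃ (A : Finset ℕ) (r : List K), A.Nonempty ∧ w = tcode K (setTokens A) ++ r ∧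
        ((peval ord O (N, 1, ars, [], true) N true [] r).elim false fun x =>
          decideAssignment ord O N ars (setList A) r x.2) = true := by
  have hset : ∀ A : Finset ℕ,
      setTokens A = (setList A).length :: (setList A).map Num.val := fun A => by
    rw [length_setList, setList, List.map_map]
    rfl
  rw [decideUniverse, readNums_iff hw]
  constructor
  · rintro ⟨l, r, h1, h2⟩
    dsimp only at h2
    cases h3 : increasing l && decide (0 < l.length)
    · simp [h3] at h2
    rw [h3, cond_true] at h2
    rw [Bool.and_eq_true, decide_eq_true_eq] at h3
    obtain ⟨A, rfl⟩ := increasing_iff.1 h3.1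
    rw [← hset] at h1
    exact ⟨A, r, Finset.card_pos.1 (length_setList A ▸ h3.2), h1, h2⟩
  · rintro ⟨A, r, hA, h1, h2⟩
    rw [hset] at h1
    refine ⟨_, r, h1, ?_⟩
    dsimp only
    rw [increasing_iff.2 ⟨A, rfl⟩, length_setList, decide_eq_true hA.card_pos, Bool.and_true,
      cond_true, h2]

/-- This is `peval_code` for the universe `{0}` and the interpretation `0`: the empty table returns
`0` by default, and `dflt` replaces the assignment. -/
theorem peval_skip {τ : Vocabulary} {N : ℕ} (hnum : τ.num ≤ N) {φ : Formula τ}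
    (hφ : φ.InFO O) {r : List K} (hw : (tcode K φ.tokens ++ r).length < N) : ∃ v,
    peval ord O (N, 1, cappedArities N τ, [], true) N true [] (tcode K φ.tokens ++ r) =
      some (v, r) := by
  have h := peval_code (ord := ord) (O := O) (A := {0}) (π := fun _ : Lit τ {0} => (0 : K))
    (tab := []) (dflt := true) (by simp) (arities_cappedArities N τ) hnum (by simp)
    (fun neg R t => by simp [tabVal]) φ N true [] (fun _ => ⟨0, by simp⟩) r hφ hw hw
    fun x _ => by
      have := idx_lt (A := {0}) ⟨0, by simp⟩
      rw [Finset.card_singleton] at this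
      simp only [lookD, cond_true, Option.some.injEq]
      omega
  exact ⟨_, h⟩

theorem peval_skip_iff {τ : Vocabulary} {N : ℕ} (hnum : τ.num ≤ N) {w : List K}
    (hw : w.length < N) (f : List K → Bool) :
    ((peval ord O (N, 1, cappedArities N τ, [], true) N true [] w).elim false
      fun x => f x.2) = true ↔
      ∃ (φ : Formula τ) (r : List K), φ.InFO O ∧ w = tcode K φ.tokens ++ r ∧ f r = true := by
  constructor
  · intro h
    rcases h1 : peval ord O (N, 1, cappedArities N τ, [], true) N true [] w with _ | ⟨v, r⟩
    · simp [h1] at h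
    rw [h1] at h
    obtain ⟨φ, h2, h3, -⟩ := exists_of_peval one_pos (arities_cappedArities N τ) hnum N true [] w
      r v hw h1
    exact ⟨φ, r, h2, h3, h⟩
  · rintro ⟨φ, r, h1, rfl, h2⟩
    obtain ⟨v, hv⟩ := peval_skip (ord := ord) hnum h1 hw
    rw [hv]
    exact h2

/-- Unique readability comes for free: the evaluator is a function, and by `peval_skip` it returns
the remainder of either reading of the same word. The order plays no role, hence `none`. -/
theorem tokens_append_cancel {τ : Vocabulary} {φ ψ : Formula τ} (hφ : φ.InFO O) (hψ : ψ.InFO O)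
    {r r' : List K} (h : tcode K φ.tokens ++ r = tcode K ψ.tokens ++ r') : r = r' := by
  set N := τ.num + (tcode K φ.tokens ++ r).length + 1 with hN
  obtain ⟨v, h1⟩ := peval_skip (ord := none) (N := N) (r := r) (by omega) hφ (by omega)
  obtain ⟨v', h2⟩ := peval_skip (ord := none) (N := N) (r := r') (by omega) hψ (by
    rw [← h]; omega)
  rw [h, h2, Option.some.injEq, Prod.mk.injEq] at h1
  exact h1.2.symm

theorem indexIn_some {l : List Num} {x : Num} {i : ℕ} (h : indexIn l x = some i) :
    l[i]? = some x := by
  induction l generalizing i with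
  | nil => simp [indexIn] at h
  | cons a l ih =>
    rw [indexIn] at h
    by_cases hax : a = x
    · simp only [hax, decide_true, cond_true, Option.some.injEq] at h
      subst h
      simp [hax]
    · simp only [hax, decide_false, cond_false, Option.map_eq_some_iff] at h
      obtain ⟨j, hj, rfl⟩ := h
      simpa using ih hj

theorem indexIn_of_getElem? {l : List Num} (hl : l.Nodup) {x : Num} {i : ℕ}
    (h : l[i]? = some x) : indexIn l x = some i := by
  induction l generalizing i with
  | nil => simp at h
  | cons a l ih =>
    rw [List.nodup_cons] at hl
    rw [indexIn]
    rcases i with _ | i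
    · have : a = x := by simpa using h
      simp [this]
    · rw [List.getElem?_cons_succ] at h
      have : a ≠ x := by
        rintro rfl
        exact hl.1 (List.mem_of_getElem? h)
      simp [this, ih hl.2 h]

theorem nodup_sortedElems (A : Finset ℕ) : (sortedElems A).Nodup :=
  List.nodup_ofFn.2 (A.orderIsoOfFin rfl).injective

theorem sortedElems_getElem? {A : Finset ℕ} (a : A) : (sortedElems A)[idx a]? = some a := by
  rw [sortedElems, List.getElem?_ofFn, dif_pos (idx_lt a)]
  simp [idx]

theorem indexIn_setList {A : Finset ℕ} (a : A) : indexIn (setList A) ⟨a.1⟩ = some (idx a) := by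
  refine indexIn_of_getElem? ((nodup_sortedElems A).map fun a b h => ?_) ?_
  · exact Subtype.ext (Num.mk.inj h)
  · rw [List.getElem?_map, sortedElems_getElem?, Option.map_some]

/-- An assignment as a list of pairs. -/
def pairList {A : Finset ℕ} (s : Assignment A) : List (Num × Num) :=
  (sortedElems s.dom).map fun x => (⟨x.1⟩, ⟨(s.val x).1⟩)

/-- An assignment as a list of pairs that consist of a variable and the index of its value. -/
def assignmentEnv {A : Finset ℕ} (s : Assignment A) : Env :=
  (sortedElems s.dom).map fun x => (⟨x.1⟩, idx (s.val x))

theorem look_assignmentEnv {A : Finset ℕ} (s : Assignment A) (x : s.dom) :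
    look (assignmentEnv s) ⟨x.1⟩ = some (idx (s.val x)) := by
  have : ∀ L : List s.dom, x ∈ L →
      look (L.map fun x => (⟨x.1⟩, idx (s.val x))) ⟨x.1⟩ = some (idx (s.val x)) := by
    intro L hL
    induction L with
    | nil => simp at hL
    | cons y L ih =>
      rw [List.map_cons]
      by_cases hxy : x = y
      · subst hxy
        exact look_cons_self _ _ _
      · rw [look_cons_of_ne fun h => hxy (Subtype.ext (Num.mk.inj h).symm)]
        exact ih (by simpa [hxy] using hL)
  exact this _ (mem_sortedElems x)

theorem mem_dom_of_look {A : Finset ℕ} {s : Assignment A} {x : ℕ}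
    (h : look (assignmentEnv s) ⟨x⟩ ≠ none) : x ∈ s.dom := by
  by_contra hx
  refine h ?_
  have : ∀ L : List s.dom, look (L.map fun x => (⟨x.1⟩, idx (s.val x))) ⟨x⟩ = none := by
    intro L
    induction L with
    | nil => rfl
    | cons y L ih =>
      rw [List.map_cons, look_cons_of_ne fun h => hx ((show y.1 = x from Num.mk.inj h) ▸ y.2), ih]
  exact this _

theorem seqOpt_pairList {A : Finset ℕ} (s : Assignment A) :
    seqOpt ((pairList s).map fun y => (indexIn (setList A) y.2).map fun i => (y.1, i)) =
      some (assignmentEnv s) := by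
  rw [seqOpt_eq_some, pairList, assignmentEnv, List.map_map, List.map_map]
  refine List.map_congr_left fun x _ => ?_
  simp [indexIn_setList]

/-- Increasing variables are the elements of a domain `D`, and a value with an index in `setList A`
is an element of `A`. -/
theorem eq_pairList {A : Finset ℕ} {l : List (Num × Num)} {env : Env}
    (h1 : increasing (l.map fun y => y.1) = true)
    (h2 : seqOpt (l.map fun y => (indexIn (setList A) y.2).map fun i => (y.1, i)) = some env) :
    ∃ s : Assignment A, l = pairList s := by
  obtain ⟨D, hD⟩ := increasing_iff.1 h1
  rw [seqOpt_eq_some] at h2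
  have hmem : ∀ y ∈ l, ∃ a : A, y.2 = ⟨a.1⟩ := by
    intro y hy
    have h3 := List.mem_map_of_mem (f := fun y => (indexIn (setList A) y.2).map
      fun i => (y.1, i)) hy
    rw [h2, List.mem_map] at h3
    obtain ⟨e, -, he⟩ := h3
    obtain ⟨i, hi, -⟩ := Option.map_eq_some_iff.1 he.symm
    have h4 := List.mem_of_getElem? (indexIn_some hi)
    obtain ⟨a, -, ha⟩ := List.mem_map.1 h4
    exact ⟨a, ha.symm⟩
  have hlen : l.length = D.card := by
    rw [← length_setList, ← hD, List.length_map]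
  have hlt : ∀ x : D, idx x < l.length := fun x => hlen ▸ idx_lt x
  choose f hf using fun x : D => hmem (l[idx x]'(hlt x)) (List.getElem_mem _)
  refine ⟨⟨D, f⟩, List.ext_getElem ?_ fun i h3 h4 => ?_⟩
  · rw [hlen, pairList, List.length_map, ← length_setList, setList, List.length_map]
  · have h5 : i < D.card := hlen ▸ h3
    have h6 : idx ((sortedElems D)[i]'(by simpa [sortedElems] using h5)) = i := by
      simp [sortedElems, idx_orderIso (A := D) ⟨i, h5⟩]
    have h7 : (l.map fun y => y.1)[i]? = (setList D)[i]? := by rw [hD]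
    rw [List.getElem?_eq_getElem (by simpa using h3), List.getElem?_eq_getElem (by
      rwa [length_setList]), Option.some.injEq, List.getElem_map] at h7
    simp only [pairList, List.getElem_map]
    refine Prod.ext ?_ ?_
    · rw [h7]
      simp [setList]
    · rw [← hf]
      simp only [h6]

theorem tcode_assignment {A : Finset ℕ} (s : Assignment A) : tcode K s.tokens =
    numCode K (pairList s).length ++
      (pairList s).flatMap fun p => numCode K p.1.val ++ numCode K p.2.val := by
  have h : (pairList s).length = s.dom.card := by simp [pairList, sortedElems]
  rw [Assignment.tokens, tcode_cons, h, pairList, tcode, List.flatMap_assoc, List.flatMap_map]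
  simp

theorem decideAssignment_iff {N : ℕ} {ars : List ℕ} {A : Finset ℕ} {wf ws : List K}
    (hw : ws.length < N) : decideAssignment ord O N ars (setList A) wf ws = true ↔
      ∃ (s : Assignment A) (r : List K), ws = tcode K s.tokens ++ r ∧
        decideValue ord O N A.card ars (assignmentEnv s) wf r = true := by
  rw [decideAssignment, readCounted_iff parses_readPair (fun t => by
    rw [List.length_append]; exact Nat.add_pos_left (numCode_pos _) _) hw]
  constructor
  · rintro ⟨l, r, h1, h2⟩
    dsimp only at h2
    cases h3 : increasing (l.map fun y => y.1)
    · simp [h3] at h2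
    rw [h3, cond_true] at h2
    rcases h4 : seqOpt (l.map fun y => (indexIn (setList A) y.2).map fun i => (y.1, i)) with _ | e
    · simp [h4] at h2
    obtain ⟨s, rfl⟩ := eq_pairList h3 h4
    rw [seqOpt_pairList, Option.elim_some, length_setList] at h2
    exact ⟨s, r, by rw [h1, tcode_assignment, List.append_assoc], h2⟩
  · rintro ⟨s, r, rfl, h⟩
    refine ⟨pairList s, r, by rw [tcode_assignment, List.append_assoc], ?_⟩
    have h1 : (pairList s).map (fun y => y.1) = setList s.dom := by
      rw [pairList, List.map_map]
      rfl
    dsimp only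
    rw [h1, increasing_iff.2 ⟨_, rfl⟩, cond_true, seqOpt_pairList, Option.elim_some,
      length_setList, h]

/-- No separate check of the free variables is needed: over a nonempty universe each of them is
looked up during the evaluation, which fails if a value is missing. -/
theorem decideValue_iff {τ : Vocabulary} {N : ℕ} (hnum : τ.num ≤ N) {A : Finset ℕ} (a : A)
    (s : Assignment A) {wf wt : List K} (hwf : wf.length < N) (hwt : wt.length < N) :
    decideValue ord O N A.card (cappedArities N τ) (assignmentEnv s) wf wt = true ↔
      ∃ (φ : Formula τ) (r : List K) (π : Lit τ A → K), φ.InFO O ∧ wf = tcode K φ.tokens ++ r ∧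
        wt = encInterp π ∧ φ.FV ⊆ s.dom ∧ φ.eval ord π (s.extend a) ≠ 0 := by
  have hA : 0 < A.card := Finset.card_pos.2 ⟨a.1, a.2⟩
  have heval : ∀ (φ : Formula τ) (r : List K) (π : Lit τ A → K), φ.InFO O →
      (tcode K φ.tokens ++ r).length < N → (encInterp π).length < N → φ.FV ⊆ s.dom →
      peval ord O (N, A.card, cappedArities N τ, interpTable π, false) N true (assignmentEnv s)
        (tcode K φ.tokens ++ r) = some (φ.eval ord π (s.extend a), r) := by
    intro φ r π hφ h1 h2 h3
    refine peval_code hA (arities_cappedArities N τ) hnum (by simp)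
      (fun neg R t => tabVal_interpTable hA _ _ π h2 neg R t) φ N true _ (s.extend a) r hφ h1 h1
      fun x hx => ?_
    have h4 := look_assignmentEnv s ⟨x, h3 hx⟩
    simpa [lookD, Assignment.extend, h3 hx] using h4
  rw [decideValue]
  constructor
  · intro h
    rcases h1 : readTable N A.card (cappedArities N τ) wt with _ | ⟨tab, r⟩
    · simp [h1] at h
    rw [h1, Option.elim_some] at h
    dsimp only at h
    cases h2 : decide (r.length = 0)
    · rw [h2, cond_false] at h
      exact absurd h Bool.false_ne_true
    rw [h2, cond_true] at h
    obtain rfl : r = [] := by simpa using h2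
    obtain ⟨π, rfl, rfl⟩ := (readTable_eq_some hA hwt).1 h1
    rcases h3 : peval ord O (N, A.card, cappedArities N τ, interpTable π, false) N true
      (assignmentEnv s) wf with _ | ⟨v, r⟩
    · simp [h3] at h
    obtain ⟨φ, h4, rfl, h5⟩ := exists_of_peval hA (arities_cappedArities N τ) hnum N true _ wf r v
      hwf h3
    have h6 : φ.FV ⊆ s.dom := fun x hx => mem_dom_of_look (h5 x hx)
    rw [heval φ r π h4 hwf hwt h6] at h
    exact ⟨φ, r, π, h4, rfl, rfl, h6, by simpa [keq] using h⟩
  · rintro ⟨φ, r, π, h1, rfl, rfl, h2, h3⟩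
    rw [cappedArities, (readTable_eq_some hA hwt).2 ⟨π, rfl, rfl⟩, ← cappedArities,
      Option.elim_some]
    dsimp only
    rw [heval φ r π h1 hwf hwt h2]
    simpa [keq] using h3

theorem encode_eq (I : MCInstance K) : I.encode = tcode K I.voc.tokens ++
    (tcode K (setTokens I.A) ++ (tcode K I.φ.tokens ++ (tcode K I.s.tokens ++ encInterp I.π))) := by
  have : (fun n => (natCode n).map fun b => if b then (1 : K) else 0) = numCode K := rfl
  rw [MCInstance.encode, List.map_flatMap, this]
  simp only [tcode, List.flatMap_append, List.append_assoc]

theorem decideMC_iff {w : List K} : decideMC ord O w = true ↔ w ∈ MC ord O := by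
  rw [decideMC_iff_exists]
  have hnum : ∀ (τ : Vocabulary) (r : List K), τ.num ≤ (tcode K τ.tokens ++ r).length + 1 := by
    intro τ r
    have h1 := length_le_tcode (K := K) τ.tokens
    have h2 : τ.tokens.length = τ.num + 1 := by simp [Vocabulary.tokens]
    rw [List.length_append]
    omega
  constructor
  · rintro ⟨τ, r₁, rfl, h⟩
    have hτ := hnum τ r₁
    rw [decideUniverse_iff (by simp)] at h
    obtain ⟨A, r₂, hA, rfl, h⟩ := h
    rw [peval_skip_iff hτ (by simp; omega)] at h
    obtain ⟨φ, r₃, hφ, rfl, h⟩ := h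
    rw [decideAssignment_iff (by simp; omega)] at h
    obtain ⟨s, r₄, rfl, h⟩ := h
    rw [decideValue_iff hτ ⟨A.min' hA, A.min'_mem hA⟩ s (by simp; omega) (by simp; omega)] at h
    obtain ⟨ψ, r₅, π, hψ, h, rfl, hs, hv⟩ := h
    -- The two runs of the evaluator yield formulas `φ` and `ψ` that need not be the same a priori.
    -- It suffices that they leave the same remaining word; the instance is built with `ψ`, whose
    -- value is known.
    have h5 := tokens_append_cancel hφ hψ h
    rw [h, ← h5]
    exact ⟨⟨τ, A, hA, ψ, s, hs, π⟩, hψ, hv, encode_eq _⟩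
  · rintro ⟨⟨τ, A, hA, φ, s, hs, π⟩, hφ, hv, rfl⟩
    rw [encode_eq]
    dsimp only
    refine ⟨τ, _, rfl, ?_⟩
    have hτ := hnum τ (tcode K (setTokens A) ++ (tcode K φ.tokens ++
      (tcode K s.tokens ++ encInterp π)))
    refine (decideUniverse_iff (by simp)).2 ⟨A, _, hA, rfl, ?_⟩
    refine (peval_skip_iff hτ (by simp; omega) _).2 ⟨φ, _, hφ, rfl, ?_⟩
    refine (decideAssignment_iff (by simp; omega)).2 ⟨s, _, rfl, ?_⟩
    exact (decideValue_iff hτ ⟨A.min' hA, A.min'_mem hA⟩ s (by simp; omega) (by simp; omega)).2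
      ⟨φ, _, π, hφ, rfl, rfl, hs, hv⟩

end Decision

end SemiringFO

end

theorem mainTheorem4 {K : Type*} [CommSemiring K] [Nontrivial K]
    (ord : Option (SemiringFO.SemiringOrder K)) (O : Set SemiringFO.Cmp)
    (hO : SemiringFO.Cmp.le ∈ O ∨ SemiringFO.Cmp.nle ∈ O → ord.isSome) :
    SemiringFO.MC ord O ∈ SemiringFO.PSPACE ord :=
  SemiringFO.mem_PSPACE_of_ps (SemiringFO.ps_decideMC O) fun _ => SemiringFO.decideMC_iff
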